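/- For a group $G$ let $\mathrm{Hol}(G)=G\rtimes \mathrm{Aut}(G)$ be its holomorph. Let $C_k$ be the cyclic group of order $k$ and $1^n$ the elementary abelian group of order $2^n$. Write $g^h=h^{-1}gh$ and $(g,h)=g^{-1}h^{-1}gh$. Let $x=2^m$ with $m\ge 2$, $t=x/2=2^{m-1}$, and $n\ge 0$. **General structure.** There is a group extension $$1\to 1^{n+1}\times 1^{n+1}\to \mathrm{Hol}(C_x\times 1^n)\to \mathrm{Hol}(1^n)\times \mathrm{Hol}(C_{t})\to 1,$$ that is, $\mathrm{Hol}(C_x\times 1^n)$ has the structure $[1^{n+1}\times 1^{n+1}]\cdot[\mathrm{Hol}(1^n)\times\mathrm{Hol}(C_{t})]$; for $m\ge 3$ the extension can be chosen not to split (so that it is not a semidirect product). For the presentations below let $m\ge 3$, $n_1=2^m$, $n_2=2^{m-2}$, $n_3=n_1/2$, $n_4=n_2/2$. We say that a group $P$ with subgroups $A,D,X,Y$ *has the form* $[A\times D]\cdot[X\times Y]$ if there is an extension $1\to 1^{n+1}\times 1^{n+1}\to P\to \mathrm{Hol}(1^n)\times \mathrm{Hol}(C_t)\to 1$ in which $A$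 and $D$ are the images of the two factors $1^{n+1}$, $X$ maps isomorphically onto $\mathrm{Hol}(1^n)\times 1$, and $Y$ maps onto $1\times\mathrm{Hol}(C_t)$. **The case $n=2$.** $\mathrm{Hol}(1^2)\cong S_4$, presented by $\langle x,y\mid x^4=y^4=x^2yx^{-2}y=xyx(yxy)^{-1}=1\rangle$. The group $P$ on generators $a,b,c,d,e,f,x,y,s,t,u$ with the following relations is isomorphic to $\mathrm{Hol}(C_{2^m}\times 1^2)$: * $a,b,c,d,e,f$ have square $1$ and commute with each other; * $x^4=y^4=x^2yx^{-2}y=xyx(yxy)^{-1}=1$; * $(a,x)=b^xab=c^xabc=(a,y)=b^yabc=c^yac=1$ and $(d,x)=e^xde=f^xdef=(d,y)=e^ydef=f^ydf=1$; * $s^{n_1}=t^{n_2}=u^2=(t,u)=s^ts^{-5}=s^us=1$, $s^{n_3}a=t^{n_4}d=1$; * $(a,s)=(b,s)=(c,s)=d^sad=e^sbe=f^scf=1$; * $t$ and $u$ commute with $a,b,c,d,e,f$; and $x,y$ commute with $s,t,u$. Moreover $P$ has the form $[\langle a,b,c\rangle\times\langle d,e,f\rangle]\cdot[\langle x,y\rangle\times\langle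 s,t,u\rangle]$ with $n=2$. **The case $n=3$.** Let $$t_1=\begin{pmatrix}1&0&0&0\\0&1&0&0\\0&0&1&0\\1&0&0&1\end{pmatrix},\; t_2=\begin{pmatrix}1&0&0&0\\0&1&0&0\\0&0&1&0\\0&1&0&1\end{pmatrix},\; t_3=\begin{pmatrix}1&0&0&0\\0&1&0&0\\0&0&0&1\\0&0&1&0\end{pmatrix},\; t_4=\begin{pmatrix}1&0&0&0\\0&0&1&0\\0&1&0&0\\0&0&0&1\end{pmatrix}$$ over $\mathbb F_2$. The subgroup of $GL_4(\mathbb F_2)$ generated by $t_1,\dots,t_4$ is isomorphic to $\mathrm{Hol}(1^3)$, which has order $1344$, and is presented on these generators by $$\begin{aligned}t_1^2&=t_2^2=t_3^2=t_4^2=(t_1,t_2)=(t_1,t_4)=(t_3t_4)^3=(t_1t_4)^4=(t_1t_3t_2t_3)^2=(t_2t_3)^4=(t_2t_4)^4=(t_2t_3t_4t_3)^3\\&=t_1t_2t_4t_3t_1t_3t_4t_2t_4t_3t_1t_3t_4=t_2t_3t_2t_3t_4t_2t_4t_3t_2t_3t_4t_2t_4=1.\end{aligned}$$ The group on generators $a_1,b_1,c_1,d_1,a_2,b_2,c_2,d_2,t_1,\dots,t_4,s,t,u$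 with the following relations is isomorphic to $\mathrm{Hol}(C_{2^m}\times 1^3)$: * $a_1,\dots,d_2$ have square $1$ and commute with each other; * the above relations among $t_1,\dots,t_4$; * each $t_i$ acts by conjugation $g\mapsto g^{t_i}$ on $(a_1,b_1,c_1,d_1)$, and in the same way on $(a_2,b_2,c_2,d_2)$, through its matrix: row $j$ lists the exponents of the image of the $j$-th generator (for example $d_1^{t_1}=a_1d_1$); * $s^{n_1}=t^{n_2}=u^2=(t,u)=s^ts^{-5}=s^us=1$, $s^{n_3}a_1=t^{n_4}a_2=1$; * $s$ commutes with $a_1,b_1,c_1,d_1$, and $a_2^sa_1a_2=b_2^sb_1b_2=c_2^sc_1c_2=d_2^sd_1d_2=1$; * $t$ and $u$ commute with $a_1,\dots,d_2$; and $t_1,\dots,t_4$ commute with $s,t,u$. It has the form $[\langle a_1,b_1,c_1,d_1\rangle\times\langle a_2,b_2,c_2,d_2\rangle]\cdot[\langle t_1,\dots,t_4\rangle\times\langle s,t,u\rangle]$ with $n=3$. Finally, $|\mathrm{Hol}(1^4)|=322560$. -/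

import Mathlib

/-- The holomorph of a group: the semidirect product of the group with its full automorphism
group. -/
abbrev Hol (G : Type*) [Group G] : Type _ := G ⋊[MonoidHom.id (MulAut G)] MulAut G

/-- The cyclic group of order `k`, written multiplicatively. -/
abbrev Cyc (k : ℕ) : Type := Multiplicative (ZMod k)

/-- The elementary abelian group `1^n` of order `2 ^ n`, written multiplicatively. -/
abbrev Elem (n : ℕ) : Type := Multiplicative (Fin n → ZMod 2)

/-- `g ^ h = h⁻¹ g h`. -/
def cnj {G : Type*} [Group G] (g h : G) : G := h⁻¹ * g * h

/-- `(g, h) = g⁻¹ h⁻¹ g h`. -/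
def cmt {G : Type*} [Group G] (g h : G) : G := g⁻¹ * h⁻¹ * g * h

/-- The group `P` has the form `[1^(n+1) × 1^(n+1)] · [Hol(1^n) × Hol(C_t)]`, `t = 2^(m-1)`, where
`A` and `D` are the two factors of the normal subgroup, `X` is a subgroup that maps isomorphically
onto the factor `Hol(1^n)` of the quotient, and `Y` is a subgroup that maps onto the factor
`Hol(C_t)`. -/
def HasHolForm (n m : ℕ) {P : Type*} [Group P] (A D X Y : Subgroup P) : Prop :=
  ∃ S : GroupExtension (Elem (n + 1) × Elem (n + 1)) P
      (Hol (Elem n) × Hol (Cyc (2 ^ (m - 1)))),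
    A = (Subgroup.prod ⊤ ⊥).map S.inl ∧
    D = (Subgroup.prod ⊥ ⊤).map S.inl ∧
    Set.InjOn S.rightHom X ∧
    X.map S.rightHom = Subgroup.prod ⊤ ⊥ ∧
    Y.map S.rightHom = Subgroup.prod ⊥ ⊤

/-- The two relations besides `x^4 = y^4 = 1` say that `x^2` inverts `y` and that `x`, `y` satisfy
the braid relation. They are stated for arbitrary elements, so as to be used in several groups. -/
def s4Relators {G : Type*} [Group G] (x y : G) : Set G :=
  {x ^ 4, y ^ 4, x ^ 2 * y * (x ^ 2)⁻¹ * y, x * y * x * (y * x * y)⁻¹}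

/-- The relators among `s`, `t`, `u` with `n1 = 2^m` and `n2 = 2^(m-2)`. -/
def stuRelators {G : Type*} [Group G] (m : ℕ) (s t u : G) : Set G :=
  {s ^ (2 ^ m), t ^ (2 ^ (m - 2)), u ^ 2, cmt t u, cnj s t * (s ^ 5)⁻¹, cnj s u * s}

/-- The generators of the presentation for `n = 2`. -/
inductive Gen2 : Type
  | a | b | c | d | e | f | x | y | s | t | u

/-- The relators of the presentation for `n = 2`. -/
def relators2 (m : ℕ) : Set (FreeGroup Gen2) :=
  let a := FreeGroup.of Gen2.a
  let b := FreeGroup.of Gen2.b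
  let c := FreeGroup.of Gen2.c
  let d := FreeGroup.of Gen2.d
  let e := FreeGroup.of Gen2.e
  let f := FreeGroup.of Gen2.f
  let x := FreeGroup.of Gen2.x
  let y := FreeGroup.of Gen2.y
  let s := FreeGroup.of Gen2.s
  let t := FreeGroup.of Gen2.t
  let u := FreeGroup.of Gen2.u
  -- the group `1^3 × 1^3`
  {a ^ 2, b ^ 2, c ^ 2, d ^ 2, e ^ 2, f ^ 2,
    cmt a b, cmt a c, cmt a d, cmt a e, cmt a f, cmt b c, cmt b d, cmt b e, cmt b f,
    cmt c d, cmt c e, cmt c f, cmt d e, cmt d f, cmt e f} ∪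
  -- the group `Hol(1^2)`, and its action on `1^3 × 1^3`
  s4Relators x y ∪
  {cmt a x, cnj b x * a * b, cnj c x * a * b * c, cmt a y, cnj b y * a * b * c, cnj c y * a * c,
    cmt d x, cnj e x * d * e, cnj f x * d * e * f, cmt d y, cnj e y * d * e * f,
    cnj f y * d * f} ∪
  -- the part belonging to `Hol(C_t)`
  stuRelators m s t u ∪
  {s ^ (2 ^ m / 2) * a, t ^ (2 ^ (m - 2) / 2) * d} ∪
  -- the action of that part on `1^3 × 1^3`
  {cmt a s, cmt b s, cmt c s, cnj d s * a * d, cnj e s * b * e, cnj f s * c * f,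
    cmt a t, cmt b t, cmt c t, cmt d t, cmt e t, cmt f t,
    cmt a u, cmt b u, cmt c u, cmt d u, cmt e u, cmt f u} ∪
  -- `Hol(1^2)` commutes with that part
  {cmt s x, cmt s y, cmt t x, cmt t y, cmt u x, cmt u y}

/-- The group presented for `n = 2`. -/
abbrev Pres2 (m : ℕ) : Type := PresentedGroup (relators2 m)

/-- The four matrices `t_1, t_2, t_3, t_4` (indexed from `0`). -/
def holMat : Fin 4 → Matrix (Fin 4) (Fin 4) (ZMod 2) :=
  ![!![1, 0, 0, 0; 0, 1, 0, 0; 0, 0, 1, 0; 1, 0, 0, 1],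
    !![1, 0, 0, 0; 0, 1, 0, 0; 0, 0, 1, 0; 0, 1, 0, 1],
    !![1, 0, 0, 0; 0, 1, 0, 0; 0, 0, 0, 1; 0, 0, 1, 0],
    !![1, 0, 0, 0; 0, 0, 1, 0; 0, 1, 0, 0; 0, 0, 0, 1]]

/-- The relators among `t_1, t_2, t_3, t_4` that define `Hol(1^3)`. -/
def hol3Relators {G : Type*} [Group G] (t₁ t₂ t₃ t₄ : G) : Set G :=
  {t₁ ^ 2, t₂ ^ 2, t₃ ^ 2, t₄ ^ 2, cmt t₁ t₂, cmt t₁ t₄, (t₃ * t₄) ^ 3, (t₁ * t₄) ^ 4,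
    (t₁ * t₃ * t₂ * t₃) ^ 2, (t₂ * t₃) ^ 4, (t₂ * t₄) ^ 4, (t₂ * t₃ * t₄ * t₃) ^ 3,
    t₁ * t₂ * t₄ * t₃ * t₁ * t₃ * t₄ * t₂ * t₄ * t₃ * t₁ * t₃ * t₄,
    t₂ * t₃ * t₂ * t₃ * t₄ * t₂ * t₄ * t₃ * t₂ * t₃ * t₄ * t₂ * t₄}

/-- The abstract group given by the presentation of `Hol(1^3)` on `t_1, t_2, t_3, t_4`. -/
abbrev PresHol3 : Type :=
  PresentedGroup (hol3Relators (FreeGroup.of (0 : Fin 4)) (FreeGroup.of 1) (FreeGroup.of 2)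
    (FreeGroup.of 3))

/-- The generators of the presentation for `n = 3`: `p 0, …, p 3` are `a_1, b_1, c_1, d_1`;
`q 0, …, q 3` are `a_2, b_2, c_2, d_2`; and `h 0, …, h 3` are `t_1, …, t_4`. -/
inductive Gen3 : Type
  | p (j : Fin 4)
  | q (j : Fin 4)
  | h (i : Fin 4)
  | s | t | u

/-- The relators of the presentation for `n = 3`. -/
def relators3 (m : ℕ) : Set (FreeGroup Gen3) :=
  let p : Fin 4 → FreeGroup Gen3 := fun j => FreeGroup.of (Gen3.p j)
  let q : Fin 4 → FreeGroup Gen3 := fun j => FreeGroup.of (Gen3.q j)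
  let h : Fin 4 → FreeGroup Gen3 := fun i => FreeGroup.of (Gen3.h i)
  let s := FreeGroup.of Gen3.s
  let t := FreeGroup.of Gen3.t
  let u := FreeGroup.of Gen3.u
  -- the group `1^4 × 1^4`
  {r | ∃ j, r = p j ^ 2 ∨ r = q j ^ 2} ∪
  {r | ∃ j k, r = cmt (p j) (p k) ∨ r = cmt (p j) (q k) ∨ r = cmt (q j) (q k)} ∪
  -- the group `Hol(1^3)`; row `j` of the `i`-th matrix lists the exponents in the conjugate of
  -- the `j`-th generator of either factor `1^4` by the `i`-th generator of `Hol(1^3)`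
  hol3Relators (h 0) (h 1) (h 2) (h 3) ∪
  {r | ∃ i j, r = cnj (p j) (h i) * (List.ofFn fun k => p k ^ (holMat i j k).val).prod⁻¹} ∪
  {r | ∃ i j, r = cnj (q j) (h i) * (List.ofFn fun k => q k ^ (holMat i j k).val).prod⁻¹} ∪
  -- the part belonging to `Hol(C_t)`
  stuRelators m s t u ∪
  {s ^ (2 ^ m / 2) * p 0, t ^ (2 ^ (m - 2) / 2) * q 0} ∪
  -- the action of that part on `1^4 × 1^4`
  {r | ∃ j, r = cmt (p j) s ∨ r = cnj (q j) s * p j * q j} ∪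
  {r | ∃ j, r = cmt (p j) t ∨ r = cmt (q j) t ∨ r = cmt (p j) u ∨ r = cmt (q j) u} ∪
  -- `Hol(1^3)` commutes with that part
  {r | ∃ i, r = cmt s (h i) ∨ r = cmt t (h i) ∨ r = cmt u (h i)}

/-- The group presented for `n = 3`. -/
abbrev Pres3 (m : ℕ) : Type := PresentedGroup (relators3 m)

/-! Let `G = C_x × 1^n` with `x = 2^(k+2)`, and let `Ω ≅ 1^(n+1)` be its subgroup of elements of
order at most 2. An automorphism of `G` restricts to `Ω` and acts on `G/Ω ≅ C_(x/2)`. The group `G`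
has exactly one nontrivial `2^(k+1)`-th power, which every automorphism fixes. So the restriction
lies in the stabilizer of a nonzero vector in `GL_(n+1)(𝔽₂)`, and this stabilizer is an affine
group, that is, `Hol(1^n)`. The two actions together give `holRight : Hol(G) → Hol(1^n) ×
Hol(C_(x/2))`. Its kernel consists of the translations by `Ω` and of the automorphisms trivial on
both `Ω` and `G/Ω`; the latter multiply the cyclic generator by an element of `Ω`. This is `1^(n+1)
× 1^(n+1)` (`range_holInl`). Surjectivity comes from explicit matrix automorphisms and from the
units of `ℤ/x`.

The extension does not split for `k ≥ 1`: multiplying the translation `s` by the cyclic generator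
with a kernel element does not change its fourth power (`mul_shift_pow_four`). So every lift of the
image of `s` has the same nontrivial `2^(k+1)`-th power, although that power is trivial in the
quotient.

For the presentations, explicit elements of the holomorph satisfy the relators, and the resulting
map is onto (`surjective_of_generators`). It is injective by counting. The relations make the
subgroup `N` of the two elementary abelian factors normal, and adjoining `Hol(1^n)`, `s`, `t`, `u`
in turn gives a tower that bounds the order (`finite_card_of_relations`, `bijective_of_relations`).
Since `5^(2^k) ≡ 1 + 2^(k+2)` modulo `2^(k+3)`, already `t^(2^k)` lies in `N`, and the bound is
exactly the order of the holomorph.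

This needs the relators of `Hol(1^2)` and `Hol(1^3)` to define these groups. Coset enumerations give
the upper bounds 24 and 1344 (`finite_card_S4_le`, `finite_card_hol3_le`), and the matrix groups
attain them. -/

section

/-! ### Automorphisms of `1^k` as invertible matrices over `𝔽₂` -/

open Matrix

/-- The action of `GL_k(𝔽₂)` on the columns. -/
def colAct (k : ℕ) : GL (Fin k) (ZMod 2) →* MulAut (Elem k) where
  toFun A :=
    { toFun := fun x => .ofAdd ((A : Matrix (Fin k) (Fin k) (ZMod 2)) *ᵥ x.toAdd)
      invFun := fun x => .ofAdd ((A⁻¹ : GL (Fin k) (ZMod 2)).val *ᵥ x.toAdd)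
      left_inv := fun x => by
        simp only [toAdd_ofAdd, mulVec_mulVec, ← Units.val_mul, inv_mul_cancel, Units.val_one,
          one_mulVec, ofAdd_toAdd]
      right_inv := fun x => by
        simp only [toAdd_ofAdd, mulVec_mulVec, ← Units.val_mul, mul_inv_cancel, Units.val_one,
          one_mulVec, ofAdd_toAdd]
      map_mul' := fun x y => by simp only [toAdd_mul, mulVec_add, ofAdd_add] }
  map_one' := by ext x : 1; simp
  map_mul' A B := by
    ext x : 1
    simp [MulAut.mul_apply, mulVec_mulVec]

lemma colAct_apply {k : ℕ} (A : GL (Fin k) (ZMod 2)) (x : Elem k) :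
    colAct k A x = .ofAdd ((A : Matrix (Fin k) (Fin k) (ZMod 2)) *ᵥ x.toAdd) := rfl

/-- The matrix of an endomorphism of `1^k`, acting on columns. -/
lemma exists_mulVec_of_hom {k l : ℕ} (f : Elem k →* Elem l) :
    ∃ M : Matrix (Fin l) (Fin k) (ZMod 2), ∀ x, f x = .ofAdd (M *ᵥ x.toAdd) := by
  let g : (Fin k → ZMod 2) →+ (Fin l → ZMod 2) :=
    AddMonoidHom.mk' (fun x => (f (.ofAdd x)).toAdd) fun x y => by
      rw [ofAdd_add, map_mul, toAdd_mul]
  refine ⟨LinearMap.toMatrix' (g.toZModLinearMap 2), fun x => ?_⟩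
  rw [LinearMap.toMatrix'_mulVec]
  rfl

/-- Automorphisms of `1^k` are `𝔽₂`-linear, so an automorphism and its inverse both have matrices,
and these are inverse to each other. -/
lemma colAct_bijective (k : ℕ) : Function.Bijective (colAct k) := by
  constructor
  · intro A B h
    refine Units.ext (Matrix.ext_of_mulVec_single fun i => ?_)
    exact congrArg Multiplicative.toAdd (DFunLike.congr_fun h (.ofAdd (Pi.single i 1)))
  · intro ψ
    obtain ⟨M, hM⟩ := exists_mulVec_of_hom (ψ : Elem k →* Elem k)
    obtain ⟨N, hN⟩ := exists_mulVec_of_hom (ψ⁻¹ : MulAut (Elem k)).toMonoidHom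
    have hM' : ∀ x, ψ x = .ofAdd (M *ᵥ x.toAdd) := hM
    have hN' : ∀ x, ψ⁻¹ x = .ofAdd (N *ᵥ x.toAdd) := hN
    refine ⟨⟨M, N, ?_, ?_⟩, ?_⟩
    · refine Matrix.ext_of_mulVec_single fun i => ?_
      have := MulAut.apply_inv_self _ ψ (.ofAdd (Pi.single i 1))
      rw [hM', hN'] at this
      rw [← mulVec_mulVec, one_mulVec]
      exact this
    · refine Matrix.ext_of_mulVec_single fun i => ?_
      have := MulAut.inv_apply_self _ ψ (.ofAdd (Pi.single i 1))
      rw [hM', hN'] at this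
      rw [← mulVec_mulVec, one_mulVec]
      exact this
    · ext x : 1
      exact (hM' x).symm

/-- The action of `GL_k(𝔽₂)` on the rows, through the inverse. -/
def rowAct (k : ℕ) : GL (Fin k) (ZMod 2) →* MulAut (Elem k) where
  toFun A :=
    { toFun := fun x => .ofAdd (x.toAdd ᵥ* (A⁻¹ : GL (Fin k) (ZMod 2)).val)
      invFun := fun x => .ofAdd (x.toAdd ᵥ* (A : Matrix (Fin k) (Fin k) (ZMod 2)))
      left_inv := fun x => by
        simp only [toAdd_ofAdd, vecMul_vecMul, ← Units.val_mul, inv_mul_cancel, Units.val_one,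
          vecMul_one, ofAdd_toAdd]
      right_inv := fun x => by
        simp only [toAdd_ofAdd, vecMul_vecMul, ← Units.val_mul, mul_inv_cancel, Units.val_one,
          vecMul_one, ofAdd_toAdd]
      map_mul' := fun x y => by simp only [toAdd_mul, add_vecMul, ofAdd_add] }
  map_one' := by ext x : 1; simp
  map_mul' A B := by
    ext x : 1
    simp only [MulAut.mul_apply, MulEquiv.coe_mk, Equiv.coe_fn_mk, toAdd_ofAdd, vecMul_vecMul,
      _root_.mul_inv_rev, Units.val_mul]

lemma rowAct_apply {k : ℕ} (A : GL (Fin k) (ZMod 2)) (x : Elem k) :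
    rowAct k A x = .ofAdd (x.toAdd ᵥ* (A⁻¹ : GL (Fin k) (ZMod 2)).val) := rfl

lemma rowAct_inv_apply {k : ℕ} (A : GL (Fin k) (ZMod 2)) (x : Elem k) :
    (rowAct k A)⁻¹ x = .ofAdd (x.toAdd ᵥ* A.val) := rfl

/-- Surjectivity is transposed from the columns: the inverse transpose of `C` acts on rows as `C`
acts on columns. -/
lemma rowAct_bijective (k : ℕ) : Function.Bijective (rowAct k) := by
  constructor
  · intro A B h
    refine inv_injective (Units.ext (Matrix.ext_of_single_vecMul fun i => ?_))
    exact congrArg Multiplicative.toAdd (DFunLike.congr_fun h (.ofAdd (Pi.single i 1)))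
  · intro ψ
    obtain ⟨C, rfl⟩ := (colAct_bijective k).2 ψ
    refine ⟨⟨(C⁻¹).valᵀ, C.valᵀ, ?_, ?_⟩, ?_⟩
    · rw [← transpose_mul, ← Units.val_mul, mul_inv_cancel, Units.val_one, transpose_one]
    · rw [← transpose_mul, ← Units.val_mul, inv_mul_cancel, Units.val_one, transpose_one]
    · ext x : 1
      rw [rowAct_apply, colAct_apply]
      simp only [Units.inv_mk, vecMul_transpose]

/-! ### The stabilizer of a vector as the affine group `Hol(1^n)` -/

/-- The stabilizer of the first basis row in `GL_{n+1}(𝔽₂)`. -/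
def Aff (n : ℕ) : Subgroup (GL (Fin (n + 1)) (ZMod 2)) where
  carrier := {B | Pi.single 0 1 ᵥ* B.val = Pi.single 0 1}
  one_mem' := vecMul_one _
  mul_mem' {A B} hA hB := by
    simp only [Set.mem_ofPred_eq] at *
    rw [Units.val_mul, ← vecMul_vecMul, hA, hB]
  inv_mem' {A} hA := by
    simp only [Set.mem_ofPred_eq] at *
    conv_lhs => rw [← hA]
    rw [vecMul_vecMul, ← Units.val_mul, mul_inv_cancel, Units.val_one, vecMul_one]

lemma mem_Aff {n : ℕ} {B : GL (Fin (n + 1)) (ZMod 2)} :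
    B ∈ Aff n ↔ Pi.single 0 1 ᵥ* B.val = Pi.single 0 1 := Iff.rfl

lemma Aff_row_zero {n : ℕ} (B : Aff n) (k : Fin n) : B.1.val 0 k.succ = 0 := by
  have := congrFun B.2 k.succ
  rwa [single_one_vecMul, Pi.single_eq_of_ne (Fin.succ_ne_zero k)] at this

lemma Aff_zero_zero {n : ℕ} (B : Aff n) : B.1.val 0 0 = 1 := by
  have := congrFun B.2 0
  rwa [single_one_vecMul, Pi.single_eq_same] at this

/-- The lower right block of an element of `Aff n`. -/
def affBlock (n : ℕ) : Aff n →* GL (Fin n) (ZMod 2) :=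
  MonoidHom.toHomUnits
    { toFun := fun B => Matrix.of fun j k => B.1.val j.succ k.succ
      map_one' := by
        ext j k
        simp [Matrix.one_apply, Fin.succ_inj]
      map_mul' := fun B C => by
        ext j k
        simp [Matrix.mul_apply, Fin.sum_univ_succ, Aff_row_zero] }

lemma affBlock_apply {n : ℕ} (B : Aff n) (j k : Fin n) :
    (affBlock n B).val j k = B.1.val j.succ k.succ := rfl

/-- The matrix of the affine map `x ↦ v + M x`. -/
def affMat {n : ℕ} (v : Fin n → ZMod 2) (M : Matrix (Fin n) (Fin n) (ZMod 2)) :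
    Matrix (Fin (n + 1)) (Fin (n + 1)) (ZMod 2) :=
  Matrix.of (Fin.cons (Pi.single 0 1) fun j => Fin.cons (v j) (M j))

lemma affMat_mul {n : ℕ} (v w : Fin n → ZMod 2) (M N : Matrix (Fin n) (Fin n) (ZMod 2)) :
    affMat v M * affMat w N = affMat (v + M *ᵥ w) (M * N) := by
  ext i j
  refine Fin.cases ?_ (fun i => ?_) i <;> refine Fin.cases ?_ (fun j => ?_) j <;>
    simp [affMat, Matrix.mul_apply, Fin.sum_univ_succ, mulVec, dotProduct]

lemma affMat_zero_one (n : ℕ) : affMat (0 : Fin n → ZMod 2) 1 = 1 := by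
  ext i j
  refine Fin.cases ?_ (fun i => ?_) i <;> refine Fin.cases ?_ (fun j => ?_) j <;>
    simp [affMat, Matrix.one_apply, Fin.succ_inj, Fin.succ_ne_zero, (Fin.succ_ne_zero _).symm]

/-- The stabilizer of the first basis row is the holomorph of `1^n`. -/
def affHom (n : ℕ) : Aff n →* Hol (Elem n) where
  toFun B := ⟨.ofAdd fun j => B.1.val j.succ 0, colAct n (affBlock n B)⟩
  map_one' := by
    refine SemidirectProduct.ext ?_ (by simp)
    exact congrArg Multiplicative.ofAdd (funext fun j => by simp)
  map_mul' B C := by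
    refine SemidirectProduct.ext ?_ (by simp)
    refine congrArg Multiplicative.ofAdd (funext fun j => ?_)
    simp [Matrix.mul_apply, Fin.sum_univ_succ, colAct_apply, mulVec, dotProduct, affBlock_apply,
      Aff_zero_zero]

/-- The first row is `(1, 0, …, 0)`, so the rest of the first column (the translation) and the lower
right block (the linear part) determine the matrix and are arbitrary. -/
lemma affHom_bijective (n : ℕ) : Function.Bijective (affHom n) := by
  constructor
  · intro B C h
    have h1 : ∀ j : Fin n, B.1.val j.succ 0 = C.1.val j.succ 0 := fun j =>
      congrFun (congrArg (fun x : Hol (Elem n) => x.left.toAdd) h) j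
    have h2 : affBlock n B = affBlock n C :=
      (colAct_bijective n).1 (congrArg (fun x : Hol (Elem n) => x.right) h)
    refine Subtype.ext (Units.ext ?_)
    ext i j
    refine Fin.cases ?_ (fun i => ?_) i <;> refine Fin.cases ?_ (fun j => ?_) j
    · rw [Aff_zero_zero, Aff_zero_zero]
    · rw [Aff_row_zero, Aff_row_zero]
    · exact h1 i
    · rw [← affBlock_apply, ← affBlock_apply, h2]
  · rintro ⟨v, ψ⟩
    obtain ⟨M, rfl⟩ := (colAct_bijective n).2 ψ
    -- The inverse of `x ↦ v + M x` is `x ↦ -M⁻¹ v + M⁻¹ x`.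
    refine ⟨⟨⟨affMat v.toAdd M.val, affMat (-((M⁻¹).val *ᵥ v.toAdd)) (M⁻¹).val, ?_, ?_⟩, ?_⟩, ?_⟩
    · rw [affMat_mul, mulVec_neg, mulVec_mulVec, ← Units.val_mul, mul_inv_cancel, Units.val_one,
        one_mulVec, add_neg_cancel, affMat_zero_one]
    · rw [affMat_mul, ← Units.val_mul, inv_mul_cancel, Units.val_one, neg_add_cancel,
        affMat_zero_one]
    · rw [mem_Aff, single_one_vecMul]
      rfl
    · refine SemidirectProduct.ext rfl (congrArg (colAct n) ?_)
      exact Units.ext rfl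

/-- The stabilizer of the first basis row is isomorphic to the holomorph of `1^n`. -/
noncomputable def affEquiv (n : ℕ) : Aff n ≃* Hol (Elem n) :=
  MulEquiv.ofBijective (affHom n) (affHom_bijective n)

instance (k : ℕ) : Finite (MulAut (Elem k)) :=
  Finite.of_surjective _ (colAct_bijective k).2

instance (n : ℕ) : Finite (Hol (Elem n)) := Finite.of_equiv _ SemidirectProduct.equivProd.symm

lemma card_hol_elem (n : ℕ) :
    Nat.card (Hol (Elem n)) = 2 ^ n * ∏ i : Fin n, (2 ^ n - 2 ^ (i : ℕ)) := by
  rw [SemidirectProduct.card,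
    ← Nat.card_congr (Equiv.ofBijective _ (colAct_bijective n)), Matrix.card_GL_field]
  simp [Nat.card_eq_fintype_card, ZMod.card]

/-! ### The elements of order at most 2 and the quotient by them -/

/-- The group `C_{2^(k+2)} × 1^n`. -/
abbrev CE (k n : ℕ) : Type := Cyc (2 ^ (k + 2)) × Elem n

/-- The reduction of `ℤ/2^(k+2)` modulo `2^(k+1)`. -/
def red (k : ℕ) : ZMod (2 ^ (k + 2)) →+* ZMod (2 ^ (k + 1)) :=
  ZMod.castHom (pow_dvd_pow 2 (Nat.le_succ _)) _

/-- The reduction of `ℤ/2^(k+2)` modulo `2`. -/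
def par (k : ℕ) : ZMod (2 ^ (k + 2)) →+* ZMod 2 :=
  ZMod.castHom (dvd_pow_self 2 (Nat.succ_ne_zero _)) _

lemma zmultiples_two_pow_two (k : ℕ) :
    zmultiplesHom (ZMod (2 ^ (k + 2))) (2 ^ (k + 1)) ((2 : ℕ) : ℤ) = 0 := by
  have : ((2 ^ (k + 2) : ℕ) : ZMod (2 ^ (k + 2))) = 0 := ZMod.natCast_self _
  push_cast at this
  simp only [zmultiplesHom_apply, Nat.cast_ofNat, zsmul_eq_mul, Int.cast_ofNat]
  rw [← this]
  ring

/-- The inclusion of `ℤ/2` as the subgroup of order `2` of `ℤ/2^(k+2)`. -/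
def half (k : ℕ) : ZMod 2 →+ ZMod (2 ^ (k + 2)) :=
  ZMod.lift 2 ⟨zmultiplesHom _ (2 ^ (k + 1)), zmultiples_two_pow_two k⟩

lemma half_natCast (k j : ℕ) : half k j = j * 2 ^ (k + 1) := by
  have := ZMod.lift_coe 2 ⟨zmultiplesHom _ (2 ^ (k + 1)), zmultiples_two_pow_two k⟩ (j : ℤ)
  simpa [half] using this

lemma half_one (k : ℕ) : half k 1 = 2 ^ (k + 1) := by
  simpa using half_natCast k 1

lemma half_one_ne_zero (k : ℕ) : half k 1 ≠ 0 := by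
  rw [half_one]
  have : ((2 ^ (k + 1) : ℕ) : ZMod (2 ^ (k + 2))) ≠ 0 := by
    rw [Ne, ZMod.natCast_eq_zero_iff, Nat.pow_dvd_pow_iff_le_right (by norm_num)]
    omega
  simpa using this

lemma half_par (k : ℕ) (c : ZMod (2 ^ (k + 2))) : half k (par k c) = c * 2 ^ (k + 1) := by
  obtain ⟨j, rfl⟩ := ZMod.natCast_zmod_surjective c
  rw [map_natCast, half_natCast]

lemma half_injective (k : ℕ) : Function.Injective (half k) := by
  rw [injective_iff_map_eq_zero]
  intro a ha
  rcases (by decide : ∀ a : ZMod 2, a = 0 ∨ a = 1) a with h | h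
  · exact h
  · exact absurd (h ▸ ha) (half_one_ne_zero k)

lemma par_half (k : ℕ) (a : ZMod 2) : par k (half k a) = 0 := by
  obtain ⟨j, rfl⟩ := ZMod.natCast_zmod_surjective a
  rw [half_natCast, map_mul, map_pow]
  simp [show par k 2 = 0 from map_ofNat (par k) 2 ▸ rfl]

lemma red_half (k : ℕ) (a : ZMod 2) : red k (half k a) = 0 := by
  obtain ⟨j, rfl⟩ := ZMod.natCast_zmod_surjective a
  have : ((2 ^ (k + 1) : ℕ) : ZMod (2 ^ (k + 1))) = 0 := ZMod.natCast_self _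
  push_cast at this
  rw [half_natCast, map_mul, map_pow, map_ofNat, this, mul_zero]

lemma exists_half_of_red (k : ℕ) (c : ZMod (2 ^ (k + 2))) (h : red k c = 0) :
    ∃ a, half k a = c := by
  obtain ⟨j, rfl⟩ := ZMod.natCast_zmod_surjective c
  rw [map_natCast, ZMod.natCast_eq_zero_iff] at h
  obtain ⟨i, rfl⟩ := h
  exact ⟨i, by rw [half_natCast]; push_cast; ring⟩

lemma red_eq_zero_of_add_self (k : ℕ) (c : ZMod (2 ^ (k + 2))) (h : c + c = 0) :
    red k c = 0 := by
  obtain ⟨j, rfl⟩ := ZMod.natCast_zmod_surjective c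
  rw [← Nat.cast_add, ZMod.natCast_eq_zero_iff, ← two_mul, pow_succ, mul_comm (2 ^ (k + 1))] at h
  rw [map_natCast, ZMod.natCast_eq_zero_iff]
  exact Nat.dvd_of_mul_dvd_mul_left two_pos h

/-- The parity of the cyclic component. -/
def parity (k n : ℕ) : CE k n →* Multiplicative (ZMod 2) :=
  (par k).toAddMonoidHom.toMultiplicative.comp (MonoidHom.fst _ _)

/-- The quotient of `C_{2^(k+2)} × 1^n` by its elements of order at most `2`. -/
def redHom (k n : ℕ) : CE k n →* Cyc (2 ^ (k + 1)) :=
  (red k).toAddMonoidHom.toMultiplicative.comp (MonoidHom.fst _ _)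

/-- The inclusion of `1^(n+1)` as the subgroup of elements of order at most `2`. -/
def om (k n : ℕ) : Elem (n + 1) →* CE k n where
  toFun x := (.ofAdd (half k (x.toAdd 0)), .ofAdd (Fin.tail x.toAdd))
  map_one' := by
    refine Prod.ext ?_ rfl
    exact congrArg Multiplicative.ofAdd (map_zero (half k))
  map_mul' x y := by
    refine Prod.ext ?_ rfl
    exact congrArg Multiplicative.ofAdd (map_add (half k) _ _)

/-- The generator of the cyclic factor. -/
def cgen (k n : ℕ) : CE k n := (.ofAdd 1, 1)

lemma om_injective (k n : ℕ) : Function.Injective (om k n) := by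
  intro x y h
  have h1 : x.toAdd 0 = y.toAdd 0 := half_injective k (congrArg (fun g : CE k n => g.1.toAdd) h)
  have h2 : ∀ j : Fin n, x.toAdd j.succ = y.toAdd j.succ := fun j =>
    congrFun (congrArg (fun g : CE k n => g.2.toAdd) h) j
  refine congrArg Multiplicative.ofAdd (a₁ := x.toAdd) (a₂ := y.toAdd) (funext fun j => ?_)
  exact Fin.cases h1 h2 j

lemma elem_mul_self {n : ℕ} (x : Elem n) : x * x = 1 :=
  congrArg Multiplicative.ofAdd (funext fun j => CharTwo.add_self_eq_zero (x.toAdd j))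

lemma elem_pow_even {n : ℕ} (x : Elem n) {j : ℕ} (h : 2 ∣ j) : x ^ j = 1 := by
  obtain ⟨i, rfl⟩ := h
  rw [pow_mul, sq, elem_mul_self, one_pow]

lemma parity_om {k n : ℕ} (x : Elem (n + 1)) : parity k n (om k n x) = 1 :=
  congrArg Multiplicative.ofAdd (par_half k _)

lemma redHom_om {k n : ℕ} (x : Elem (n + 1)) : redHom k n (om k n x) = 1 :=
  congrArg Multiplicative.ofAdd (red_half k _)

lemma exists_om_of_redHom {k n : ℕ} {g : CE k n} (h : redHom k n g = 1) :
    ∃ x, om k n x = g := by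
  obtain ⟨a, ha⟩ := exists_half_of_red k g.1.toAdd h
  exact ⟨.ofAdd (Fin.cons a g.2.toAdd), Prod.ext (congrArg Multiplicative.ofAdd ha) rfl⟩

lemma redHom_eq_one_of_mul_self {k n : ℕ} {g : CE k n} (h : g * g = 1) : redHom k n g = 1 :=
  red_eq_zero_of_add_self k g.1.toAdd (congrArg (fun g : CE k n => g.1.toAdd) h)

lemma redHom_surjective (k n : ℕ) : Function.Surjective (redHom k n) := by
  intro c
  obtain ⟨j, hj⟩ := ZMod.natCast_zmod_surjective c.toAdd
  exact ⟨(.ofAdd j, 1), congrArg Multiplicative.ofAdd ((map_natCast (red k) j).trans hj)⟩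

lemma parity_cgen (k n : ℕ) : parity k n (cgen k n) = .ofAdd 1 :=
  congrArg Multiplicative.ofAdd (map_one (par k))

/-- The exponent is even, which kills the component in `1^n`; on the cyclic component multiplication
by `2 ^ (k + 1)` sees only the parity. Hence there is a single nontrivial power of this kind. -/
lemma pow_eq_om {k n : ℕ} (g : CE k n) :
    g ^ 2 ^ (k + 1) = om k n (.ofAdd (Pi.single 0 (parity k n g).toAdd)) := by
  refine Prod.ext ?_ ?_
  · refine (congrArg Multiplicative.ofAdd (a₁ := 2 ^ (k + 1) • g.1.toAdd) ?_)
    rw [nsmul_eq_mul, mul_comm, Nat.cast_pow, Nat.cast_ofNat, ← half_par]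
    rfl
  · have h : (g ^ 2 ^ (k + 1)).2 = 1 := elem_pow_even g.2 (dvd_pow_self 2 (Nat.succ_ne_zero k))
    rw [h]
    exact congrArg Multiplicative.ofAdd (funext fun j => by simp [Fin.tail])

lemma exists_eq_cgen_pow_mul_om {k n : ℕ} (g : CE k n) :
    ∃ (j : ℕ) (x : Elem (n + 1)), g = cgen k n ^ j * om k n x := by
  obtain ⟨j, hj⟩ := ZMod.natCast_zmod_surjective g.1.toAdd
  refine ⟨j, .ofAdd (Fin.cons 0 g.2.toAdd), Prod.ext ?_ ?_⟩
  · refine congrArg Multiplicative.ofAdd (a₁ := g.1.toAdd)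
      (a₂ := j • (1 : ZMod (2 ^ (k + 2))) + half k 0) ?_
    simp [hj]
  · rw [Prod.snd_mul, Prod.pow_snd]
    simp [cgen, om]

/-- The cyclic generator and the elements of order at most 2 generate the group. Identities between
the automorphisms below are checked on these two kinds of elements. -/
lemma CE_hom_ext {k n : ℕ} {H : Type*} [Monoid H] {f g : CE k n →* H}
    (h1 : f (cgen k n) = g (cgen k n)) (h2 : ∀ x, f (om k n x) = g (om k n x)) : f = g := by
  ext1 a
  obtain ⟨j, x, rfl⟩ := exists_eq_cgen_pow_mul_om a
  rw [map_mul, map_mul, map_pow, map_pow, h1, h2]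

lemma CE_aut_ext {k n : ℕ} {φ ψ : MulAut (CE k n)}
    (h1 : φ (cgen k n) = ψ (cgen k n)) (h2 : ∀ x, φ (om k n x) = ψ (om k n x)) : φ = ψ :=
  MulEquiv.toMonoidHom_injective (CE_hom_ext h1 h2)

/-! ### The two actions of an automorphism: on the elements of order at most 2 and on the quotient
-/

lemma aut_om_exists {k n : ℕ} (φ : MulAut (CE k n)) (x : Elem (n + 1)) :
    ∃ y, om k n y = φ (om k n x) := by
  refine exists_om_of_redHom (redHom_eq_one_of_mul_self ?_)
  rw [← map_mul, ← map_mul, elem_mul_self, map_one, map_one]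

lemma exists_restrict {k n : ℕ} (φ : MulAut (CE k n)) :
    ∃ ψ : MulAut (Elem (n + 1)), ∀ x, om k n (ψ x) = φ (om k n x) := by
  choose f hf using aut_om_exists φ
  choose g hg using aut_om_exists φ⁻¹
  refine ⟨⟨⟨f, g, fun x => om_injective k n ?_, fun x => om_injective k n ?_⟩,
    fun x y => om_injective k n ?_⟩, hf⟩
  · rw [hg, hf, MulAut.inv_apply_self]
  · rw [hf, hg, MulAut.apply_inv_self]
  · rw [map_mul]
    erw [hf, hf, hf]
    rw [map_mul, map_mul]

/-- The restriction of the automorphisms to the elements of order at most `2`. -/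
noncomputable def restrictHom (k n : ℕ) : MulAut (CE k n) →* MulAut (Elem (n + 1)) where
  toFun φ := (exists_restrict φ).choose
  map_one' := by
    ext x : 1
    exact om_injective k n ((exists_restrict 1).choose_spec x)
  map_mul' φ ψ := by
    ext x : 1
    refine om_injective k n (((exists_restrict (φ * ψ)).choose_spec x).trans ?_)
    rw [MulAut.mul_apply, MulAut.mul_apply, (exists_restrict φ).choose_spec,
      (exists_restrict ψ).choose_spec]

lemma om_restrictHom {k n : ℕ} (φ : MulAut (CE k n)) (x : Elem (n + 1)) :
    om k n (restrictHom k n φ x) = φ (om k n x) := (exists_restrict φ).choose_spec x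

lemma exists_quotient {k n : ℕ} (φ : MulAut (CE k n)) :
    ∃ ψ : MulAut (Cyc (2 ^ (k + 1))), ∀ g, ψ (redHom k n g) = redHom k n (φ g) := by
  -- An automorphism preserves the kernel of `redHom`, so the chosen preimage does not matter.
  have key : ∀ (φ : MulAut (CE k n)) (g h : CE k n), redHom k n g = redHom k n h →
      redHom k n (φ g) = redHom k n (φ h) := by
    intro φ g h hgh
    rw [← div_eq_one, ← map_div] at hgh
    obtain ⟨x, hx⟩ := exists_om_of_redHom hgh
    obtain ⟨y, hy⟩ := aut_om_exists φ x
    rw [← div_eq_one, ← map_div, ← map_div, ← hx, ← hy, redHom_om]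
  have hs := Function.surjInv_eq (redHom_surjective k n)
  have hk : ∀ (φ : MulAut (CE k n)) g,
      redHom k n (φ (Function.surjInv (redHom_surjective k n) (redHom k n g))) =
        redHom k n (φ g) := fun φ g => key φ _ _ (hs _)
  refine ⟨⟨⟨fun c => redHom k n (φ (Function.surjInv (redHom_surjective k n) c)),
    fun c => redHom k n (φ⁻¹ (Function.surjInv (redHom_surjective k n) c)),
    fun c => ?_, fun c => ?_⟩, fun c d => ?_⟩, fun g => hk φ g⟩
  · beta_reduce
    rw [hk, MulAut.inv_apply_self, hs]
  · beta_reduce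
    rw [hk, MulAut.apply_inv_self, hs]
  · obtain ⟨c, rfl⟩ := redHom_surjective k n c
    obtain ⟨d, rfl⟩ := redHom_surjective k n d
    change redHom k n (φ (Function.surjInv _ (redHom k n c * redHom k n d))) =
      redHom k n (φ (Function.surjInv _ (redHom k n c))) *
        redHom k n (φ (Function.surjInv _ (redHom k n d)))
    rw [← map_mul, hk, hk, hk, map_mul, map_mul]

/-- The action of the automorphisms on the quotient by the elements of order at most `2`. -/
noncomputable def quotientHom (k n : ℕ) : MulAut (CE k n) →* MulAut (Cyc (2 ^ (k + 1))) where
  toFun φ := (exists_quotient φ).choose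
  map_one' := by
    ext c : 1
    obtain ⟨g, rfl⟩ := redHom_surjective k n c
    exact (exists_quotient 1).choose_spec g
  map_mul' φ ψ := by
    ext c : 1
    obtain ⟨g, rfl⟩ := redHom_surjective k n c
    refine ((exists_quotient (φ * ψ)).choose_spec g).trans ?_
    rw [MulAut.mul_apply, MulAut.mul_apply, (exists_quotient ψ).choose_spec,
      (exists_quotient φ).choose_spec]

lemma quotientHom_redHom {k n : ℕ} (φ : MulAut (CE k n)) (g : CE k n) :
    quotientHom k n φ (redHom k n g) = redHom k n (φ g) := (exists_quotient φ).choose_spec g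

/-- The element is the only nontrivial `2 ^ (k + 1)`-th power in the group, so it is characteristic.
This is what places the restriction in `Aff n`. -/
lemma aut_om_single_zero {k n : ℕ} (φ : MulAut (CE k n)) :
    φ (om k n (.ofAdd (Pi.single 0 1))) = om k n (.ofAdd (Pi.single 0 1)) := by
  have h : om k n (.ofAdd (Pi.single 0 1)) = cgen k n ^ 2 ^ (k + 1) := by
    rw [pow_eq_om, parity_cgen, toAdd_ofAdd]
  have h2 : φ (om k n (.ofAdd (Pi.single 0 1))) ≠ 1 := by
    rw [Ne, map_eq_one_iff φ φ.injective, map_eq_one_iff (om k n) (om_injective k n)]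
    intro h
    have := congrFun (congrArg Multiplicative.toAdd h) 0
    simp at this
  rw [h, map_pow, pow_eq_om] at h2
  rw [h, map_pow, pow_eq_om, pow_eq_om, parity_cgen, toAdd_ofAdd]
  rcases (by decide : ∀ a : ZMod 2, a = 0 ∨ a = 1) (parity k n (φ (cgen k n))).toAdd with h3 | h3
  · rw [h3, Pi.single_zero, ofAdd_zero, map_one] at h2
    exact absurd rfl h2
  · rw [h3]

/-- The matrix by which the inverse of an automorphism acts on the elements of order at
most `2`. -/
noncomputable def rowHom (k n : ℕ) : MulAut (CE k n) →* Aff n :=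
  ((MulEquiv.ofBijective _ (rowAct_bijective (n + 1))).symm.toMonoidHom.comp
    (restrictHom k n)).codRestrict (Aff n) fun φ => by
    obtain ⟨B, hB⟩ := (rowAct_bijective (n + 1)).2 (restrictHom k n φ)
    have : (MulEquiv.ofBijective _ (rowAct_bijective (n + 1))).symm (restrictHom k n φ) = B := by
      rw [MulEquiv.symm_apply_eq]
      exact hB.symm
    change (MulEquiv.ofBijective _ (rowAct_bijective (n + 1))).symm (restrictHom k n φ) ∈ _
    rw [this, mem_Aff]
    -- Right multiplication by `B` is the action of the inverse, so the fixed vector is used for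
    -- `φ⁻¹`.
    have h2 := rowAct_inv_apply B (.ofAdd (Pi.single 0 1))
    rw [hB, ← map_inv] at h2
    have h3 := om_restrictHom φ⁻¹ (.ofAdd (Pi.single 0 1))
    rw [h2, aut_om_single_zero] at h3
    exact congrArg Multiplicative.toAdd (om_injective k n h3)

lemma rowAct_rowHom {k n : ℕ} (φ : MulAut (CE k n)) :
    rowAct (n + 1) (rowHom k n φ).1 = restrictHom k n φ :=
  (MulEquiv.ofBijective _ (rowAct_bijective (n + 1))).apply_symm_apply _

/-- With the inverse on this side, conjugation `g ↦ h⁻¹ g h` in the holomorph becomes right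
multiplication of rows by the matrix, which is the convention of the presentations. -/
lemma inv_apply_om {k n : ℕ} (φ : MulAut (CE k n)) (x : Elem (n + 1)) :
    φ⁻¹ (om k n x) = om k n (.ofAdd (x.toAdd ᵥ* (rowHom k n φ).1.val)) := by
  rw [← rowAct_inv_apply, rowAct_rowHom, ← map_inv, om_restrictHom]

lemma rowHom_eq_of {k n : ℕ} {φ : MulAut (CE k n)} {B : Aff n}
    (h : ∀ x, φ⁻¹ (om k n x) = om k n (.ofAdd (x.toAdd ᵥ* B.1.val))) : rowHom k n φ = B := by
  refine Subtype.ext (Units.ext (Matrix.ext_of_single_vecMul fun i => ?_))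
  have := h (.ofAdd (Pi.single i 1))
  rw [inv_apply_om] at this
  exact congrArg Multiplicative.toAdd (om_injective k n this)

lemma apply_om_of_rowHom_eq_one {k n : ℕ} {φ : MulAut (CE k n)} (h : rowHom k n φ = 1)
    (x : Elem (n + 1)) : φ (om k n x) = om k n x := by
  have := inv_apply_om φ x
  rw [h, OneMemClass.coe_one, Units.val_one, vecMul_one, ofAdd_toAdd] at this
  conv_lhs => rw [← this]
  exact MulAut.apply_inv_self _ _ _

/-! ### Explicit automorphisms: matrices, transvections, units -/

lemma om_single_zero (k n : ℕ) (a : ZMod 2) :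
    om k n (.ofAdd (Pi.single 0 a)) = (.ofAdd (half k a), 1) := by
  refine Prod.ext ?_ ?_
  · simp [om]
  · exact congrArg Multiplicative.ofAdd (funext fun j => by simp [Fin.tail])

lemma cgen_pow_fst {k n : ℕ} (g : CE k n) : cgen k n ^ g.1.toAdd.val = (g.1, 1) := by
  refine Prod.ext ?_ ?_
  · refine congrArg Multiplicative.ofAdd (a₁ := g.1.toAdd.val • (1 : ZMod (2 ^ (k + 2))))
      (a₂ := g.1.toAdd) ?_
    simp
  · simp [cgen]

/-- The endomorphism of `C_{2^(k+2)} × 1^n` that fixes the generator of the cyclic factor and acts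
on the elements of order at most `2` through a matrix. -/
def matEnd {k n : ℕ} (M : Matrix (Fin (n + 1)) (Fin (n + 1)) (ZMod 2)) : CE k n →* CE k n where
  toFun g := (g.1, 1) * om k n (.ofAdd (Fin.cons 0 g.2.toAdd ᵥ* M))
  map_one' := by
    have : (Fin.cons 0 (1 : Elem n).toAdd : Fin (n + 1) → ZMod 2) = 0 :=
      funext fun j => Fin.cases rfl (fun _ => rfl) j
    rw [Prod.snd_one, this, zero_vecMul]
    exact (one_mul _).trans (map_one _)
  map_mul' g h := by
    have : (Fin.cons 0 (g.2 * h.2).toAdd : Fin (n + 1) → ZMod 2) =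
        Fin.cons 0 g.2.toAdd + Fin.cons 0 h.2.toAdd :=
      funext fun j => Fin.cases (add_zero _).symm (fun _ => rfl) j
    rw [Prod.snd_mul, this, add_vecMul, ofAdd_add, map_mul, mul_mul_mul_comm]
    rfl

lemma matEnd_cgen {k n : ℕ} (M : Matrix (Fin (n + 1)) (Fin (n + 1)) (ZMod 2)) :
    matEnd M (cgen k n) = cgen k n := by
  have : (Fin.cons 0 (1 : Elem n).toAdd : Fin (n + 1) → ZMod 2) = 0 :=
    funext fun j => Fin.cases rfl (fun _ => rfl) j
  change _ * om k n (.ofAdd (Fin.cons 0 (1 : Elem n).toAdd ᵥ* M)) = _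
  rw [this, zero_vecMul, ofAdd_zero, map_one, mul_one]
  rfl

/-- The definition of `matEnd` never uses row 0 of `M`. The hypothesis makes that row agree with the
forced image of the first basis vector, which is a power of the fixed generator. -/
lemma matEnd_om {k n : ℕ} {M : Matrix (Fin (n + 1)) (Fin (n + 1)) (ZMod 2)}
    (hM : Pi.single 0 1 ᵥ* M = Pi.single 0 1) (x : Elem (n + 1)) :
    matEnd M (om k n x) = om k n (.ofAdd (x.toAdd ᵥ* M)) := by
  have h : ∀ a : ZMod 2, (Pi.single 0 a : Fin (n + 1) → ZMod 2) ᵥ* M = Pi.single 0 a := by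
    intro a
    have : (Pi.single 0 a : Fin (n + 1) → ZMod 2) = a • Pi.single 0 1 := by
      rw [← Pi.single_smul, smul_eq_mul, mul_one]
    rw [this, smul_vecMul, hM]
  have h2 : x.toAdd = Pi.single 0 (x.toAdd 0) + Fin.cons 0 (om k n x).2.toAdd :=
    funext fun j => Fin.cases (by simp) (fun j => by simp [om, Fin.tail]) j
  conv_rhs => rw [h2, add_vecMul, h, ofAdd_add, map_mul, om_single_zero]
  rfl

/-- The action of the stabilizer of the first basis row on `C_{2^(k+2)} × 1^n`. -/
def matAut (k n : ℕ) : Aff n →* MulAut (CE k n) where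
  -- Right multiplication of rows reverses products; passing to the inverse makes this a
  -- homomorphism.
  toFun B := MonoidHom.toMulEquiv (matEnd (B⁻¹).1.val) (matEnd B.1.val)
    (CE_hom_ext (by simp [matEnd_cgen]) fun x => by
      rw [MonoidHom.comp_apply, matEnd_om (B⁻¹).2, matEnd_om B.2, toAdd_ofAdd, vecMul_vecMul,
        ← Units.val_mul, ← Subgroup.coe_mul, inv_mul_cancel]
      simp)
    (CE_hom_ext (by simp [matEnd_cgen]) fun x => by
      rw [MonoidHom.comp_apply, matEnd_om B.2, matEnd_om (B⁻¹).2, toAdd_ofAdd, vecMul_vecMul,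
        ← Units.val_mul, ← Subgroup.coe_mul, mul_inv_cancel]
      simp)
  map_one' := CE_aut_ext (matEnd_cgen _) fun x => by
    refine (matEnd_om (1⁻¹ : Aff n).2 x).trans ?_
    simp
  map_mul' A B := CE_aut_ext ((matEnd_cgen _).trans (by
      change _ = matEnd _ (matEnd _ (cgen k n))
      rw [matEnd_cgen, matEnd_cgen])) fun x => by
    refine (matEnd_om (A * B)⁻¹.2 x).trans ?_
    change _ = matEnd (A⁻¹).1.val (matEnd (B⁻¹).1.val (om k n x))
    rw [matEnd_om (B⁻¹).2, matEnd_om (A⁻¹).2, toAdd_ofAdd, vecMul_vecMul,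
        ← Units.val_mul, ← Subgroup.coe_mul, _root_.mul_inv_rev]

lemma matAut_cgen {k n : ℕ} (B : Aff n) : matAut k n B (cgen k n) = cgen k n := matEnd_cgen _

lemma matAut_inv_om {k n : ℕ} (B : Aff n) (x : Elem (n + 1)) :
    (matAut k n B)⁻¹ (om k n x) = om k n (.ofAdd (x.toAdd ᵥ* B.1.val)) := matEnd_om B.2 x

lemma matAut_om {k n : ℕ} (B : Aff n) (x : Elem (n + 1)) :
    matAut k n B (om k n x) = om k n (.ofAdd (x.toAdd ᵥ* (B⁻¹).1.val)) := matEnd_om (B⁻¹).2 x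

lemma rowHom_matAut {k n : ℕ} (B : Aff n) : rowHom k n (matAut k n B) = B :=
  rowHom_eq_of (matAut_inv_om B)

/-- The transvection of `C_{2^(k+2)} × 1^n` that multiplies the generator of the cyclic factor by
an element of order at most `2` and fixes the elements of order at most `2`. -/
def transEnd {k n : ℕ} (w : Elem (n + 1)) : CE k n →* CE k n where
  toFun g := g * om k n (.ofAdd ((parity k n g).toAdd • w.toAdd))
  map_one' := by
    rw [map_one, toAdd_one, zero_smul, ofAdd_zero, map_one, mul_one]
  map_mul' g h := by
    rw [map_mul, toAdd_mul, add_smul, ofAdd_add, map_mul, mul_mul_mul_comm]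

lemma transEnd_cgen {k n : ℕ} (w : Elem (n + 1)) :
    transEnd w (cgen k n) = cgen k n * om k n w := by
  change _ * om k n (.ofAdd ((parity k n (cgen k n)).toAdd • w.toAdd)) = _
  rw [parity_cgen, toAdd_ofAdd, one_smul, ofAdd_toAdd]

lemma transEnd_om {k n : ℕ} (w x : Elem (n + 1)) : transEnd w (om k n x) = om k n x := by
  change _ * om k n (.ofAdd ((parity k n (om k n x)).toAdd • w.toAdd)) = _
  rw [parity_om, toAdd_one, zero_smul, ofAdd_zero, map_one, mul_one]

lemma transEnd_comp_self {k n : ℕ} (w : Elem (n + 1)) :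
    (transEnd w).comp (transEnd w) = MonoidHom.id (CE k n) :=
  CE_hom_ext (by
    rw [MonoidHom.comp_apply, transEnd_cgen, map_mul, transEnd_cgen, transEnd_om, mul_assoc,
      ← map_mul, elem_mul_self, map_one, mul_one, MonoidHom.id_apply]) fun x => by
    rw [MonoidHom.comp_apply, transEnd_om, transEnd_om, MonoidHom.id_apply]

/-- The homomorphism from `1^(n+1)` to the automorphisms of `C_{2^(k+2)} × 1^n` given by the
transvections. -/
def transAut (k n : ℕ) : Elem (n + 1) →* MulAut (CE k n) where
  toFun w := MonoidHom.toMulEquiv (transEnd w) (transEnd w) (transEnd_comp_self w)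
    (transEnd_comp_self w)
  map_one' := CE_aut_ext ((transEnd_cgen 1).trans (by
    rw [map_one, mul_one, MulAut.one_apply])) (transEnd_om 1)
  map_mul' v w := CE_aut_ext ((transEnd_cgen (v * w)).trans (by
      change _ = transEnd v (transEnd w (cgen k n))
      rw [transEnd_cgen, map_mul (transEnd v), transEnd_cgen, transEnd_om, map_mul,
        mul_assoc])) fun x =>
    (transEnd_om (v * w) x).trans (by
      change _ = transEnd v (transEnd w (om k n x))
      rw [transEnd_om, transEnd_om])

lemma transAut_cgen {k n : ℕ} (w : Elem (n + 1)) :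
    transAut k n w (cgen k n) = cgen k n * om k n w := transEnd_cgen w

lemma transAut_om {k n : ℕ} (w x : Elem (n + 1)) :
    transAut k n w (om k n x) = om k n x := transEnd_om w x

lemma par_unit {k : ℕ} (u : (ZMod (2 ^ (k + 2)))ˣ) : par k u = 1 := by
  have := (par k).isUnit_map u.isUnit
  revert this
  generalize par k u = a
  revert a
  decide

/-- The action of the units of `ℤ/2^(k+2)` on the cyclic factor. -/
def unitAut (k n : ℕ) : (ZMod (2 ^ (k + 2)))ˣ →* MulAut (CE k n) where
  toFun u :=
    { toFun := fun g => (.ofAdd (u * g.1.toAdd), g.2)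
      invFun := fun g => (.ofAdd ((u⁻¹ : (ZMod (2 ^ (k + 2)))ˣ) * g.1.toAdd), g.2)
      left_inv := fun g => by simp
      right_inv := fun g => by simp
      map_mul' := fun g h => by simp [mul_add] }
  map_one' := by ext g : 1; simp
  map_mul' u v := by ext g : 1; simp [mul_assoc]

lemma unitAut_apply {k n : ℕ} (u : (ZMod (2 ^ (k + 2)))ˣ) (g : CE k n) :
    unitAut k n u g = (.ofAdd (u * g.1.toAdd), g.2) := rfl

/-- A unit is odd, so it fixes `2 ^ (k + 1)` modulo `2 ^ (k + 2)`. -/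
lemma unitAut_om {k n : ℕ} (u : (ZMod (2 ^ (k + 2)))ˣ) (x : Elem (n + 1)) :
    unitAut k n u (om k n x) = om k n x := by
  refine Prod.ext (congrArg Multiplicative.ofAdd
    (a₁ := u * half k (x.toAdd 0)) (a₂ := half k (x.toAdd 0)) ?_) rfl
  obtain ⟨j, hj⟩ := ZMod.natCast_zmod_surjective (x.toAdd 0)
  rw [← hj, half_natCast, mul_left_comm, ← half_par, par_unit, half_one]

lemma unitAut_cgen {k n : ℕ} (u : (ZMod (2 ^ (k + 2)))ˣ) :
    unitAut k n u (cgen k n) = cgen k n ^ u.val.val := by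
  have := cgen_pow_fst (unitAut k n u (cgen k n))
  have h : (unitAut k n u (cgen k n)).1.toAdd = u := mul_one _
  rw [h] at this
  exact this.symm

lemma commute_matAut_unitAut {k n : ℕ} (B : Aff n) (u : (ZMod (2 ^ (k + 2)))ˣ) :
    Commute (matAut k n B) (unitAut k n u) := by
  refine (Commute.inv_left_iff).1 (CE_aut_ext ?_ fun x => ?_)
  · rw [MulAut.mul_apply, MulAut.mul_apply, unitAut_cgen, map_pow, ← map_inv, matAut_cgen,
      unitAut_cgen]
  · rw [MulAut.mul_apply, MulAut.mul_apply, unitAut_om, matAut_inv_om, unitAut_om]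

lemma commute_transAut_unitAut {k n : ℕ} (w : Elem (n + 1)) (u : (ZMod (2 ^ (k + 2)))ˣ) :
    Commute (transAut k n w) (unitAut k n u) := by
  -- The representative of a unit is odd, and `w` has order at most 2.
  have hu : w ^ u.val.val = w := by
    have h : Odd u.val.val := by
      rw [← ZMod.natCast_eq_one_iff_odd, ← par_unit u, ← map_natCast (par k), ZMod.natCast_zmod_val]
    obtain ⟨j, hj⟩ := h
    rw [hj, pow_succ, elem_pow_even w (dvd_mul_right 2 j), one_mul]
  refine CE_aut_ext ?_ fun x => ?_
  · rw [MulAut.mul_apply, MulAut.mul_apply, unitAut_cgen, map_pow, transAut_cgen, mul_pow,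
      ← map_pow, hu, map_mul, unitAut_om, unitAut_cgen]
  · rw [MulAut.mul_apply, MulAut.mul_apply, unitAut_om, transAut_om, unitAut_om]

lemma matAut_inv_mul_transAut_mul {k n : ℕ} (B : Aff n) (w : Elem (n + 1)) :
    (matAut k n B)⁻¹ * transAut k n w * matAut k n B =
      transAut k n (.ofAdd (w.toAdd ᵥ* B.1.val)) := by
  rw [mul_assoc, inv_mul_eq_iff_eq_mul]
  refine CE_aut_ext ?_ fun x => ?_
  · rw [MulAut.mul_apply, MulAut.mul_apply, matAut_cgen, transAut_cgen, transAut_cgen, map_mul,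
      matAut_cgen, ← matAut_inv_om, MulAut.apply_inv_self]
  · rw [MulAut.mul_apply, MulAut.mul_apply, transAut_om, matAut_om, transAut_om]

/-! ### The corresponding subgroups of the holomorph and their relations -/

/-- The translations by the elements of order at most `2`. -/
def trl (k n : ℕ) : Elem (n + 1) →* Hol (CE k n) := SemidirectProduct.inl.comp (om k n)

/-- The transvections, as elements of the holomorph. -/
def tvn (k n : ℕ) : Elem (n + 1) →* Hol (CE k n) := SemidirectProduct.inr.comp (transAut k n)

/-- The stabilizer of the first basis row, as a subgroup of the holomorph. -/
def mtx (k n : ℕ) : Aff n →* Hol (CE k n) := SemidirectProduct.inr.comp (matAut k n)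

/-- The units of `ℤ/2^(k+2)`, as a subgroup of the holomorph. -/
def unt (k n : ℕ) : (ZMod (2 ^ (k + 2)))ˣ →* Hol (CE k n) :=
  SemidirectProduct.inr.comp (unitAut k n)

/-- The translation by the generator of the cyclic factor. -/
def shift (k n : ℕ) : Hol (CE k n) := SemidirectProduct.inl (cgen k n)

lemma hol_inr_mul_inl {G : Type*} [Group G] (φ : MulAut G) (g : G) :
    (SemidirectProduct.inr φ * SemidirectProduct.inl g : Hol G) =
      SemidirectProduct.inl (φ g) * SemidirectProduct.inr φ := by
  have := SemidirectProduct.inl_aut (φ := MonoidHom.id (MulAut G)) φ g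
  rw [MonoidHom.id_apply] at this
  rw [this, map_inv, inv_mul_cancel_right]

lemma commute_trl_tvn {k n : ℕ} (x w : Elem (n + 1)) : Commute (trl k n x) (tvn k n w) := by
  change SemidirectProduct.inl (om k n x) * SemidirectProduct.inr (transAut k n w) =
    SemidirectProduct.inr (transAut k n w) * SemidirectProduct.inl (om k n x)
  rw [hol_inr_mul_inl, transAut_om]

lemma mtx_inv_mul_trl_mul {k n : ℕ} (B : Aff n) (x : Elem (n + 1)) :
    (mtx k n B)⁻¹ * trl k n x * mtx k n B = trl k n (.ofAdd (x.toAdd ᵥ* B.1.val)) := by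
  change (SemidirectProduct.inr (matAut k n B))⁻¹ * SemidirectProduct.inl (om k n x) *
    SemidirectProduct.inr (matAut k n B) = SemidirectProduct.inl _
  rw [← map_inv, hol_inr_mul_inl, mul_assoc, ← map_mul, inv_mul_cancel, map_one, mul_one,
    matAut_inv_om]

lemma mtx_inv_mul_tvn_mul {k n : ℕ} (B : Aff n) (w : Elem (n + 1)) :
    (mtx k n B)⁻¹ * tvn k n w * mtx k n B = tvn k n (.ofAdd (w.toAdd ᵥ* B.1.val)) := by
  change (SemidirectProduct.inr (matAut k n B))⁻¹ * SemidirectProduct.inr (transAut k n w) *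
    SemidirectProduct.inr (matAut k n B) = SemidirectProduct.inr _
  rw [← map_inv, ← map_mul, ← map_mul, matAut_inv_mul_transAut_mul]

lemma commute_shift_trl {k n : ℕ} (x : Elem (n + 1)) : Commute (shift k n) (trl k n x) :=
  (Commute.all (cgen k n) (om k n x)).map SemidirectProduct.inl

/-- Moving a transvection past the shift costs a translation by `w`, since the generator is sent to
its product with `w`. This yields the relations `d^s a d = 1` of the presentations. -/
lemma tvn_mul_shift {k n : ℕ} (w : Elem (n + 1)) :
    tvn k n w * shift k n = shift k n * trl k n w * tvn k n w := by
  refine (hol_inr_mul_inl _ _).trans ?_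
  rw [transAut_cgen, map_mul]
  rfl

lemma commute_shift_mtx {k n : ℕ} (B : Aff n) : Commute (shift k n) (mtx k n B) := by
  refine Eq.symm ((hol_inr_mul_inl _ _).trans ?_)
  rw [matAut_cgen]
  rfl

lemma commute_mtx_unt {k n : ℕ} (B : Aff n) (u : (ZMod (2 ^ (k + 2)))ˣ) :
    Commute (mtx k n B) (unt k n u) := by
  change SemidirectProduct.inr (matAut k n B) * SemidirectProduct.inr (unitAut k n u) =
    SemidirectProduct.inr (unitAut k n u) * SemidirectProduct.inr (matAut k n B)
  rw [← map_mul, ← map_mul, (commute_matAut_unitAut B u).eq]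

lemma commute_tvn_unt {k n : ℕ} (w : Elem (n + 1)) (u : (ZMod (2 ^ (k + 2)))ˣ) :
    Commute (tvn k n w) (unt k n u) := by
  change SemidirectProduct.inr (transAut k n w) * SemidirectProduct.inr (unitAut k n u) =
    SemidirectProduct.inr (unitAut k n u) * SemidirectProduct.inr (transAut k n w)
  rw [← map_mul, ← map_mul, (commute_transAut_unitAut w u).eq]

lemma commute_trl_unt {k n : ℕ} (x : Elem (n + 1)) (u : (ZMod (2 ^ (k + 2)))ˣ) :
    Commute (trl k n x) (unt k n u) := by
  refine Eq.symm ((hol_inr_mul_inl _ _).trans ?_)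
  rw [unitAut_om]
  rfl

lemma shift_pow_eq (k n : ℕ) :
    shift k n ^ 2 ^ (k + 1) = trl k n (.ofAdd (Pi.single 0 1)) := by
  rw [shift, ← map_pow, pow_eq_om, parity_cgen]
  rfl

/-! ### The group extension -/

/-- The normal subgroup `1^(n+1) × 1^(n+1)` of the holomorph. -/
def holInl (k n : ℕ) : Elem (n + 1) × Elem (n + 1) →* Hol (CE k n) :=
  MonoidHom.noncommCoprod (trl k n) (tvn k n) commute_trl_tvn

lemma holInl_apply {k n : ℕ} (x : Elem (n + 1) × Elem (n + 1)) :
    holInl k n x = trl k n x.1 * tvn k n x.2 := rfl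

/-- The quotient of the holomorph by `1^(n+1) × 1^(n+1)`. -/
noncomputable def holRight (k n : ℕ) : Hol (CE k n) →* Hol (Elem n) × Hol (Cyc (2 ^ (k + 1))) :=
  ((affEquiv n).toMonoidHom.comp ((rowHom k n).comp SemidirectProduct.rightHom)).prod
    (SemidirectProduct.map (redHom k n) (quotientHom k n) fun φ => by
      ext1 g
      exact (quotientHom_redHom φ g).symm)

lemma holRight_apply {k n : ℕ} (g : Hol (CE k n)) :
    holRight k n g = (affEquiv n (rowHom k n g.right),
      ⟨redHom k n g.left, quotientHom k n g.right⟩) := rfl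

lemma holInl_injective (k n : ℕ) : Function.Injective (holInl k n) := by
  rw [injective_iff_map_eq_one]
  rintro ⟨x, w⟩ h
  have h1 : om k n x = 1 := by
    have := congrArg SemidirectProduct.left h
    simpa [holInl_apply, trl, tvn] using this
  have h2 : transAut k n w = 1 := by
    have := congrArg SemidirectProduct.right h
    simpa [holInl_apply, trl, tvn] using this
  have h3 := transAut_cgen (k := k) w
  rw [h2, MulAut.one_apply, eq_comm, mul_eq_left] at h3
  rw [map_eq_one_iff _ (om_injective k n)] at h1 h3
  rw [h1, h3]
  rfl

lemma cyc_hom_ext {N : ℕ} {ψ χ : MulAut (Cyc N)} (h : ψ (.ofAdd 1) = χ (.ofAdd 1)) : ψ = χ := by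
  ext c : 1
  obtain ⟨j, hj⟩ := ZMod.intCast_surjective c.toAdd
  have : c = (.ofAdd 1 : Cyc N) ^ j := by
    refine congrArg Multiplicative.ofAdd (a₁ := c.toAdd) (a₂ := j • (1 : ZMod N)) ?_
    rw [← hj]
    simp
  rw [this, map_zpow, map_zpow, h]

lemma quotientHom_eq_of_cgen {k n : ℕ} {φ : MulAut (CE k n)} {ψ : MulAut (Cyc (2 ^ (k + 1)))}
    (h : redHom k n (φ (cgen k n)) = ψ (.ofAdd 1)) : quotientHom k n φ = ψ := by
  have hz : redHom k n (cgen k n) = .ofAdd 1 := congrArg Multiplicative.ofAdd (map_one (red k))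
  refine cyc_hom_ext ?_
  rw [← hz, quotientHom_redHom, h, hz]

lemma redHom_cgen (k n : ℕ) : redHom k n (cgen k n) = .ofAdd 1 :=
  congrArg Multiplicative.ofAdd (map_one (red k))

lemma quotientHom_transAut {k n : ℕ} (w : Elem (n + 1)) :
    quotientHom k n (transAut k n w) = 1 :=
  quotientHom_eq_of_cgen (by
    rw [transAut_cgen, map_mul, redHom_om, mul_one, redHom_cgen, MulAut.one_apply])

lemma quotientHom_matAut {k n : ℕ} (B : Aff n) : quotientHom k n (matAut k n B) = 1 :=
  quotientHom_eq_of_cgen (by rw [matAut_cgen, redHom_cgen, MulAut.one_apply])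

lemma rowHom_eq_one_of {k n : ℕ} {φ : MulAut (CE k n)} (h : ∀ x, φ (om k n x) = om k n x) :
    rowHom k n φ = 1 :=
  rowHom_eq_of fun x => by
    rw [OneMemClass.coe_one, Units.val_one, vecMul_one, ofAdd_toAdd]
    conv_lhs => rw [← h x]
    exact MulAut.inv_apply_self _ _ _

lemma rowHom_transAut {k n : ℕ} (w : Elem (n + 1)) : rowHom k n (transAut k n w) = 1 :=
  rowHom_eq_one_of (transAut_om w)

lemma rowHom_unitAut {k n : ℕ} (u : (ZMod (2 ^ (k + 2)))ˣ) : rowHom k n (unitAut k n u) = 1 :=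
  rowHom_eq_one_of (unitAut_om u)

/-- An automorphism of a cyclic group is multiplication by the image of 1, which is a unit, and
units modulo `2 ^ (k + 1)` lift to units modulo `2 ^ (k + 2)`. -/
lemma exists_quotientHom_unitAut {k n : ℕ} (ψ : MulAut (Cyc (2 ^ (k + 1)))) :
    ∃ u, quotientHom k n (unitAut k n u) = ψ := by
  have hmul : ∀ (ψ : MulAut (Cyc (2 ^ (k + 1)))) (c : Cyc (2 ^ (k + 1))),
      (ψ c).toAdd = (ψ (.ofAdd 1)).toAdd * c.toAdd := by
    intro ψ c
    obtain ⟨j, hj⟩ := ZMod.natCast_zmod_surjective c.toAdd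
    have : c = (.ofAdd 1 : Cyc (2 ^ (k + 1))) ^ j := by
      refine congrArg Multiplicative.ofAdd (a₁ := c.toAdd)
        (a₂ := j • (1 : ZMod (2 ^ (k + 1)))) ?_
      rw [← hj]
      simp
    rw [this, map_pow, toAdd_pow, toAdd_pow, nsmul_eq_mul, nsmul_eq_mul, toAdd_ofAdd, mul_one,
      mul_comm]
  have h1 := hmul ψ (ψ⁻¹ (.ofAdd 1))
  have h2 := hmul ψ⁻¹ (ψ (.ofAdd 1))
  rw [MulAut.apply_inv_self, toAdd_ofAdd] at h1
  rw [MulAut.inv_apply_self, toAdd_ofAdd] at h2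
  obtain ⟨u, hu⟩ := ZMod.unitsMap_surjective (pow_dvd_pow 2 (Nat.le_succ (k + 1)))
    ⟨(ψ (.ofAdd 1)).toAdd, (ψ⁻¹ (.ofAdd 1)).toAdd, h1.symm, h2.symm⟩
  refine ⟨u, quotientHom_eq_of_cgen ?_⟩
  refine congrArg Multiplicative.ofAdd (a₁ := red k (u * 1)) (a₂ := (ψ (.ofAdd 1)).toAdd) ?_
  rw [mul_one]
  exact congrArg Units.val hu

/-- An automorphism trivial on the quotient multiplies the generator by some `w` of order at most 2.
If it also fixes the elements of order at most 2, it is the transvection by `w`. -/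
lemma range_holInl (k n : ℕ) : (holInl k n).range = (holRight k n).ker := by
  ext g
  rw [MonoidHom.mem_ker, holRight_apply, Prod.mk_eq_one, map_eq_one_iff _ (affEquiv n).injective]
  constructor
  · rintro ⟨⟨x, w⟩, rfl⟩
    have hl : (holInl k n (x, w)).left = om k n x := by simp [holInl_apply, trl, tvn]
    have hr : (holInl k n (x, w)).right = transAut k n w := by simp [holInl_apply, trl, tvn]
    rw [hl, hr, rowHom_transAut, quotientHom_transAut, redHom_om]
    exact ⟨rfl, rfl⟩
  · rintro ⟨h1, h2⟩
    obtain ⟨x, hx⟩ := exists_om_of_redHom (congrArg SemidirectProduct.left h2)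
    have h3 := quotientHom_redHom g.right (cgen k n)
    rw [show quotientHom k n g.right = 1 from congrArg SemidirectProduct.right h2,
      MulAut.one_apply, eq_comm, ← div_eq_one, ← map_div] at h3
    obtain ⟨w, hw⟩ := exists_om_of_redHom h3
    refine ⟨(x, w), SemidirectProduct.ext ?_ ?_⟩
    · simp [holInl_apply, trl, tvn, hx]
    · have : g.right = transAut k n w := CE_aut_ext
        (by rw [transAut_cgen, hw, mul_div_cancel]) fun y => by
        rw [transAut_om, apply_om_of_rowHom_eq_one h1]
      simp [holInl_apply, trl, tvn, this]

/-- `matAut` realizes the first factor and is trivial on the quotient; `unitAut` realizes the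
automorphisms of the quotient and has trivial matrix. -/
lemma holRight_surjective (k n : ℕ) : Function.Surjective (holRight k n) := by
  rintro ⟨a, ⟨c, ψ⟩⟩
  obtain ⟨B, rfl⟩ := (affEquiv n).surjective a
  obtain ⟨g, rfl⟩ := redHom_surjective k n c
  obtain ⟨u, rfl⟩ := exists_quotientHom_unitAut (n := n) ψ
  refine ⟨⟨g, matAut k n B * unitAut k n u⟩, ?_⟩
  refine Prod.ext ?_ (SemidirectProduct.ext rfl ?_)
  · change affEquiv n (rowHom k n (matAut k n B * unitAut k n u)) = affEquiv n B
    rw [map_mul (rowHom k n), rowHom_matAut, rowHom_unitAut, mul_one]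
  · change quotientHom k n (matAut k n B * unitAut k n u) = _
    rw [map_mul, quotientHom_matAut, one_mul]

/-- The group extension `1 → 1^(n+1) × 1^(n+1) → Hol(C_x × 1^n) → Hol(1^n) × Hol(C_{x/2}) → 1`. -/
noncomputable def holExtension (k n : ℕ) : GroupExtension (Elem (n + 1) × Elem (n + 1))
    (Hol (CE k n)) (Hol (Elem n) × Hol (Cyc (2 ^ (k + 1)))) where
  inl := holInl k n
  rightHom := holRight k n
  inl_injective := holInl_injective k n
  range_inl_eq_ker_rightHom := range_holInl k n
  rightHom_surjective := holRight_surjective k n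

/-! ### Non-splitting -/

/-- In the square the two translations by `x` and the two transvections cancel, except that moving a
transvection past the shift leaves a translation by `w`. That translation commutes with the shift
and disappears in the next square. -/
lemma mul_shift_pow_four {k n : ℕ} (x : Elem (n + 1) × Elem (n + 1)) :
    (holInl k n x * shift k n) ^ 4 = shift k n ^ 4 := by
  obtain ⟨x, w⟩ := x
  have h1 : (holInl k n (x, w) * shift k n) ^ 2 = trl k n w * shift k n ^ 2 := by
    have hw := tvn_mul_shift (k := k) w
    have hx : trl k n x * trl k n x = 1 := by rw [← map_mul, elem_mul_self, map_one]
    have hww : tvn k n w * tvn k n w = 1 := by rw [← map_mul, elem_mul_self, map_one]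
    have c1 := (commute_shift_trl (k := k) x).eq
    have c2 := (commute_shift_trl (k := k) w).eq
    have c3 := (commute_trl_tvn (k := k) x w).eq
    have c4 := (commute_trl_tvn (k := k) w w).eq
    have e : tvn k n w * shift k n * tvn k n w = shift k n * trl k n w := by
      rw [hw, mul_assoc, hww, mul_one]
    rw [holInl_apply, sq]
    calc trl k n x * tvn k n w * shift k n * (trl k n x * tvn k n w * shift k n)
        = trl k n x * tvn k n w * (shift k n * trl k n x) * tvn k n w * shift k n := by group
      _ = trl k n x * (tvn k n w * trl k n x) * shift k n * tvn k n w * shift k n := by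
          rw [c1]; group
      _ = (trl k n x * trl k n x) * (tvn k n w * shift k n * tvn k n w) * shift k n := by
          rw [← c3]; group
      _ = trl k n w * shift k n ^ 2 := by rw [hx, e, c2, one_mul, sq, mul_assoc]
  rw [show 4 = 2 * 2 from rfl, pow_mul, h1, ((commute_shift_trl w).symm.pow_right 2).mul_pow,
    ← map_pow, sq, elem_mul_self, map_one, one_mul, pow_mul]

/-- A splitting would lift the image `q` of the shift to an element whose `2 ^ (k + 1)`-th power is
trivial. Every lift has the fourth power of the shift, and 4 divides `2 ^ (k + 1)` because `k ≥ 1`;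
but the shift to this power is a nontrivial translation. -/
lemma isEmpty_splitting_holExtension (k n : ℕ) (hk : 1 ≤ k) :
    IsEmpty (holExtension k n).Splitting := by
  refine ⟨fun σ => ?_⟩
  set q := holRight k n (shift k n) with hq
  have hσ : holRight k n (σ.toMonoidHom q) = q := σ.rightInverse_rightHom q
  have hmem : σ.toMonoidHom q * (shift k n)⁻¹ ∈ (holRight k n).ker := by
    rw [MonoidHom.mem_ker, map_mul, hσ, map_inv, ← hq, mul_inv_cancel]
  rw [← range_holInl] at hmem
  obtain ⟨x, hx⟩ := hmem
  rw [eq_mul_inv_iff_mul_eq] at hx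
  obtain ⟨j, rfl⟩ := Nat.exists_eq_add_of_le hk
  have hpow : (2 : ℕ) ^ (1 + j + 1) = 4 * 2 ^ j := by rw [pow_add, pow_add]; ring
  have h1 : σ.toMonoidHom q ^ 2 ^ (1 + j + 1) = shift (1 + j) n ^ 2 ^ (1 + j + 1) := by
    rw [← hx, hpow, pow_mul, mul_shift_pow_four, ← pow_mul]
  have h2 : q ^ 2 ^ (1 + j + 1) = 1 := by
    rw [hq, ← map_pow, shift_pow_eq, ← MonoidHom.mem_ker, ← range_holInl]
    exact ⟨(.ofAdd (Pi.single 0 1), 1), by simp [holInl_apply]⟩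
  rw [← map_pow, h2, map_one, shift_pow_eq] at h1
  have h3 : holInl (1 + j) n (.ofAdd (Pi.single 0 1), 1) = 1 := by
    rw [holInl_apply, map_one, mul_one, h1]
  rw [map_eq_one_iff _ (holInl_injective _ n)] at h3
  have := congrFun (congrArg (fun x : Elem (n + 1) × Elem (n + 1) => x.1.toAdd) h3) 0
  simp at this

end

/-! ### Upper bounds for orders from relations -/

section Counting

variable {P : Type*} [Group P]

/-- For a finite subgroup an inclusion under conjugation is an equality, so the hypothesis is needed
only for the elements of `T` and not for their inverses. -/
lemma normal_sup_of_conj_mem {K L : Subgroup P} [K.Normal] [Finite ↥(K ⊔ L)] (T : Set P)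
    (hT : K ⊔ L ⊔ Subgroup.closure T = ⊤)
    (h : ∀ g ∈ T, ∀ l ∈ L, g⁻¹ * l * g ∈ K ⊔ L) : (K ⊔ L).Normal := by
  rw [← Subgroup.normalizer_eq_top_iff, eq_top_iff, ← hT]
  refine sup_le Subgroup.le_normalizer ((Subgroup.closure_le _).2 fun g hg => ?_)
  have hmap : K ⊔ L ≤ (K ⊔ L).comap (MulAut.conj g⁻¹).toMonoidHom := by
    refine sup_le (fun x hx => ?_) fun x hx => ?_
    · exact (le_sup_left : K ≤ K ⊔ L) (Subgroup.Normal.conj_mem ‹_› x hx g⁻¹)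
    · simpa using h g hg x hx
  have : g⁻¹ ∈ Subgroup.normalizer ((K ⊔ L : Subgroup P) : Set P) :=
    Subgroup.mem_normalizer_fintype fun x hx => hmap hx
  exact (inv_mem_iff (H := Subgroup.normalizer ((K ⊔ L : Subgroup P) : Set P))).1 this

lemma finite_card_sup (K L : Subgroup P) [K.Normal] [Finite K] [Finite L] :
    Finite ↥(K ⊔ L) ∧ Nat.card ↥(K ⊔ L) ≤ Nat.card K * Nat.card L := by
  have hs : Function.Surjective (fun x : K × L =>
      (⟨x.1 * x.2, mul_mem (Subgroup.mem_sup_left x.1.2) (Subgroup.mem_sup_right x.2.2)⟩ :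
        ↥(K ⊔ L))) := by
    rintro ⟨g, hg⟩
    obtain ⟨x, hx, y, hy, rfl⟩ := Subgroup.mem_sup_of_normal_left.1 hg
    exact ⟨(⟨x, hx⟩, ⟨y, hy⟩), rfl⟩
  exact ⟨Finite.of_surjective _ hs, (Nat.card_le_card_of_surjective _ hs).trans
    (Nat.card_prod _ _).le⟩

lemma finite_card_sup_zpowers (K : Subgroup P) [K.Normal] [Finite K] {g : P} {r : ℕ} (hr : 0 < r)
    (hg : g ^ r ∈ K) : Finite ↥(K ⊔ Subgroup.zpowers g) ∧
      Nat.card ↥(K ⊔ Subgroup.zpowers g) ≤ Nat.card K * r := by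
  have hs : Function.Surjective (fun x : K × Fin r =>
      (⟨x.1 * g ^ (x.2 : ℕ), mul_mem (Subgroup.mem_sup_left x.1.2)
        (Subgroup.mem_sup_right (Subgroup.npow_mem_zpowers g _))⟩ :
          ↥(K ⊔ Subgroup.zpowers g))) := by
    rintro ⟨a, ha⟩
    obtain ⟨x, hx, y, ⟨z, rfl⟩, rfl⟩ := Subgroup.mem_sup_of_normal_left.1 ha
    have hr' : (0 : ℤ) < r := by exact_mod_cast hr
    refine ⟨(⟨x * (g ^ r) ^ (z / r), mul_mem hx (zpow_mem hg _)⟩,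
      ⟨(z % r).toNat, ?_⟩), Subtype.ext ?_⟩
    · have := Int.emod_lt_of_pos z hr'
      have := Int.emod_nonneg z hr'.ne'
      omega
    · change x * (g ^ r) ^ (z / r) * g ^ (z % r).toNat = x * g ^ z
      rw [mul_assoc, ← zpow_natCast g (z % r).toNat, Int.toNat_of_nonneg
        (Int.emod_nonneg z hr'.ne'), ← zpow_natCast g r, ← zpow_mul, ← zpow_add,
        Int.mul_ediv_add_emod]
  exact ⟨Finite.of_surjective _ hs, (Nat.card_le_card_of_surjective _ hs).trans
    (by rw [Nat.card_prod, Nat.card_fin])⟩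

lemma closure_insert_eq_sup (g : P) (T : Set P) :
    Subgroup.closure (insert g T) = Subgroup.zpowers g ⊔ Subgroup.closure T := by
  rw [Set.insert_eq, Subgroup.closure_union, Subgroup.zpowers_eq_closure]

/-- The order of a group generated by a finite normal subgroup `N`, a subgroup `X`, and elements
`s`, `t`, `u` that centralize `X` and satisfy the relations of a group `C_a ⋊ (C_b × C_2)`
modulo `N`. -/
lemma finite_card_of_relations {N X : Subgroup P} [N.Normal] [Finite N] [Finite X] {s t u : P}
    {a b : ℕ} (ha : 0 < a) (hb : 0 < b)
    (hgen : N ⊔ X ⊔ Subgroup.closure {s, t, u} = ⊤)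
    (hX : ∀ x ∈ X, Commute x s ∧ Commute x t ∧ Commute x u)
    (hs : s ^ a ∈ N) (ht : t ^ b ∈ N) (hu : u ^ 2 = 1) (htu : Commute t u)
    (hst : t⁻¹ * s * t = s ^ 5) (hsu : u⁻¹ * s * u = s⁻¹) :
    Finite P ∧ Nat.card P ≤ Nat.card N * Nat.card X * a * b * 2 := by
  -- In the tower `N ≤ NX ≤ NX⟨s⟩ ≤ NX⟨s⟩⟨t⟩ ≤ P` the terms before the last are normal, so adjoining
  -- `s`, `t`, `u` multiplies the order by at most `a`, `b`, 2.
  obtain ⟨f1, c1⟩ := finite_card_sup N X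
  have conj : ∀ {x g : P}, Commute x g → g⁻¹ * x * g = x := fun {x g} h => by
    rw [mul_assoc, h.eq, inv_mul_cancel_left]
  have n1 : (N ⊔ X).Normal := normal_sup_of_conj_mem {s, t, u} hgen (by
    rintro g (rfl | rfl | rfl) x hx
    · rw [conj (hX x hx).1]
      exact Subgroup.mem_sup_right hx
    · rw [conj (hX x hx).2.1]
      exact Subgroup.mem_sup_right hx
    · rw [conj (hX x hx).2.2]
      exact Subgroup.mem_sup_right hx)
  obtain ⟨f2, c2⟩ := finite_card_sup_zpowers (N ⊔ X) ha (Subgroup.mem_sup_left hs)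
  rw [closure_insert_eq_sup, ← sup_assoc] at hgen
  have zp : ∀ {x y g : P}, g⁻¹ * x * g ∈ Subgroup.zpowers x → y ∈ Subgroup.zpowers x →
      g⁻¹ * y * g ∈ Subgroup.zpowers x := by
    rintro x y g h ⟨z, rfl⟩
    have := zpow_mem h z
    have e : (g⁻¹ * x * g) ^ z = g⁻¹ * x ^ z * g := by
      simpa using (conj_zpow (i := z) (a := g⁻¹) (b := x))
    rwa [e] at this
  have n2 : (N ⊔ X ⊔ Subgroup.zpowers s).Normal := normal_sup_of_conj_mem {t, u} hgen (by
    rintro g (rfl | rfl) x hx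
    · exact Subgroup.mem_sup_right (zp (hst ▸ Subgroup.npow_mem_zpowers _ _) hx)
    · exact Subgroup.mem_sup_right (zp (hsu ▸ inv_mem (Subgroup.mem_zpowers _)) hx))
  obtain ⟨f3, c3⟩ := finite_card_sup_zpowers (N ⊔ X ⊔ Subgroup.zpowers s) hb
    (Subgroup.mem_sup_left (Subgroup.mem_sup_left ht))
  rw [closure_insert_eq_sup, ← sup_assoc] at hgen
  have n3 : (N ⊔ X ⊔ Subgroup.zpowers s ⊔ Subgroup.zpowers t).Normal :=
    normal_sup_of_conj_mem {u} hgen (by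
      rintro g rfl x hx
      exact Subgroup.mem_sup_right (zp ((conj htu).symm ▸ Subgroup.mem_zpowers _) hx))
  obtain ⟨f4, c4⟩ := finite_card_sup_zpowers
    (N ⊔ X ⊔ Subgroup.zpowers s ⊔ Subgroup.zpowers t) two_pos (hu ▸ one_mem _ : u ^ 2 ∈ _)
  rw [← Subgroup.zpowers_eq_closure] at hgen
  rw [hgen] at f4 c4
  rw [Subgroup.card_top] at c4
  refine ⟨Subgroup.topEquiv.symm.toEquiv.finite_iff.2 f4, c4.trans ?_⟩
  gcongr
  refine c3.trans ?_
  gcongr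
  refine c2.trans ?_
  gcongr

end Counting

/-! ### The order of the holomorph and the units of `ℤ/2^(k+2)` -/

lemma card_hol_CE (k n : ℕ) : Nat.card (Hol (CE k n)) =
    Nat.card (Elem (n + 1) × Elem (n + 1)) * Nat.card (Aff n) * (2 ^ (k + 1) * 2 ^ k) := by
  have h1 : Nat.card (Hol (Cyc (2 ^ (k + 1)))) = 2 ^ (k + 1) * 2 ^ k := by
    rw [SemidirectProduct.card, IsCyclic.card_mulAut]
    simp [Nat.card_eq_fintype_card, ZMod.card, Nat.totient_prime_pow_succ Nat.prime_two]
  rw [Subgroup.card_eq_card_quotient_mul_card_subgroup (holRight k n).ker,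
    Nat.card_congr (QuotientGroup.quotientKerEquivOfSurjective _ (holRight_surjective k n)).toEquiv,
    Nat.card_prod, h1, ← range_holInl, ← Nat.card_congr (affEquiv n).toEquiv,
    ← Nat.card_congr (MonoidHom.ofInjective (holInl_injective k n)).toEquiv]
  ring

lemma holRight_mtx {k n : ℕ} (B : Aff n) : holRight k n (mtx k n B) = (affEquiv n B, 1) := by
  refine Prod.ext ?_ (SemidirectProduct.ext (map_one (redHom k n)) ?_)
  · exact congrArg (affEquiv n) (rowHom_matAut B)
  · exact quotientHom_matAut B

lemma holRight_shift_fst {k n : ℕ} : (holRight k n (shift k n)).1 = 1 := by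
  change affEquiv n (rowHom k n 1) = 1
  rw [map_one, map_one]

lemma holRight_unt_fst {k n : ℕ} (u : (ZMod (2 ^ (k + 2)))ˣ) :
    (holRight k n (unt k n u)).1 = 1 := by
  change affEquiv n (rowHom k n (unitAut k n u)) = 1
  rw [rowHom_unitAut, map_one]

lemma holRight_trl {k n : ℕ} (x : Elem (n + 1)) : holRight k n (trl k n x) = 1 := by
  rw [← MonoidHom.mem_ker, ← range_holInl]
  exact ⟨(x, 1), by rw [holInl_apply, map_one, mul_one]⟩

lemma holRight_tvn {k n : ℕ} (w : Elem (n + 1)) : holRight k n (tvn k n w) = 1 := by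
  rw [← MonoidHom.mem_ker, ← range_holInl]
  exact ⟨(1, w), by rw [holInl_apply, map_one, one_mul]⟩

/-- The unit `5` of `ℤ/2^(k+2)`. -/
def five (k : ℕ) : (ZMod (2 ^ (k + 2)))ˣ :=
  ZMod.unitOfCoprime 5 (Nat.Coprime.pow_right _ (by norm_num))

lemma five_val (k : ℕ) : (five k : ZMod (2 ^ (k + 2))) = 5 := by
  rw [five, ZMod.coe_unitOfCoprime, Nat.cast_ofNat]

/-- The powers of 5 form a subgroup of index 2 in the units, and `-1` lies outside it because 5 is 1
modulo 4. -/
lemma closure_five_neg_one (k : ℕ) :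
    Subgroup.zpowers (five k) ⊔ Subgroup.zpowers (-1) = ⊤ := by
  have h5 : Nat.card (Subgroup.zpowers (five k)) = 2 ^ k := by
    rw [Nat.card_zpowers, ← orderOf_units, five_val, ZMod.orderOf_five]
  have hc : Nat.card (ZMod (2 ^ (k + 2)))ˣ = 2 ^ k * 2 := by
    rw [Nat.card_eq_fintype_card, ZMod.card_units_eq_totient,
      Nat.totient_prime_pow_succ Nat.prime_two, pow_succ, show 2 - 1 = 1 from rfl, mul_one]
  have hd := Subgroup.card_dvd_of_le
    (le_sup_left : Subgroup.zpowers (five k) ≤ Subgroup.zpowers (five k) ⊔ Subgroup.zpowers (-1))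
  have hd2 := Subgroup.card_subgroup_dvd_card
    (Subgroup.zpowers (five k) ⊔ Subgroup.zpowers (-1))
  rw [h5] at hd
  obtain ⟨j, hj⟩ := hd
  rw [hc, hj] at hd2
  have hj2 := (Nat.dvd_prime Nat.prime_two).1 (Nat.dvd_of_mul_dvd_mul_left (by positivity) hd2)
  refine Subgroup.eq_top_of_card_eq _ ?_
  rw [hc, hj]
  rcases hj2 with rfl | rfl
  · exfalso
    have heq := Subgroup.eq_of_le_of_card_ge
      (le_sup_left : Subgroup.zpowers (five k) ≤ Subgroup.zpowers (five k) ⊔ Subgroup.zpowers (-1))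
      (by rw [hj, h5, mul_one])
    have hmem : (-1 : (ZMod (2 ^ (k + 2)))ˣ) ∈ Subgroup.zpowers (five k) := by
      rw [heq]
      exact Subgroup.mem_sup_right (Subgroup.mem_zpowers _)
    let r : ZMod (2 ^ (k + 2)) →+* ZMod 4 :=
      ZMod.castHom (pow_dvd_pow 2 (Nat.le_add_left 2 k)) _
    obtain ⟨z, hz⟩ := hmem
    have h1 : Units.map r.toMonoidHom (five k) = 1 := by
      ext
      change r (five k).val = 1
      rw [five_val, map_ofNat]
      rfl
    have h2 := congrArg (Units.map r.toMonoidHom) hz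
    simp only [map_zpow, h1, one_zpow] at h2
    have h3 := congrArg Units.val h2
    change (1 : ZMod 4) = r (-1) at h3
    rw [map_neg, map_one] at h3
    exact absurd h3 (by decide)
  · rfl

lemma five_pow (k : ℕ) : (five (k + 1) : ZMod (2 ^ (k + 3))) ^ 2 ^ k = 1 + 2 ^ (k + 2) := by
  have h : ∀ j : ℕ, ∃ c : ℕ, 5 ^ 2 ^ j = 1 + 2 ^ (j + 2) * (2 * c + 1) := by
    intro j
    induction j with
    | zero => exact ⟨0, by norm_num⟩
    | succ j ih =>
      obtain ⟨c, hc⟩ := ih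
      -- Squaring `1 + 2 ^ (j + 2) * q` with `q = 2 * c + 1` gives the new odd factor `q + 2 ^ (j +
      -- 1) * q ^ 2`.
      refine ⟨c + 2 ^ j * (2 * c + 1) ^ 2, ?_⟩
      rw [pow_succ, pow_mul, hc]
      ring
  obtain ⟨c, hc⟩ := h k
  have h0 : ((2 ^ (k + 3) : ℕ) : ZMod (2 ^ (k + 3))) = 0 := ZMod.natCast_self _
  have h1 := congrArg (Nat.cast : ℕ → ZMod (2 ^ (k + 3))) hc
  push_cast at h0 h1
  rw [five_val, h1]
  linear_combination (c : ZMod (2 ^ (k + 3))) * h0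

lemma unitAut_cgen_zpow {k n : ℕ} (u : (ZMod (2 ^ (k + 2)))ˣ) (j : ℤ)
    (h : (j : ZMod (2 ^ (k + 2))) = u) : unitAut k n u (cgen k n) = cgen k n ^ j := by
  refine Prod.ext ?_ ?_
  · refine congrArg Multiplicative.ofAdd (a₁ := u * (1 : ZMod (2 ^ (k + 2))))
      (a₂ := j • (1 : ZMod (2 ^ (k + 2)))) ?_
    rw [mul_one, zsmul_one, h]
  · simp [cgen, unitAut_apply]

lemma unt_mul_shift_zpow {k n : ℕ} (u : (ZMod (2 ^ (k + 2)))ˣ) (j : ℤ)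
    (h : (j : ZMod (2 ^ (k + 2))) = u) :
    unt k n u * shift k n * (unt k n u)⁻¹ = shift k n ^ j := by
  rw [mul_inv_eq_iff_eq_mul]
  refine (hol_inr_mul_inl _ _).trans ?_
  rw [unitAut_cgen_zpow u j h, map_zpow]
  rfl

/-- By `five_pow` this is multiplication by `1 + 2 ^ (k + 2)`, which adds to the generator the
element of order 2 in the cyclic factor. This is the source of the relation `t^(n_4) d = 1`. -/
lemma unt_five_pow (k n : ℕ) :
    unt (k + 1) n (five (k + 1)) ^ 2 ^ k = tvn (k + 1) n (.ofAdd (Pi.single 0 1)) := by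
  rw [← map_pow]
  refine congrArg SemidirectProduct.inr (CE_aut_ext ?_ fun x => ?_)
  · rw [transAut_cgen, om_single_zero, half_one]
    refine Prod.ext ?_ rfl
    refine congrArg Multiplicative.ofAdd (a₁ := (five (k + 1) ^ 2 ^ k).val *
      (1 : ZMod (2 ^ (k + 3)))) (a₂ := (1 : ZMod (2 ^ (k + 3))) + 2 ^ (k + 2)) ?_
    rw [mul_one, Units.val_pow_eq_pow_val, five_pow]
  · rw [unitAut_om, transAut_om]

/-! ### Recognizing the holomorph by its generators -/

section Recognition

variable {k n : ℕ} {P : Type*} [Group P] {α β : Elem (n + 1) →* P} {χ : Aff n →* P} {s t u : P}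
  {f : P →* Hol (CE (k + 1) n)}

/-- The shift and the translations `trl` give all translations. An automorphism has the same image
under `holRight` as a product of a matrix and a unit, so it differs from this product by an element
of the kernel, which is in the range. -/
lemma surjective_of_generators (hα : f.comp α = trl (k + 1) n) (hβ : f.comp β = tvn (k + 1) n)
    (hχ : f.comp χ = mtx (k + 1) n) (hs : f s = shift (k + 1) n)
    (ht : f t = unt (k + 1) n (five (k + 1))⁻¹) (hu : f u = unt (k + 1) n (-1)) :
    Function.Surjective f := by
  rw [← MonoidHom.range_eq_top, eq_top_iff]
  have h1 : ∀ x, trl (k + 1) n x ∈ f.range := fun x => ⟨α x, DFunLike.congr_fun hα x⟩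
  have h2 : ∀ x, tvn (k + 1) n x ∈ f.range := fun x => ⟨β x, DFunLike.congr_fun hβ x⟩
  have h3 : ∀ x, mtx (k + 1) n x ∈ f.range := fun x => ⟨χ x, DFunLike.congr_fun hχ x⟩
  have h4 : ∀ v, unt (k + 1) n v ∈ f.range := by
    have : Subgroup.zpowers (five (k + 1)) ⊔ Subgroup.zpowers (-1) ≤
        f.range.comap (unt (k + 1) n) := by
      rw [sup_le_iff, Subgroup.zpowers_le, Subgroup.zpowers_le]
      refine ⟨⟨t⁻¹, ?_⟩, u, hu⟩
      rw [map_inv, ht, map_inv, inv_inv]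
    rw [closure_five_neg_one] at this
    exact fun v => this (Subgroup.mem_top v)
  have h5 : ∀ g, SemidirectProduct.inl g ∈ f.range := by
    intro g
    obtain ⟨j, x, rfl⟩ := exists_eq_cgen_pow_mul_om g
    rw [map_mul, map_pow]
    exact mul_mem (pow_mem (hs ▸ ⟨s, rfl⟩ : shift (k + 1) n ∈ f.range) j) (h1 x)
  have h6 : ∀ φ, SemidirectProduct.inr φ ∈ f.range := by
    intro φ
    obtain ⟨v, hv⟩ := exists_quotientHom_unitAut (n := n) (quotientHom (k + 1) n φ)
    let g : Hol (CE (k + 1) n) :=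
      (mtx (k + 1) n (rowHom (k + 1) n φ) * unt (k + 1) n v)⁻¹ * SemidirectProduct.inr φ
    have hg : g ∈ (holInl (k + 1) n).range := by
      rw [range_holInl, MonoidHom.mem_ker, map_mul, map_inv, inv_mul_eq_one, map_mul, holRight_mtx]
      refine Prod.ext ?_ (SemidirectProduct.ext ?_ ?_)
      · rw [Prod.fst_mul, holRight_unt_fst, mul_one]
        rfl
      · exact (one_mul (redHom (k + 1) n 1)).trans rfl
      · exact (one_mul _).trans hv
    obtain ⟨x, hx⟩ := hg
    have : SemidirectProduct.inr φ =
        mtx (k + 1) n (rowHom (k + 1) n φ) * unt (k + 1) n v * holInl (k + 1) n x := by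
      rw [hx, mul_inv_cancel_left]
    rw [this]
    exact mul_mem (mul_mem (h3 _) (h4 v)) (mul_mem (h1 _) (h2 _))
  intro g _
  rw [← SemidirectProduct.inl_left_mul_inr_right g]
  exact mul_mem (h5 _) (h6 _)

/-- A group that satisfies the relations of `Hol(C_{2^(k+3)} × 1^n)` and maps to it compatibly with
the generators is isomorphic to it. -/
lemma bijective_of_relations
    (hgen : α.range ⊔ β.range ⊔ χ.range ⊔ Subgroup.closure {s, t, u} = ⊤)
    (hαβ : ∀ x y, Commute (α x) (β y)) (hN : (α.range ⊔ β.range).Normal)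
    (hX : ∀ x ∈ χ.range, Commute x s ∧ Commute x t ∧ Commute x u)
    (hsN : s ^ 2 ^ (k + 2) ∈ α.range ⊔ β.range) (htN : t ^ 2 ^ k ∈ α.range ⊔ β.range)
    (hu2 : u ^ 2 = 1) (htu : Commute t u) (hst : t⁻¹ * s * t = s ^ 5) (hsu : u⁻¹ * s * u = s⁻¹)
    (hf : Function.Surjective f) : Function.Bijective f := by
  have hr := MonoidHom.noncommCoprod_range α β hαβ
  have fN : Finite ↥(α.range ⊔ β.range) := by
    rw [← hr]
    exact Finite.of_surjective _ (MonoidHom.rangeRestrict_surjective _)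
  have cN : Nat.card ↥(α.range ⊔ β.range) ≤ Nat.card (Elem (n + 1) × Elem (n + 1)) := by
    rw [← hr]
    exact Nat.card_le_card_of_surjective _ (MonoidHom.rangeRestrict_surjective _)
  have fX : Finite (Aff n) := Finite.of_equiv _ (affEquiv n).symm.toEquiv
  have fX' : Finite χ.range := Finite.of_surjective _ χ.rangeRestrict_surjective
  have cX : Nat.card χ.range ≤ Nat.card (Aff n) :=
    Nat.card_le_card_of_surjective _ (MonoidHom.rangeRestrict_surjective _)
  -- Modulo the normal subgroup the exponents of `s` and `t` are `2 ^ (k + 2)` and `2 ^ k`, half of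
  -- those in `stuRelators`. This makes the bound equal to the order of the holomorph.
  obtain ⟨fP, cP⟩ := finite_card_of_relations (by positivity) (by positivity) hgen hX hsN htN hu2
    htu hst hsu
  refine (Nat.bijective_iff_surjective_and_card f).2
    ⟨hf, le_antisymm (cP.trans ?_) (Nat.card_le_card_of_surjective f hf)⟩
  rw [card_hol_CE, pow_succ 2 k]
  calc _ ≤ Nat.card (Elem (n + 1) × Elem (n + 1)) * Nat.card (Aff n) * 2 ^ (k + 2) * 2 ^ k * 2 := by
        gcongr
    _ = _ := by ring

/-- A group isomorphic to `Hol(C_{2^(k+3)} × 1^n)` compatibly with the generators has the form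
`[1^(n+1) × 1^(n+1)] · [Hol(1^n) × Hol(C_{2^(k+2)})]`. -/
lemma hasHolForm_of_bijective
    (hgen : α.range ⊔ β.range ⊔ χ.range ⊔ Subgroup.closure {s, t, u} = ⊤)
    (hα : f.comp α = trl (k + 1) n) (hβ : f.comp β = tvn (k + 1) n)
    (hχ : f.comp χ = mtx (k + 1) n) (hs : f s = shift (k + 1) n)
    (ht : f t = unt (k + 1) n (five (k + 1))⁻¹) (hu : f u = unt (k + 1) n (-1))
    (hf : Function.Bijective f) :
    HasHolForm n (k + 3) α.range β.range χ.range (Subgroup.closure {s, t, u}) := by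
  let e := MulEquiv.ofBijective f hf
  have he : ∀ x, e x = f x := fun _ => rfl
  have hes : ∀ x, f (e.symm x) = x := e.apply_symm_apply
  let ρ := (holRight (k + 1) n).comp f
  have hρα : ∀ x, ρ (α x) = 1 := fun x => by
    rw [MonoidHom.comp_apply, ← MonoidHom.comp_apply f α, hα, holRight_trl]
  have hρβ : ∀ x, ρ (β x) = 1 := fun x => by
    rw [MonoidHom.comp_apply, ← MonoidHom.comp_apply f β, hβ, holRight_tvn]
  have hρχ : ∀ x, ρ (χ x) = (affEquiv n x, 1) := fun x => by
    rw [MonoidHom.comp_apply, ← MonoidHom.comp_apply f χ, hχ, holRight_mtx]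
  have hX : χ.range.map ρ = Subgroup.prod ⊤ ⊥ := by
    ext ⟨a, b⟩
    rw [Subgroup.mem_map, Subgroup.mem_prod, Subgroup.mem_bot]
    constructor
    · rintro ⟨_, ⟨x, rfl⟩, hx⟩
      rw [hρχ, Prod.mk.injEq] at hx
      exact ⟨Subgroup.mem_top _, hx.2.symm⟩
    · rintro ⟨-, h⟩
      refine ⟨χ ((affEquiv n).symm a), ⟨_, rfl⟩, ?_⟩
      rw [hρχ, MulEquiv.apply_symm_apply]
      exact Prod.ext rfl h.symm
  have hY1 : (Subgroup.closure {s, t, u}).map ρ ≤ Subgroup.prod ⊥ ⊤ := by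
    rw [Subgroup.map_le_iff_le_comap, Subgroup.closure_le]
    rintro g (rfl | rfl | rfl) <;>
      refine Subgroup.mem_prod.2 ⟨Subgroup.mem_bot.2 ?_, Subgroup.mem_top _⟩ <;>
      rw [MonoidHom.comp_apply]
    · rw [hs, holRight_shift_fst]
    · rw [ht, holRight_unt_fst]
    · rw [hu, holRight_unt_fst]
  -- The map `ρ` is onto, kills `α` and `β`, and sends `χ` into the first factor only, so the second
  -- factor must come from `s`, `t`, `u`.
  have hY : (Subgroup.closure {s, t, u}).map ρ = Subgroup.prod ⊥ ⊤ := by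
    refine le_antisymm hY1 ?_
    have htop : (⊤ : Subgroup P).map ρ = ⊤ :=
      Subgroup.map_top_of_surjective _ ((holRight_surjective _ _).comp hf.2)
    have b1 : α.range.map ρ = ⊥ := by
      rw [Subgroup.map_eq_bot_iff]
      rintro _ ⟨x, rfl⟩
      exact hρα x
    have b2 : β.range.map ρ = ⊥ := by
      rw [Subgroup.map_eq_bot_iff]
      rintro _ ⟨x, rfl⟩
      exact hρβ x
    rw [← hgen, Subgroup.map_sup, Subgroup.map_sup, Subgroup.map_sup, b1, b2, bot_sup_eq,
      bot_sup_eq, hX] at htop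
    rintro ⟨a, b⟩ hab
    obtain ⟨ha, -⟩ := Subgroup.mem_prod.1 hab
    obtain ⟨⟨c, d⟩, hc, y, hy, hcy⟩ := Subgroup.mem_sup_of_normal_left.1
      (htop ▸ Subgroup.mem_top (a, b) : (a, b) ∈ _)
    obtain ⟨hy1, -⟩ := Subgroup.mem_prod.1 (hY1 hy)
    obtain ⟨-, hd⟩ := Subgroup.mem_prod.1 hc
    have : y = (a, b) := by
      refine Prod.ext ((Subgroup.mem_bot.1 hy1).trans (Subgroup.mem_bot.1 ha).symm) ?_
      rw [← hcy, Prod.snd_mul, Subgroup.mem_bot.1 hd, one_mul]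
    exact this ▸ hy
  refine ⟨{ inl := e.symm.toMonoidHom.comp (holInl (k + 1) n), rightHom := ρ,
            inl_injective := e.symm.injective.comp (holInl_injective _ _),
            range_inl_eq_ker_rightHom := ?_,
            rightHom_surjective := (holRight_surjective _ _).comp hf.2 }, ?_, ?_, ?_, hX, hY⟩
  · ext g
    rw [MonoidHom.mem_ker, MonoidHom.comp_apply, ← MonoidHom.mem_ker, ← range_holInl]
    constructor
    · rintro ⟨x, rfl⟩
      exact ⟨x, (hes _).symm⟩
    · rintro ⟨x, hx⟩
      exact ⟨x, hf.1 ((hes _).trans hx)⟩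
  · ext g
    constructor
    · rintro ⟨x, rfl⟩
      refine ⟨(x, 1), ⟨Subgroup.mem_top _, rfl⟩, hf.1 ((hes _).trans ?_)⟩
      rw [holInl_apply, map_one, mul_one, ← hα]
      rfl
    · rintro ⟨⟨x, y⟩, ⟨-, hy⟩, rfl⟩
      refine ⟨x, hf.1 (Eq.trans ?_ (hes _).symm)⟩
      rw [holInl_apply, show y = 1 from hy, map_one, mul_one, ← hα]
      rfl
  · ext g
    constructor
    · rintro ⟨x, rfl⟩
      refine ⟨(1, x), ⟨rfl, Subgroup.mem_top _⟩, hf.1 ((hes _).trans ?_)⟩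
      rw [holInl_apply, map_one, one_mul, ← hβ]
      rfl
    · rintro ⟨⟨x, y⟩, ⟨hx, -⟩, rfl⟩
      refine ⟨y, hf.1 (Eq.trans ?_ (hes _).symm)⟩
      rw [holInl_apply, show x = 1 from hx, map_one, one_mul, ← hβ]
      rfl
  · rintro _ ⟨x, rfl⟩ _ ⟨y, rfl⟩ hxy
    have : ρ (χ x) = ρ (χ y) := hxy
    rw [hρχ, hρχ, Prod.mk.injEq] at this
    rw [(affEquiv n).injective this.1]

end Recognition

/-! ### Coset enumerations -/

/-- The coset table of the dihedral subgroup generated by the first two generators in the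
presentation of `GL_3(𝔽₂)` by three involutions. -/
lemma exists_coset_table {X : Type*} {f g h : X → X} {p0 : X} (ff : ∀ x, f (f x) = x)
    (gg : ∀ x, g (g x) = x) (hh : ∀ x, h (h x) = x)
    (r0 : ∀ x, g (h (g (h (g (h x))))) = x)
    (r1 : ∀ x, f (g (f (g (f (g (f (g x))))))) = x)
    (r2 : ∀ x, f (h (f (h (f (h (f (h x))))))) = x)
    (r3 : ∀ x, f (g (h (g (f (g (h (g (f (g (h (g x))))))))))) = x)
    (r4 : ∀ x, f (g (f (g (h (f (h (g (f (g (h (f (h x)))))))))))) = x)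
    (f0 : f p0 = p0) (g0 : g p0 = p0) :
    ∃ c : Fin 21 → X, c 0 = p0 ∧
      ∀ i, (∃ j, f (c i) = c j) ∧ (∃ j, g (c i) = c j) ∧ ∃ j, h (c i) = c j := by
  -- This is a Todd–Coxeter enumeration. Each `obtain` names a coset; in each deduction a relator is
  -- traced from one coset in both directions, and the meeting point gives a new table entry. The
  -- points need not be distinct, since only an upper bound is wanted.
  obtain ⟨p1, h0⟩ : ∃ p, h p0 = p := ⟨_, rfl⟩
  have h1 : h p1 = p0 := by rw [← h0, hh]
  obtain ⟨p2, g1⟩ : ∃ p, g p1 = p := ⟨_, rfl⟩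
  have g2 : g p2 = p1 := by rw [← g1, gg]
  have h2 : h p2 = p2 := by
    have e := r0 p0
    simp only [h0, g1] at e
    have e' := congrArg (fun x => g (h (g x))) e
    simpa only [gg, hh, g0, h0, g1] using e'
  obtain ⟨p3, f1⟩ : ∃ p, f p1 = p := ⟨_, rfl⟩
  have f3 : f p3 = p1 := by rw [← f1, ff]
  obtain ⟨p4, g3⟩ : ∃ p, g p3 = p := ⟨_, rfl⟩
  have g4 : g p4 = p3 := by rw [← g3, gg]
  obtain ⟨p5, h4⟩ : ∃ p, h p4 = p := ⟨_, rfl⟩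
  have h5 : h p5 = p4 := by rw [← h4, hh]
  obtain ⟨p6, f5⟩ : ∃ p, f p5 = p := ⟨_, rfl⟩
  have f6 : f p6 = p5 := by rw [← f5, ff]
  obtain ⟨p7, f4⟩ : ∃ p, f p4 = p := ⟨_, rfl⟩
  have f7 : f p7 = p4 := by rw [← f4, ff]
  obtain ⟨p8, g6⟩ : ∃ p, g p6 = p := ⟨_, rfl⟩
  have g8 : g p8 = p6 := by rw [← g6, gg]
  obtain ⟨p9, g5⟩ : ∃ p, g p5 = p := ⟨_, rfl⟩
  have g9 : g p9 = p5 := by rw [← g5, gg]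
  have f9 : f p9 = p9 := by
    have e := r3 p1
    simp only [g1, h2, g2, f1, g3, h4, g5] at e
    have e' := congrArg (fun x => g (h (g (f x)))) e
    simpa only [gg, hh, ff, f1, g3, h4, g5] using e'
  have f8 : f p8 = p8 := by
    have e := r1 p5
    simp only [g5, f9, g9, f5, g6] at e
    have e' := congrArg (fun x => g (f x)) e
    simpa only [gg, ff, f5, g6] using e'
  obtain ⟨p10, h3⟩ : ∃ p, h p3 = p := ⟨_, rfl⟩
  have h10 : h p10 = p3 := by rw [← h3, hh]
  have f10 : f p10 = p10 := by
    have e := r2 p0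
    simp only [h0, f1, h3] at e
    have e' := congrArg (fun x => h (f (h (f x)))) e
    simpa only [hh, ff, f0, h0, f1, h3] using e'
  obtain ⟨p11, h6⟩ : ∃ p, h p6 = p := ⟨_, rfl⟩
  have h11 : h p11 = p6 := by rw [← h6, hh]
  obtain ⟨p12, h7⟩ : ∃ p, h p7 = p := ⟨_, rfl⟩
  have h12 : h p12 = p7 := by rw [← h7, hh]
  obtain ⟨p13, g7⟩ : ∃ p, g p7 = p := ⟨_, rfl⟩
  have g13 : g p13 = p7 := by rw [← g7, gg]
  obtain ⟨p14, f2⟩ : ∃ p, f p2 = p := ⟨_, rfl⟩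
  have f14 : f p14 = p2 := by rw [← f2, ff]
  obtain ⟨p15, f11⟩ : ∃ p, f p11 = p := ⟨_, rfl⟩
  have f15 : f p15 = p11 := by rw [← f11, ff]
  obtain ⟨p16, g10⟩ : ∃ p, g p10 = p := ⟨_, rfl⟩
  have g16 : g p16 = p10 := by rw [← g10, gg]
  have h16 : h p16 = p9 := by
    have e := r0 p3
    simp only [h3, g10] at e
    have e' := congrArg (fun x => g (h (g x))) e
    simpa only [gg, hh, g3, h4, g5] using e'
  have h9 : h p9 = p16 := by rw [← h16, hh]
  have h8 : h p8 = p8 := by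
    have e := r3 p5
    simp only [g5, h9, g16, f10, g10, h16, g9, f5, g6] at e
    have e' := congrArg (fun x => g (f x)) e
    simpa only [gg, ff, f5, g6] using e'
  have f16 : f p16 = p16 := by
    have e := r4 p0
    simp only [h0, f1, h3, g10] at e
    have e' := congrArg (fun x => g (h (f (h (g (f (g (f x)))))))) e
    simpa only [gg, hh, ff, f0, g0, h0, f1, h3, g10] using e'
  have g11 : g p11 = p11 := by
    have e := r0 p6
    simp only [h6] at e
    have e' := congrArg (fun x => h (g (h (g x)))) e
    simpa only [hh, gg, g6, h8, g8, h6] using e'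
  have h13 : h p13 = p13 := by
    have e := r3 p4
    simp only [g4, h3, g10, f16, g16, h10, g3, f4, g7] at e
    have e' := congrArg (fun x => g (f x)) e
    simpa only [gg, ff, f4, g7] using e'
  have g12 : g p12 = p12 := by
    have e := r0 p7
    simp only [h7] at e
    have e' := congrArg (fun x => h (g (h (g x)))) e
    simpa only [hh, gg, g7, h13, g13, h7] using e'
  obtain ⟨p17, g14⟩ : ∃ p, g p14 = p := ⟨_, rfl⟩
  have g17 : g p17 = p14 := by rw [← g14, gg]
  have f17 : f p17 = p13 := by
    have e := r1 p1
    simp only [g1, f2, g14] at e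
    have e' := congrArg (fun x => g (f (g (f x)))) e
    simpa only [gg, ff, f1, g3, f4, g7] using e'
  have f13 : f p13 = p17 := by rw [← f17, ff]
  have h17 : h p17 = p17 := by
    have e := r3 p0
    simp only [g0, h0, g1, f2, g14] at e
    have e' := congrArg (fun x => g (f (g (h (g (f x)))))) e
    simpa only [gg, ff, hh, f0, g0, h0, g1, f2, g14] using e'
  obtain ⟨p18, f12⟩ : ∃ p, f p12 = p := ⟨_, rfl⟩
  have f18 : f p18 = p12 := by rw [← f12, ff]
  have h15 : h p15 = p18 := by
    have e := r2 p4
    simp only [h4, f5, h6, f11] at e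
    have e' := congrArg (fun x => f (h (f x))) e
    simpa only [ff, hh, f4, h7, f12] using e'
  have h18 : h p18 = p15 := by rw [← h15, hh]
  have g18 : g p18 = p18 := by
    have e := r4 p5
    simp only [h5, f4, h7, g12, f12] at e
    have e' := congrArg (fun x => h (f (h (g (f (g (f x))))))) e
    simpa only [hh, ff, gg, f5, g6, f8, g8, h6, f11, h15] using e'
  obtain ⟨p19, h14⟩ : ∃ p, h p14 = p := ⟨_, rfl⟩
  have h19 : h p19 = p14 := by rw [← h14, hh]
  have g19 : g p19 = p19 := by
    have e := r0 p14
    simp only [h14] at e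
    have e' := congrArg (fun x => h (g (h (g x)))) e
    simpa only [hh, gg, g14, h17, g17, h14] using e'
  obtain ⟨p20, f19⟩ : ∃ p, f p19 = p := ⟨_, rfl⟩
  have f20 : f p20 = p19 := by rw [← f19, ff]
  have h20 : h p20 = p20 := by
    have e := r2 p2
    simp only [h2, f2, h14, f19] at e
    have e' := congrArg (fun x => f (h (f x))) e
    simpa only [ff, hh, f2, h14, f19] using e'
  have g20 : g p20 = p15 := by
    have e := r3 p12
    simp only [g12, h12, g7, f13, g17, h14, g19, f19] at e
    have e' := congrArg (fun x => h (g (f x))) e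
    simpa only [hh, gg, ff, f12, g18, h18] using e'
  have g15 : g p15 = p20 := by rw [← g20, gg]
  refine ⟨![p0, p1, p2, p3, p4, p5, p6, p7, p8, p9, p10, p11, p12, p13, p14, p15, p16, p17, p18, p19, p20], rfl, fun i => ?_⟩
  fin_cases i
  · exact ⟨⟨0, f0⟩, ⟨0, g0⟩, ⟨1, h0⟩⟩
  · exact ⟨⟨3, f1⟩, ⟨2, g1⟩, ⟨0, h1⟩⟩
  · exact ⟨⟨14, f2⟩, ⟨1, g2⟩, ⟨2, h2⟩⟩
  · exact ⟨⟨1, f3⟩, ⟨4, g3⟩, ⟨10, h3⟩⟩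
  · exact ⟨⟨7, f4⟩, ⟨3, g4⟩, ⟨5, h4⟩⟩
  · exact ⟨⟨6, f5⟩, ⟨9, g5⟩, ⟨4, h5⟩⟩
  · exact ⟨⟨5, f6⟩, ⟨8, g6⟩, ⟨11, h6⟩⟩
  · exact ⟨⟨4, f7⟩, ⟨13, g7⟩, ⟨12, h7⟩⟩
  · exact ⟨⟨8, f8⟩, ⟨6, g8⟩, ⟨8, h8⟩⟩
  · exact ⟨⟨9, f9⟩, ⟨5, g9⟩, ⟨16, h9⟩⟩
  · exact ⟨⟨10, f10⟩, ⟨16, g10⟩, ⟨3, h10⟩⟩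
  · exact ⟨⟨15, f11⟩, ⟨11, g11⟩, ⟨6, h11⟩⟩
  · exact ⟨⟨18, f12⟩, ⟨12, g12⟩, ⟨7, h12⟩⟩
  · exact ⟨⟨17, f13⟩, ⟨7, g13⟩, ⟨13, h13⟩⟩
  · exact ⟨⟨2, f14⟩, ⟨17, g14⟩, ⟨19, h14⟩⟩
  · exact ⟨⟨11, f15⟩, ⟨20, g15⟩, ⟨18, h15⟩⟩
  · exact ⟨⟨16, f16⟩, ⟨10, g16⟩, ⟨9, h16⟩⟩
  · exact ⟨⟨13, f17⟩, ⟨14, g17⟩, ⟨17, h17⟩⟩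
  · exact ⟨⟨12, f18⟩, ⟨18, g18⟩, ⟨15, h18⟩⟩
  · exact ⟨⟨20, f19⟩, ⟨19, g19⟩, ⟨14, h19⟩⟩
  · exact ⟨⟨19, f20⟩, ⟨15, g20⟩, ⟨20, h20⟩⟩

section Cosets

variable {P : Type*} [Group P]

open Pointwise in
/-- A subgroup generated by a set that permutes finitely many cosets of a finite subgroup. -/
lemma finite_card_closure_le {T : Set P} {H : Subgroup P} [Finite H] {N : ℕ} (c : Fin N → P ⧸ H)
    {i₀ : Fin N} (h0 : c i₀ = ((1 : P) : P ⧸ H)) (hc : ∀ g ∈ T, ∀ i, ∃ j, g • c i = c j) :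
    Finite (Subgroup.closure T) ∧ Nat.card (Subgroup.closure T) ≤ N * Nat.card H := by
  classical
  -- A finite set mapped into itself by each element of `T` is stabilized by the group that `T`
  -- generates, so this group sends the base coset only to the listed ones.
  have hstab : Subgroup.closure T ≤
      MulAction.stabilizer P (Finset.univ.image c : Finset (P ⧸ H)) := by
    rw [Subgroup.closure_le]
    intro g hg
    rw [SetLike.mem_coe, MulAction.mem_stabilizer_finset']
    intro x hx
    obtain ⟨i, -, rfl⟩ := Finset.mem_image.1 hx
    obtain ⟨j, hj⟩ := hc g hg i
    rw [hj]
    exact Finset.mem_image_of_mem _ (Finset.mem_univ j)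
  have hmem : ∀ g : Subgroup.closure T, ∃ i, c i = ((g : P) : P ⧸ H) := by
    intro g
    have := (MulAction.mem_stabilizer_finset'.1 (hstab g.2))
      (Finset.mem_image_of_mem c (Finset.mem_univ i₀))
    obtain ⟨i, -, hi⟩ := Finset.mem_image.1 this
    refine ⟨i, hi.trans ?_⟩
    rw [h0, MulAction.Quotient.smul_coe, smul_eq_mul, mul_one]
  choose r hr using hmem
  let F : Subgroup.closure T → Fin N × H := fun g =>
    (r g, ⟨(c (r g)).out⁻¹ * g, by
      rw [← QuotientGroup.eq, QuotientGroup.out_eq', hr]⟩)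
  have hF : Function.Injective F := by
    intro a b hab
    have h1 : r a = r b := congrArg Prod.fst hab
    have h2 : (c (r a)).out⁻¹ * (a : P) = (c (r b)).out⁻¹ * b :=
      congrArg (fun x => (x.2 : P)) hab
    rw [h1] at h2
    exact Subtype.ext (mul_left_cancel h2)
  refine ⟨Finite.of_injective F hF, (Nat.card_le_card_of_injective F hF).trans ?_⟩
  rw [Nat.card_prod, Nat.card_fin]

lemma finite_card_zpowers_le {g : P} {r : ℕ} (hr : 0 < r) (h : g ^ r = 1) :
    Finite (Subgroup.zpowers g) ∧ Nat.card (Subgroup.zpowers g) ≤ r := by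
  have hg : IsOfFinOrder g := isOfFinOrder_iff_pow_eq_one.2 ⟨r, hr, h⟩
  exact ⟨hg.finite_zpowers, by rw [Nat.card_zpowers]; exact orderOf_le_of_pow_eq_one hr h⟩

lemma mk_one_eq_smul_of_mem {H : Subgroup P} {g : P} (hg : g ∈ H) :
    g • ((1 : P) : P ⧸ H) = ((1 : P) : P ⧸ H) := by
  rw [MulAction.Quotient.smul_coe, smul_eq_mul, mul_one, QuotientGroup.eq, mul_one]
  exact inv_mem hg

/-- As `a * b` fixes the base coset of `⟨a * b⟩`, both `a` and `b` send it to the same coset; these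
two cosets suffice. -/
lemma finite_card_dihedral_le {a b : P} {r : ℕ} (hr : 0 < r) (ha : a ^ 2 = 1) (hb : b ^ 2 = 1)
    (hab : (a * b) ^ r = 1) :
    Finite (Subgroup.closure {a, b}) ∧ Nat.card (Subgroup.closure {a, b}) ≤ 2 * r := by
  obtain ⟨hf, hcard⟩ := finite_card_zpowers_le hr hab
  let o : P ⧸ Subgroup.zpowers (a * b) := ((1 : P) : P ⧸ Subgroup.zpowers (a * b))
  have h1 : (a * b) • o = o := mk_one_eq_smul_of_mem (Subgroup.mem_zpowers _)
  have haa : ∀ x : P ⧸ Subgroup.zpowers (a * b), a • a • x = x := fun x => by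
    rw [← mul_smul, ← sq, ha, one_smul]
  have hbb : ∀ x : P ⧸ Subgroup.zpowers (a * b), b • b • x = x := fun x => by
    rw [← mul_smul, ← sq, hb, one_smul]
  rw [mul_smul] at h1
  have h2 : b • o = a • o := by rw [← haa (b • o), h1]
  have h3 : b • a • o = o := by rw [← h2, hbb]
  have := finite_card_closure_le (T := {a, b}) (H := Subgroup.zpowers (a * b)) ![o, a • o]
    (i₀ := 0) rfl (by
      rintro g (rfl | rfl) i <;> fin_cases i
      · exact ⟨1, rfl⟩
      · exact ⟨0, haa o⟩
      · exact ⟨1, h2⟩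
      · exact ⟨0, h3⟩)
  exact ⟨this.1, this.2.trans (by gcongr)⟩

/-- The dihedral subgroup `⟨a, b⟩` has order at most 8, and the table lists 21 cosets: `21 · 8 =
168`. -/
lemma finite_card_GL3_le {a b c : P} (ha : a ^ 2 = 1) (hb : b ^ 2 = 1) (hc : c ^ 2 = 1)
    (hbc : (b * c) ^ 3 = 1) (hab : (a * b) ^ 4 = 1) (hac : (a * c) ^ 4 = 1)
    (habcb : (a * b * c * b) ^ 3 = 1)
    (hw : a * b * a * b * c * a * c * b * a * b * c * a * c = 1) :
    Finite (Subgroup.closure {a, b, c}) ∧ Nat.card (Subgroup.closure {a, b, c}) ≤ 168 := by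
  obtain ⟨hf, hcard⟩ := finite_card_dihedral_le (by norm_num) ha hb hab
  let o : P ⧸ Subgroup.closure {a, b} := ((1 : P) : P ⧸ Subgroup.closure {a, b})
  have key : ∀ {w : P}, w = 1 → ∀ x : P ⧸ Subgroup.closure {a, b}, w • x = x :=
    fun h x => by rw [h, one_smul]
  obtain ⟨p, hp, h⟩ := exists_coset_table (f := fun x => a • x) (g := fun x => b • x)
    (h := fun x => c • x) (p0 := o) (by simpa only [sq, mul_smul] using key ha)
    (by simpa only [sq, mul_smul] using key hb) (by simpa only [sq, mul_smul] using key hc)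
    (by simpa only [pow_succ, pow_zero, one_mul, mul_smul] using key hbc)
    (by simpa only [pow_succ, pow_zero, one_mul, mul_smul] using key hab)
    (by simpa only [pow_succ, pow_zero, one_mul, mul_smul] using key hac)
    (by simpa only [pow_succ, pow_zero, one_mul, mul_smul] using key habcb)
    (by simpa only [mul_smul] using key hw)
    (mk_one_eq_smul_of_mem (Subgroup.subset_closure (by simp)))
    (mk_one_eq_smul_of_mem (Subgroup.subset_closure (by simp)))
  have := finite_card_closure_le (T := {a, b, c}) (H := Subgroup.closure {a, b}) p hp (by
    rintro g (rfl | rfl | rfl) i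
    · exact (h i).1
    · exact (h i).2.1
    · exact (h i).2.2)
  exact ⟨this.1, this.2.trans (by omega)⟩

/-- Six cosets of `⟨x⟩`, each with at most 4 elements, are permuted by `x` and `y`. -/
lemma finite_card_S4_le {x y : P} (h : ∀ r ∈ s4Relators x y, r = 1) :
    Finite (Subgroup.closure {x, y}) ∧ Nat.card (Subgroup.closure {x, y}) ≤ 24 := by
  have hx : x ^ 4 = 1 := h _ (by simp [s4Relators])
  have hy : y ^ 4 = 1 := h _ (by simp [s4Relators])
  have hi : x ^ 2 * y * (x ^ 2)⁻¹ * y = 1 := h _ (by simp [s4Relators])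
  have hb : x * y * x = y * x * y := mul_inv_eq_one.1 (h _ (by simp [s4Relators]))
  obtain ⟨hf, hcard⟩ := finite_card_zpowers_le (by norm_num) hx
  let o : P ⧸ Subgroup.zpowers x := ((1 : P) : P ⧸ Subgroup.zpowers x)
  have o0 : x • o = o := mk_one_eq_smul_of_mem (Subgroup.mem_zpowers _)
  have y4 : y • y • y • y • o = o := by
    rw [← mul_smul, ← mul_smul, ← mul_smul,
      show y * y * y * y = 1 by rw [← hy]; simp only [pow_succ, pow_zero, one_mul], one_smul]
  have hb' : ∀ p : P ⧸ Subgroup.zpowers x, x • y • x • p = y • x • y • p := fun p => by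
    rw [← mul_smul, ← mul_smul, hb, mul_smul, mul_smul]
  have a1 : x • x • y • o = y • y • y • o := by
    have e1 : x ^ 2 * y = y⁻¹ * x ^ 2 := by
      rw [mul_eq_one_iff_eq_inv, mul_inv_eq_iff_eq_mul] at hi
      exact hi
    have e2 : y⁻¹ = y ^ 3 := by rw [inv_eq_iff_mul_eq_one, ← pow_succ', hy]
    have e3 : x • x • y • o = (x ^ 2 * y) • o := by rw [sq, mul_smul, mul_smul]
    rw [e3, e1, e2, sq, mul_smul, mul_smul, o0, o0, pow_succ, sq, mul_smul, mul_smul]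
  have a2 : x • x • y • y • y • o = y • o := by
    rw [← a1, ← mul_smul, ← mul_smul, ← mul_smul,
      show x * x * x * x = 1 by rw [← hx]; simp only [pow_succ, pow_zero, one_mul], one_smul]
  have a3 : y • x • y • o = x • y • o := by rw [← hb', o0]
  have a4 : x • y • y • o = y • y • o := by
    apply MulAction.injective y
    change y • x • y • y • o = y • y • y • o
    rw [← hb', a3, a1]
  have a5 : y • x • y • y • y • o = x • y • y • y • o := by
    apply MulAction.injective x
    change x • y • x • y • y • y • o = x • x • y • y • y • o
    rw [hb', y4, o0, a2]
  have := finite_card_closure_le (T := {x, y}) (H := Subgroup.zpowers x)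
    ![o, y • o, y • y • o, y • y • y • o, x • y • o, x • y • y • y • o] (i₀ := 0) rfl (by
      rintro g (rfl | rfl) i <;> fin_cases i
      · exact ⟨0, o0⟩
      · exact ⟨4, rfl⟩
      · exact ⟨2, a4⟩
      · exact ⟨5, rfl⟩
      · exact ⟨3, a1⟩
      · exact ⟨1, a2⟩
      · exact ⟨1, rfl⟩
      · exact ⟨2, rfl⟩
      · exact ⟨3, rfl⟩
      · exact ⟨0, y4⟩
      · exact ⟨4, a3⟩
      · exact ⟨5, a5⟩)
  exact ⟨this.1, this.2.trans (by omega)⟩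

lemma inv_of_sq {x : P} (h : x ^ 2 = 1) : x⁻¹ = x := by
  rw [inv_eq_iff_mul_eq_one, ← sq, h]

/-- In the affine group `t₁`, `c = t₃ t₁ t₃` and `b = t₄ c t₄` are the basis translations, and `t₂,
t₃, t₄` generate the linear part, of order at most 168. The relations show that `t₁, b, c` commute
and how `t₂, t₃, t₄` conjugate them, so their eight products represent all cosets: `8 · 168 = 1344`.
-/
lemma finite_card_hol3_le {t₁ t₂ t₃ t₄ : P} (h : ∀ r ∈ hol3Relators t₁ t₂ t₃ t₄, r = 1) :
    Finite (Subgroup.closure {t₁, t₂, t₃, t₄}) ∧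
      Nat.card (Subgroup.closure {t₁, t₂, t₃, t₄}) ≤ 1344 := by
  simp only [hol3Relators, Set.mem_insert_iff, Set.mem_singleton_iff, forall_eq_or_imp,
    forall_eq, cmt] at h
  obtain ⟨h1, h2, h3, h4, h12, h14, h34, -, h1323, h23, h24, h2343, hw1, hw2⟩ := h
  obtain ⟨hf, hcard⟩ := finite_card_GL3_le h2 h3 h4 h34 h23 h24 h2343 hw2
  set H := Subgroup.closure {t₂, t₃, t₄} with hH
  let o : P ⧸ H := ((1 : P) : P ⧸ H)
  have o2 : t₂ • o = o := mk_one_eq_smul_of_mem (Subgroup.subset_closure (by simp))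
  have o3 : t₃ • o = o := mk_one_eq_smul_of_mem (Subgroup.subset_closure (by simp))
  have o4 : t₄ • o = o := mk_one_eq_smul_of_mem (Subgroup.subset_closure (by simp))
  have i1 := inv_of_sq h1
  have i2 := inv_of_sq h2
  have i3 := inv_of_sq h3
  have i4 := inv_of_sq h4
  rw [i1, i2] at h12
  rw [i1, i4] at h14
  have m1 : t₁ * t₁ = 1 := by rw [← sq, h1]
  have m2 : t₂ * t₂ = 1 := by rw [← sq, h2]
  have m3 : t₃ * t₃ = 1 := by rw [← sq, h3]
  have m4 : t₄ * t₄ = 1 := by rw [← sq, h4]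
  have n1 : ∀ x, t₁ * (t₁ * x) = x := fun x => by rw [← mul_assoc, m1, one_mul]
  have n3 : ∀ x, t₃ * (t₃ * x) = x := fun x => by rw [← mul_assoc, m3, one_mul]
  have n4 : ∀ x, t₄ * (t₄ * x) = x := fun x => by rw [← mul_assoc, m4, one_mul]
  have conj_of : ∀ {t a b : P}, t * t = 1 → t * a * t = b → t * a = b * t := by
    intro t a b ht hab
    rw [← hab, mul_assoc _ t t, ht, mul_one]
  have comm_of : ∀ {a b : P}, a * a = 1 → b * b = 1 → a * b * a * b = 1 → b * a = a * b := by
    intro a b ha hb hab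
    rw [mul_assoc (a * b), mul_eq_one_iff_eq_inv, mul_inv_rev,
      inv_eq_iff_mul_eq_one.2 ha, inv_eq_iff_mul_eq_one.2 hb] at hab
    exact hab ▸ rfl
  obtain ⟨c, hc⟩ : ∃ c, c = t₃ * t₁ * t₃ := ⟨_, rfl⟩
  obtain ⟨b, hb⟩ : ∃ b, b = t₄ * t₃ * t₁ * t₃ * t₄ := ⟨_, rfl⟩
  have cc : c * c = 1 := by simp only [hc, mul_assoc, n3, n1, m3]
  have bb : b * b = 1 := by simp only [hb, mul_assoc, n4, n3, n1, m4]
  have r2a : t₂ * t₁ = t₁ * t₂ := comm_of m1 m2 h12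
  have r4a : t₄ * t₁ = t₁ * t₄ := comm_of m1 m4 h14
  have r3a : t₃ * t₁ = c * t₃ := conj_of m3 hc.symm
  have r3c : t₃ * c = t₁ * t₃ := conj_of m3 (by simp only [hc, mul_assoc, n3, m3, mul_one])
  have r4c : t₄ * c = b * t₄ := conj_of m4 (by simp only [hc, hb, mul_assoc])
  have r4b : t₄ * b = c * t₄ :=
    conj_of m4 (by simp only [hc, hb, mul_assoc, n4, m4, mul_one])
  -- Conjugating the relator `(t₁ t₃ t₂ t₃)²` by `t₃` gives `(c t₂)²`.
  have r2c : t₂ * c = c * t₂ := comm_of cc m2 (by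
    have : t₃ * (t₁ * t₃ * t₂ * t₃) ^ 2 * t₃ = 1 := by rw [h1323, mul_one, m3]
    rw [← this, hc, sq]
    simp only [mul_assoc, m3, mul_one])
  -- The relator `hw1` spells `t₁ · (t₂ b t₂) · b`.
  have hx : t₂ * b * t₂ = t₁ * b := by
    have : t₁ * (t₂ * b * t₂) * b = 1 := by
      rw [← hw1, hb]
      simp only [mul_assoc]
    rw [mul_eq_one_iff_eq_inv, inv_eq_iff_mul_eq_one.2 bb] at this
    rw [← n1 (t₂ * b * t₂), this]
  have r2b : t₂ * b = t₁ * b * t₂ := conj_of m2 hx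
  have r3b : t₃ * b = b * t₃ := by
    have braid : t₃ * t₄ * t₃ = t₄ * t₃ * t₄ := by
      have e : t₃ * t₄ * t₃ * (t₄ * t₃ * t₄) = 1 := by
        rw [← h34]
        simp only [pow_succ, pow_zero, one_mul, mul_assoc]
      rw [mul_eq_one_iff_eq_inv, mul_inv_rev, mul_inv_rev, i3, i4, ← mul_assoc] at e
      exact e
    calc t₃ * b = t₃ * t₄ * t₃ * t₁ * t₃ * t₄ := by rw [hb]; simp only [mul_assoc]
      _ = t₄ * t₃ * (t₄ * t₁) * t₃ * t₄ := by rw [braid]; simp only [mul_assoc]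
      _ = t₄ * t₃ * t₁ * (t₄ * t₃ * t₄) := by rw [r4a]; simp only [mul_assoc]
      _ = b * t₃ := by rw [← braid, hb]; simp only [mul_assoc]
  -- As a conjugate of `b`, the product `t₁ b` is an involution. The two commutations after this one
  -- come from it by conjugation with `t₄` and `t₃`.
  have ba : b * t₁ = t₁ * b := comm_of m1 bb (by
    rw [mul_assoc (t₁ * b), ← hx]
    have n2 : ∀ x, t₂ * (t₂ * x) = x := fun x => by rw [← mul_assoc, m2, one_mul]
    have nb : ∀ x, b * (b * x) = x := fun x => by rw [← mul_assoc, bb, one_mul]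
    simp only [mul_assoc, n2, nb, m2])
  have conj_comm : ∀ {t x y x' y' : P}, t * t = 1 → t * x = x' * t → t * y = y' * t →
      x * y = y * x → x' * y' = y' * x' := by
    intro t x y x' y' ht hx hy hxy
    have e : x' * y' * t = y' * x' * t := by
      rw [mul_assoc, ← hy, ← mul_assoc, ← hx, mul_assoc, hxy, ← mul_assoc, hy, mul_assoc, hx,
        mul_assoc]
    exact mul_right_cancel e
  have ca : c * t₁ = t₁ * c := conj_comm m4 r4b r4a ba
  have cb : c * b = b * c := conj_comm m3 r3a r3b ba.symm
  have sm : ∀ {u v w z : P}, u * v = w * z → ∀ x : P ⧸ H, u • v • x = w • z • x :=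
    fun h x => by rw [← mul_smul, h, mul_smul]
  have sq' : ∀ {u : P}, u * u = 1 → ∀ x : P ⧸ H, u • u • x = x :=
    fun h x => by rw [← mul_smul, h, one_smul]
  have s2b : ∀ x : P ⧸ H, t₂ • b • x = t₁ • b • t₂ • x := fun x => by
    rw [← mul_smul, r2b, mul_smul, mul_smul]
  have := finite_card_closure_le (T := {t₁, t₂, t₃, t₄}) (H := H)
    ![o, t₁ • o, b • o, c • o, t₁ • b • o, t₁ • c • o, b • c • o, t₁ • b • c • o]
    (i₀ := 0) rfl (by
      have fin8 : ∀ {p : Fin 8 → Prop}, p 0 ∨ p 1 ∨ p 2 ∨ p 3 ∨ p 4 ∨ p 5 ∨ p 6 ∨ p 7 →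
          ∃ j, p j := by
        rintro p (h | h | h | h | h | h | h | h) <;> exact ⟨_, h⟩
      rintro g (rfl | rfl | rfl | rfl) i <;> fin_cases i <;> apply fin8 <;>
        simp [sm r2a, sm r4a, sm r3a, sm r3c, sm r4c, sm r4b, sm r2c, s2b, sm r3b, sm ba, sm ca,
          sm cb, sq' m1, o2, o3, o4])
  exact ⟨this.1, this.2.trans (by omega)⟩

end Cosets

/-! ### Generators and presentations of `Hol(1^2)` and `Hol(1^3)` -/

section

open Matrix

/-- Invertible matrices are products of transvections and an invertible diagonal matrix. Over `𝔽₂`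
the latter is the identity, and a nontrivial transvection has coefficient 1. -/
lemma exists_mem_affMat_of_transvections {n : ℕ} {K : Subgroup (Aff n)}
    (h : ∀ i j, i ≠ j → ∃ g ∈ K, g.1.val = affMat 0 (transvection i j 1))
    (M : Matrix (Fin n) (Fin n) (ZMod 2)) (hM : M.det ≠ 0) : ∃ g ∈ K, g.1.val = affMat 0 M := by
  refine diagonal_transvection_induction_of_det_ne_zero
    (fun M => ∃ g ∈ K, g.1.val = affMat 0 M) M hM (fun D hD => ?_) (fun t => ?_) ?_
  · have hD1 : diagonal D = 1 := by
      rw [det_diagonal, Finset.prod_ne_zero_iff] at hD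
      rw [← diagonal_one]
      congr 1
      funext i
      exact (by decide : ∀ a : ZMod 2, a ≠ 0 → a = 1) _ (hD i (Finset.mem_univ i))
    exact ⟨1, K.one_mem, by rw [hD1, affMat_zero_one]; rfl⟩
  · rcases (by decide : ∀ a : ZMod 2, a = 0 ∨ a = 1) t.c with hc | hc
    · exact ⟨1, K.one_mem, by
        rw [TransvectionStruct.toMatrix, hc, transvection_zero, affMat_zero_one]; rfl⟩
    · rw [TransvectionStruct.toMatrix, hc]
      exact h _ _ t.hij
  · rintro A B - - ⟨g, hg, hgA⟩ ⟨g', hg', hgB⟩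
    refine ⟨g * g', K.mul_mem hg hg', ?_⟩
    rw [Subgroup.coe_mul, Units.val_mul, hgA, hgB, affMat_mul, mulVec_zero, add_zero]

lemma Aff_val_eq_affMat {n : ℕ} (B : Aff n) :
    B.1.val = affMat (fun j => B.1.val j.succ 0) (affBlock n B).val := by
  ext i j
  refine Fin.cases ?_ (fun i => ?_) i <;> refine Fin.cases ?_ (fun j => ?_) j
  · exact Aff_zero_zero B
  · exact Aff_row_zero B j
  · rfl
  · rfl

/-- The stabilizer of the first basis row is generated by the translations and the
transvections. -/
lemma Aff_eq_top_of_mem {n : ℕ} {K : Subgroup (Aff n)}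
    (h1 : ∀ j, ∃ g ∈ K, g.1.val = affMat (Pi.single j 1) 1)
    (h2 : ∀ i j, i ≠ j → ∃ g ∈ K, g.1.val = affMat 0 (transvection i j 1)) : K = ⊤ := by
  have hv : ∀ v : Fin n → ZMod 2, ∃ g ∈ K, g.1.val = affMat v 1 := by
    let S : AddSubgroup (Fin n → ZMod 2) :=
      { carrier := {v | ∃ g ∈ K, g.1.val = affMat v 1}
        zero_mem' := ⟨1, K.one_mem, by rw [affMat_zero_one]; rfl⟩
        add_mem' := by
          rintro v w ⟨g, hg, hgv⟩ ⟨g', hg', hgw⟩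
          refine ⟨g * g', K.mul_mem hg hg', ?_⟩
          rw [Subgroup.coe_mul, Units.val_mul, hgv, hgw, affMat_mul, one_mulVec, mul_one]
        neg_mem' := by
          rintro v ⟨g, hg, hgv⟩
          rw [Set.mem_ofPred_eq, show -v = v from funext fun j => ZMod.neg_eq_self_mod_two _]
          exact ⟨g, hg, hgv⟩ }
    have hS : ∀ v, v ∈ S := fun v => AddSubgroup.pi_mem_of_single_mem v fun j => by
      rcases (by decide : ∀ a : ZMod 2, a = 0 ∨ a = 1) (v j) with h | h
      · rw [h, Pi.single_zero]
        exact S.zero_mem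
      · rw [h]
        exact h1 j
    exact hS
  rw [eq_top_iff]
  intro B _
  obtain ⟨g, hg, hgv⟩ := hv fun j => B.1.val j.succ 0
  obtain ⟨g', hg', hgM⟩ := exists_mem_affMat_of_transvections h2 (affBlock n B).val
    ((Matrix.isUnit_iff_isUnit_det _).1 (affBlock n B).isUnit).ne_zero
  have : B = g * g' := by
    refine Subtype.ext (Units.ext ?_)
    rw [Subgroup.coe_mul, Units.val_mul, hgv, hgM, affMat_mul, mulVec_zero, add_zero, one_mul]
    exact Aff_val_eq_affMat B
  rw [this]
  exact K.mul_mem hg hg'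

lemma card_Aff (n : ℕ) :
    Nat.card (Aff n) = 2 ^ n * ∏ i : Fin n, (2 ^ n - 2 ^ (i : ℕ)) := by
  rw [Nat.card_congr (affEquiv n).toEquiv, card_hol_elem]

/-- The generators of `Hol(1^3)` as elements of `GL_4(𝔽₂)`. -/
def hol3Gen (i : Fin 4) : Aff 3 :=
  ⟨⟨holMat i, holMat i, by revert i; decide, by revert i; decide⟩, by
    rw [mem_Aff]
    revert i
    decide⟩

lemma hol3Gen_val (i : Fin 4) : (hol3Gen i).1.val = holMat i := rfl

lemma hol3Gen_inv (i : Fin 4) : (hol3Gen i)⁻¹ = hol3Gen i := rfl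

lemma hol3Gen_relators :
    ∀ r ∈ hol3Relators (hol3Gen 0) (hol3Gen 1) (hol3Gen 2) (hol3Gen 3), r = 1 := by
  have key : ∀ g : Aff 3, g.1.val = 1 → g = 1 := fun g h => Subtype.ext (Units.ext h)
  simp only [hol3Relators, Set.mem_insert_iff, Set.mem_singleton_iff, forall_eq_or_imp,
    forall_eq, cmt, hol3Gen_inv]
  refine ⟨?_, ?_, ?_, ?_, ?_, ?_, ?_, ?_, ?_, ?_, ?_, ?_, ?_, ?_⟩ <;> apply key <;>
    simp only [Subgroup.coe_mul, Subgroup.coe_pow, Units.val_mul, Units.val_pow_eq_pow_val,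
      hol3Gen_val] <;> decide

lemma closure_hol3Gen : Subgroup.closure (Set.range hol3Gen) = ⊤ := by
  have hm : ∀ i, hol3Gen i ∈ Subgroup.closure (Set.range hol3Gen) := fun i =>
    Subgroup.subset_closure ⟨i, rfl⟩
  have h0 := hm 0
  have h1 := hm 1
  have h2 := hm 2
  have h3 := hm 3
  apply Aff_eq_top_of_mem
  -- The matrix `t_1` is a basis translation, and the permutation matrices `t_3`, `t_4` conjugate it
  -- to the other two. Below, they conjugate the transvection `t_2` to all the others in the same
  -- way.
  · intro j
    fin_cases j
    · exact ⟨hol3Gen 3 * hol3Gen 2 * hol3Gen 0 * hol3Gen 2 * hol3Gen 3,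
        mul_mem (mul_mem (mul_mem (mul_mem h3 h2) h0) h2) h3, by
          simp only [Subgroup.coe_mul, Units.val_mul, hol3Gen_val]; decide⟩
    · exact ⟨hol3Gen 2 * hol3Gen 0 * hol3Gen 2, mul_mem (mul_mem h2 h0) h2, by
          simp only [Subgroup.coe_mul, Units.val_mul, hol3Gen_val]; decide⟩
    · exact ⟨hol3Gen 0, h0, by
          simp only [hol3Gen_val]; decide⟩
  · have key : ∀ i j : Fin 3, i ≠ j → ∃ l : List (Fin 4),
        (l.map holMat).prod = affMat 0 (transvection i j 1) := by
      intro i j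
      fin_cases i <;> fin_cases j <;> intro hij
      · exact absurd rfl hij
      · exact ⟨[3, 2, 1, 2, 3], by decide⟩
      · exact ⟨[3, 2, 3, 1, 3, 2, 3], by decide⟩
      · exact ⟨[2, 1, 2], by decide⟩
      · exact absurd rfl hij
      · exact ⟨[2, 3, 1, 3, 2], by decide⟩
      · exact ⟨[1], by decide⟩
      · exact ⟨[3, 1, 3], by decide⟩
      · exact absurd rfl hij
    intro i j hij
    obtain ⟨l, hl⟩ := key i j hij
    refine ⟨(l.map hol3Gen).prod, list_prod_mem fun x hx => ?_, hl ▸ ?_⟩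
    · obtain ⟨k, -, rfl⟩ := List.mem_map.1 hx
      exact hm k
    · clear hl
      induction l with
      | nil => rfl
      | cons a l ih =>
        rw [List.map_cons, List.prod_cons, List.map_cons, List.prod_cons, Subgroup.coe_mul,
          Units.val_mul, ih, hol3Gen_val]

/-- The generator `x` of `Hol(1^2)` as an element of `GL_3(𝔽₂)`. -/
def s4X : Aff 2 :=
  ⟨⟨!![1, 0, 0; 1, 1, 0; 1, 1, 1], !![1, 0, 0; 1, 1, 0; 0, 1, 1], by decide, by decide⟩, by
    rw [mem_Aff]
    decide⟩

/-- The generator `y` of `Hol(1^2)` as an element of `GL_3(𝔽₂)`. -/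
def s4Y : Aff 2 :=
  ⟨⟨!![1, 0, 0; 1, 1, 1; 1, 0, 1], !![1, 0, 0; 0, 1, 1; 1, 0, 1], by decide, by decide⟩, by
    rw [mem_Aff]
    decide⟩

lemma s4_relators : ∀ r ∈ s4Relators s4X s4Y, r = 1 := by
  have key : ∀ g : Aff 2, g.1.val = 1 → g = 1 := fun g h => Subtype.ext (Units.ext h)
  simp only [s4Relators, Set.mem_insert_iff, Set.mem_singleton_iff, forall_eq_or_imp, forall_eq]
  refine ⟨?_, ?_, ?_, ?_⟩ <;> apply key <;> decide

lemma closure_s4 : Subgroup.closure {s4X, s4Y} = ⊤ := by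
  have hx : s4X ∈ Subgroup.closure {s4X, s4Y} := Subgroup.subset_closure (by simp)
  have hy : s4Y ∈ Subgroup.closure {s4X, s4Y} := Subgroup.subset_closure (by simp)
  apply Aff_eq_top_of_mem
  · intro j
    fin_cases j
    · exact ⟨s4Y * s4Y, mul_mem hy hy, by decide⟩
    · exact ⟨s4X * s4X, mul_mem hx hx, by decide⟩
  · intro i j
    fin_cases i <;> fin_cases j <;> intro hij
    · exact absurd rfl hij
    · exact ⟨s4Y * s4X * s4X, mul_mem (mul_mem hy hx) hx, by decide⟩
    · exact ⟨s4X * s4Y * s4Y, mul_mem (mul_mem hx hy) hy, by decide⟩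
    · exact absurd rfl hij

lemma forall_s4Relators_map {G H : Type*} [Group G] [Group H] (φ : G →* H) (x y : G) :
    (∀ r ∈ s4Relators x y, φ r = 1) ↔ ∀ r ∈ s4Relators (φ x) (φ y), r = 1 := by
  simp [s4Relators]

lemma forall_hol3Relators_map {G H : Type*} [Group G] [Group H] (φ : G →* H) (a b c d : G) :
    (∀ r ∈ hol3Relators a b c d, φ r = 1) ↔
      ∀ r ∈ hol3Relators (φ a) (φ b) (φ c) (φ d), r = 1 := by
  simp [hol3Relators, cmt]

/-- The group `⟨x, y ∣ x^4 = y^4 = x^2 y x^(-2) y = xyx(yxy)⁻¹ = 1⟩`. -/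
abbrev PresS4 : Type :=
  PresentedGroup (s4Relators (FreeGroup.of (0 : Fin 2)) (FreeGroup.of 1))

lemma bijective_of_closure {G H : Type*} [Group G] [Group H] {f : G →* H} {T : Set G} {N : ℕ}
    (hT : Subgroup.closure T = ⊤) (hN : Nat.card H = N)
    (hc : Finite (Subgroup.closure T) ∧ Nat.card (Subgroup.closure T) ≤ N)
    (hf : Function.Surjective f) : Function.Bijective f := by
  rw [hT, Subgroup.card_top] at hc
  have hG : Finite G := Subgroup.topEquiv.symm.toEquiv.finite_iff.2 hc.1
  exact (Nat.bijective_iff_surjective_and_card f).2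
    ⟨hf, le_antisymm (hN ▸ hc.2) (Nat.card_le_card_of_surjective f hf)⟩

lemma lift_s4_relators : ∀ r ∈ s4Relators (FreeGroup.of (0 : Fin 2)) (FreeGroup.of 1),
    FreeGroup.lift ![s4X, s4Y] r = 1 := by
  rw [forall_s4Relators_map]
  simpa using s4_relators

/-- The homomorphism from the presented group to `GL_3(𝔽₂)`. -/
def presS4Hom : PresS4 →* Aff 2 := PresentedGroup.toGroup lift_s4_relators

lemma presS4_relators :
    ∀ r ∈ s4Relators (PresentedGroup.of 0 : PresS4) (PresentedGroup.of 1), r = 1 :=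
  (forall_s4Relators_map (PresentedGroup.mk _) _ _).1 fun _ hr => PresentedGroup.one_of_mem hr

lemma presS4_closure :
    Subgroup.closure {(PresentedGroup.of 0 : PresS4), PresentedGroup.of 1} = ⊤ := by
  rw [← PresentedGroup.closure_range_of]
  congr 1
  ext x
  simp [Fin.exists_fin_two, eq_comm]

lemma presS4Hom_surjective : Function.Surjective presS4Hom := by
  rw [← MonoidHom.range_eq_top, eq_top_iff, ← closure_s4, Subgroup.closure_le]
  rintro g (rfl | rfl)
  · exact ⟨.of 0, PresentedGroup.toGroup.of _⟩
  · exact ⟨.of 1, PresentedGroup.toGroup.of _⟩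

lemma card_Aff_two : Nat.card (Aff 2) = 24 := by
  rw [card_Aff]
  decide

lemma card_Aff_three : Nat.card (Aff 3) = 1344 := by
  rw [card_Aff]
  decide

/-- The presentation of `Hol(1^2)`. -/
noncomputable def presS4Equiv : PresS4 ≃* Aff 2 :=
  MulEquiv.ofBijective presS4Hom (bijective_of_closure presS4_closure card_Aff_two
    (finite_card_S4_le presS4_relators) presS4Hom_surjective)

lemma presS4Equiv_of (i : Fin 2) : presS4Equiv (.of i) = ![s4X, s4Y] i :=
  PresentedGroup.toGroup.of lift_s4_relators

lemma lift_hol3_relators : ∀ r ∈ hol3Relators (FreeGroup.of (0 : Fin 4)) (FreeGroup.of 1)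
    (FreeGroup.of 2) (FreeGroup.of 3), FreeGroup.lift hol3Gen r = 1 := by
  rw [forall_hol3Relators_map]
  simpa using hol3Gen_relators

/-- The homomorphism from the presented group to `GL_4(𝔽₂)`. -/
def presHol3Hom : PresHol3 →* Aff 3 := PresentedGroup.toGroup lift_hol3_relators

lemma presHol3_relators : ∀ r ∈ hol3Relators (PresentedGroup.of 0 : PresHol3)
    (PresentedGroup.of 1) (PresentedGroup.of 2) (PresentedGroup.of 3), r = 1 :=
  (forall_hol3Relators_map (PresentedGroup.mk _) _ _ _ _).1
    fun _ hr => PresentedGroup.one_of_mem hr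

lemma presHol3_closure : Subgroup.closure {(PresentedGroup.of 0 : PresHol3), PresentedGroup.of 1,
    PresentedGroup.of 2, PresentedGroup.of 3} = ⊤ := by
  rw [← PresentedGroup.closure_range_of]
  congr 1
  ext x
  simp [Fin.exists_fin_succ, eq_comm]

lemma presHol3Hom_surjective : Function.Surjective presHol3Hom := by
  rw [← MonoidHom.range_eq_top, eq_top_iff, ← closure_hol3Gen, Subgroup.closure_le]
  rintro _ ⟨i, rfl⟩
  exact ⟨.of i, PresentedGroup.toGroup.of _⟩

/-- The presentation of `Hol(1^3)`. -/
noncomputable def presHol3Equiv : PresHol3 ≃* Aff 3 :=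
  MulEquiv.ofBijective presHol3Hom (bijective_of_closure presHol3_closure card_Aff_three
    (finite_card_hol3_le presHol3_relators) presHol3Hom_surjective)

lemma presHol3Equiv_of (i : Fin 4) : presHol3Equiv (.of i) = hol3Gen i :=
  PresentedGroup.toGroup.of lift_hol3_relators

/-! ### The identification with `S_4` -/

/-- The first generator of `S_4`. -/
def permX : Equiv.Perm (Fin 4) := ⟨![1, 2, 3, 0], ![3, 0, 1, 2], by decide, by decide⟩

/-- The second generator of `S_4`. -/
def permY : Equiv.Perm (Fin 4) := ⟨![1, 3, 0, 2], ![2, 0, 3, 1], by decide, by decide⟩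

lemma perm_relators : ∀ r ∈ s4Relators permX permY, r = 1 := by
  simp only [s4Relators, Set.mem_insert_iff, Set.mem_singleton_iff, forall_eq_or_imp, forall_eq]
  refine ⟨?_, ?_, ?_, ?_⟩ <;> decide

/-- The homomorphism from the presented group to `S_4`. -/
def presS4Perm : PresS4 →* Equiv.Perm (Fin 4) :=
  PresentedGroup.toGroup (f := ![permX, permY]) (by
    rw [forall_s4Relators_map]
    simpa using perm_relators)

lemma presS4Perm_surjective : Function.Surjective presS4Perm := by
  rw [← MonoidHom.range_eq_top, ← Subgroup.toSubmonoid_inj, Subgroup.top_toSubmonoid, eq_top_iff,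
    ← Equiv.Perm.mclosure_swap_castSucc_succ, Submonoid.closure_le]
  have hx : permX ∈ presS4Perm.range := ⟨.of 0, PresentedGroup.toGroup.of _⟩
  have hy : permY ∈ presS4Perm.range := ⟨.of 1, PresentedGroup.toGroup.of _⟩
  rintro _ ⟨i, rfl⟩
  -- Each word is an adjacent transposition; these generate `S_4`.
  fin_cases i
  · have h : permX * permY * permY * permY * permX ∈ presS4Perm.range :=
      mul_mem (mul_mem (mul_mem (mul_mem hx hy) hy) hy) hx
    rw [show permX * permY * permY * permY * permX = Equiv.swap 0 1 by decide] at h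
    exact h
  · have h : permY * permX * permX ∈ presS4Perm.range := mul_mem (mul_mem hy hx) hx
    rw [show permY * permX * permX = Equiv.swap 1 2 by decide] at h
    exact h
  · have h : permX * permY * permX ∈ presS4Perm.range := mul_mem (mul_mem hx hy) hx
    rw [show permX * permY * permX = Equiv.swap 2 3 by decide] at h
    exact h

/-- The presentation of `S_4`. -/
noncomputable def presS4EquivPerm : PresS4 ≃* Equiv.Perm (Fin 4) :=
  MulEquiv.ofBijective presS4Perm (bijective_of_closure presS4_closure
    (by rw [Nat.card_perm, Nat.card_fin]; rfl) (finite_card_S4_le presS4_relators)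
    presS4Perm_surjective)

/-! ### Homomorphisms out of `1^k` -/

section ElemHom

variable {k : ℕ} {P : Type*} [Group P]

lemma elem_hom_ext {f g : Elem k →* P}
    (h : ∀ j, f (.ofAdd (Pi.single j 1)) = g (.ofAdd (Pi.single j 1))) : f = g := by
  let S : AddSubgroup (Fin k → ZMod 2) := (f.eqLocus g).toAddSubgroup'
  have hS : ∀ v, v ∈ S := fun v => AddSubgroup.pi_mem_of_single_mem v fun j => by
    rcases (by decide : ∀ a : ZMod 2, a = 0 ∨ a = 1) (v j) with h' | h'
    · rw [h', Pi.single_zero]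
      exact S.zero_mem
    · rw [h']
      exact h j
  exact MonoidHom.ext fun x => hS x.toAdd

lemma elem_hom_range (f : Elem k →* P) :
    f.range = Subgroup.closure (Set.range fun j => f (.ofAdd (Pi.single j 1))) := by
  refine le_antisymm ?_ ((Subgroup.closure_le _).2 ?_)
  · let S : AddSubgroup (Fin k → ZMod 2) := ((Subgroup.closure
      (Set.range fun j => f (.ofAdd (Pi.single j 1)))).comap f).toAddSubgroup'
    have hS : ∀ v, v ∈ S := fun v => AddSubgroup.pi_mem_of_single_mem v fun j => by
      rcases (by decide : ∀ a : ZMod 2, a = 0 ∨ a = 1) (v j) with h' | h'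
      · rw [h', Pi.single_zero]
        exact S.zero_mem
      · rw [h']
        exact Subgroup.subset_closure ⟨j, rfl⟩
    rintro _ ⟨x, rfl⟩
    exact hS x.toAdd
  · rintro _ ⟨j, rfl⟩
    exact ⟨_, rfl⟩

/-- The homomorphism from the group of order `2` given by an element with square `1`. -/
def involutionHom (g : P) (hg : g ^ 2 = 1) : Multiplicative (ZMod 2) →* P where
  toFun a := g ^ a.toAdd.val
  map_one' := pow_zero g
  map_mul' a b := by
    have h : ∀ a b : ZMod 2, g ^ (a + b).val = g ^ a.val * g ^ b.val := by
      intro a b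
      rw [← pow_add, ZMod.val_add]
      exact (pow_eq_pow_mod _ hg).symm
    exact h a.toAdd b.toAdd

lemma commute_involutionHom {g h : P} (hg : g ^ 2 = 1) (hh : h ^ 2 = 1) (hgh : Commute g h)
    (a b : Multiplicative (ZMod 2)) : Commute (involutionHom g hg a) (involutionHom h hh b) :=
  hgh.pow_pow _ _

/-- The homomorphism from `1^k` given by `k` commuting elements with square `1`. -/
def elemLift (p : Fin k → P) (hp : ∀ i, p i ^ 2 = 1) (hc : ∀ i j, Commute (p i) (p j)) :
    Elem k →* P :=
  (MonoidHom.noncommPiCoprod (fun i => involutionHom (p i) (hp i))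
    fun i j _ => commute_involutionHom (hp i) (hp j) (hc i j)).comp
    { toFun := fun x i => .ofAdd (x.toAdd i)
      map_one' := rfl
      map_mul' := fun _ _ => rfl }

lemma elemLift_single (p : Fin k → P) (hp : ∀ i, p i ^ 2 = 1)
    (hc : ∀ i j, Commute (p i) (p j)) (j : Fin k) :
    elemLift p hp hc (.ofAdd (Pi.single j 1)) = p j := by
  have h : (fun i => Multiplicative.ofAdd ((Pi.single j 1 : Fin k → ZMod 2) i)) =
      Pi.mulSingle j (.ofAdd 1) := by
    funext i
    rcases eq_or_ne i j with rfl | hij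
    · simp
    · simp [hij]
  refine (congrArg (MonoidHom.noncommPiCoprod (fun i => involutionHom (p i) (hp i))
    fun i j _ => commute_involutionHom (hp i) (hp j) (hc i j)) h).trans ?_
  exact (MonoidHom.noncommPiCoprod_mulSingle _ _ _).trans (pow_one (p j))

end ElemHom

/-! ### Commutators, conjugates and relators under homomorphisms -/

section Relations

variable {G H : Type*} [Group G] [Group H]

lemma cmt_eq_one_iff {g h : G} : cmt g h = 1 ↔ Commute g h := by
  rw [cmt, mul_assoc, ← _root_.mul_inv_rev, inv_mul_eq_one, eq_comm]
  rfl

lemma cmt_eq_inv_mul_cnj (g h : G) : cmt g h = g⁻¹ * cnj g h := by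
  simp only [cmt, cnj, mul_assoc]

lemma map_cmt (φ : G →* H) (g h : G) : φ (cmt g h) = cmt (φ g) (φ h) := by
  simp [cmt]

lemma map_cnj (φ : G →* H) (g h : G) : φ (cnj g h) = cnj (φ g) (φ h) := by
  simp [cnj]

lemma forall_stuRelators_map (φ : G →* H) (m : ℕ) (s t u : G) :
    (∀ r ∈ stuRelators m s t u, φ r = 1) ↔ ∀ r ∈ stuRelators m (φ s) (φ t) (φ u), r = 1 := by
  simp [stuRelators, map_cmt, map_cnj]

lemma commute_of_mem_closure {S : Set G} {g : G} (h : ∀ x ∈ S, Commute x g) {x : G}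
    (hx : x ∈ Subgroup.closure S) : Commute x g := by
  induction hx using Subgroup.closure_induction with
  | mem x hx => exact h x hx
  | one => exact Commute.one_left g
  | mul x y _ _ hx hy => exact hx.mul_left hy
  | inv x _ hx => exact hx.inv_left

lemma normal_closure_of_conj_mem {S T : Set G} [Finite (Subgroup.closure S)]
    (hT : Subgroup.closure T = ⊤)
    (h : ∀ g ∈ T, ∀ l ∈ S, g⁻¹ * l * g ∈ Subgroup.closure S) : (Subgroup.closure S).Normal := by
  rw [← Subgroup.normalizer_eq_top_iff, eq_top_iff, ← hT]
  refine (Subgroup.closure_le _).2 fun g hg => ?_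
  have hmap : Subgroup.closure S ≤ (Subgroup.closure S).comap (MulAut.conj g⁻¹).toMonoidHom := by
    rw [Subgroup.closure_le]
    intro x hx
    simpa using h g hg x hx
  have : g⁻¹ ∈ Subgroup.normalizer ((Subgroup.closure S : Subgroup G) : Set G) :=
    Subgroup.mem_normalizer_fintype fun x hx => hmap hx
  exact (inv_mem_iff (H := Subgroup.normalizer ((Subgroup.closure S : Subgroup G) : Set G))).1 this

end Relations

/-! ### The relations in the holomorph -/

section HolRelations

variable {k n : ℕ}

lemma trl_sq (x : Elem (n + 1)) : trl k n x ^ 2 = 1 := by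
  rw [← map_pow, sq, elem_mul_self, map_one]

lemma tvn_sq (x : Elem (n + 1)) : tvn k n x ^ 2 = 1 := by
  rw [← map_pow, sq, elem_mul_self, map_one]

lemma cnj_trl_mtx (x : Elem (n + 1)) (B : Aff n) :
    cnj (trl k n x) (mtx k n B) = trl k n (.ofAdd (x.toAdd ᵥ* B.1.val)) :=
  mtx_inv_mul_trl_mul B x

lemma cnj_tvn_mtx (x : Elem (n + 1)) (B : Aff n) :
    cnj (tvn k n x) (mtx k n B) = tvn k n (.ofAdd (x.toAdd ᵥ* B.1.val)) :=
  mtx_inv_mul_tvn_mul B x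

lemma cnj_tvn_shift_mul (x : Elem (n + 1)) :
    cnj (tvn k n x) (shift k n) * trl k n x * tvn k n x = 1 := by
  have h : cnj (tvn k n x) (shift k n) = trl k n x * tvn k n x := by
    rw [cnj, mul_assoc, tvn_mul_shift, mul_assoc, inv_mul_cancel_left]
  rw [h, mul_assoc, ← sq, (commute_trl_tvn x x).mul_pow, trl_sq, tvn_sq, one_mul]

/-- The generator `t` goes to the inverse of 5 because `cnj` conjugates by `t⁻¹ s t`, whereas a unit
acts by conjugation from the other side. -/
lemma cnj_shift_five :
    cnj (shift k n) (unt k n (five k)⁻¹) = shift k n ^ 5 := by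
  have := unt_mul_shift_zpow (n := n) (five k) 5 (by rw [five_val]; norm_num)
  rw [cnj, map_inv, inv_inv, this]
  rfl

lemma cnj_shift_neg_one : cnj (shift k n) (unt k n (-1)) = (shift k n)⁻¹ := by
  have := unt_mul_shift_zpow (n := n) (-1 : (ZMod (2 ^ (k + 2)))ˣ) (-1) (by simp)
  rw [_root_.zpow_neg_one, ← map_inv, inv_neg, inv_one] at this
  rw [cnj, ← map_inv, inv_neg, inv_one, this]

lemma hol_stuRelators : ∀ r ∈ stuRelators (k + 3) (shift (k + 1) n)
    (unt (k + 1) n (five (k + 1))⁻¹) (unt (k + 1) n (-1)), r = 1 := by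
  simp only [stuRelators, Set.mem_insert_iff, Set.mem_singleton_iff, forall_eq_or_imp, forall_eq]
  refine ⟨?_, ?_, ?_, ?_, ?_, ?_⟩
  · refine (congrArg (shift (k + 1) n ^ ·) (pow_succ 2 (k + 2))).trans ?_
    rw [pow_mul, shift_pow_eq, trl_sq]
  · refine (congrArg (unt (k + 1) n (five (k + 1))⁻¹ ^ ·) (pow_succ 2 k)).trans ?_
    rw [pow_mul, map_inv, inv_pow, unt_five_pow, inv_pow, tvn_sq, inv_one]
  · rw [← map_pow, neg_one_sq, map_one]
  · exact cmt_eq_one_iff.2 ((Commute.all _ _).map (unt (k + 1) n))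
  · rw [cnj_shift_five, mul_inv_cancel]
  · rw [cnj_shift_neg_one, inv_mul_cancel]

lemma shift_pow_mul : shift (k + 1) n ^ (2 ^ (k + 3) / 2) *
    trl (k + 1) n (.ofAdd (Pi.single 0 1)) = 1 := by
  have h : shift (k + 1) n ^ (2 ^ (k + 3) / 2) = shift (k + 1) n ^ 2 ^ (k + 2) :=
    congrArg (shift (k + 1) n ^ ·) (Nat.mul_div_cancel (2 ^ (k + 2)) two_pos)
  rw [h, shift_pow_eq, ← sq, trl_sq]

lemma unt_pow_mul : unt (k + 1) n (five (k + 1))⁻¹ ^ (2 ^ (k + 3 - 2) / 2) *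
    tvn (k + 1) n (.ofAdd (Pi.single 0 1)) = 1 := by
  have h : unt (k + 1) n (five (k + 1))⁻¹ ^ (2 ^ (k + 3 - 2) / 2) =
      unt (k + 1) n (five (k + 1))⁻¹ ^ 2 ^ k :=
    congrArg (unt (k + 1) n (five (k + 1))⁻¹ ^ ·) (Nat.mul_div_cancel (2 ^ k) two_pos)
  rw [h, map_inv, inv_pow, unt_five_pow, inv_mul_cancel]

end HolRelations

/-! ### From relations to the isomorphism -/

/-- A group with the generators and relations of `Hol(C_{2^(k+3)} × 1^n)`, in terms of a
presentation of `Hol(1^n)`, that maps to it compatibly with the generators. -/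
lemma nonempty_mulEquiv_and_hasHolForm {k n : ℕ} {P ι : Type} [Group P] {p q : Fin (n + 1) → P}
    {B : ι → Aff n} {χ : Aff n →* P} {s t u : P} (f : P →* Hol (CE (k + 1) n))
    (hp : ∀ i, p i ^ 2 = 1) (hq : ∀ i, q i ^ 2 = 1)
    (hpp : ∀ i j, Commute (p i) (p j)) (hpq : ∀ i j, Commute (p i) (q j))
    (hqq : ∀ i j, Commute (q i) (q j)) (hB : Subgroup.closure (Set.range B) = ⊤)
    (hχp : ∀ i j, cnj (p j) (χ (B i)) ∈ Subgroup.closure (Set.range p))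
    (hχq : ∀ i j, cnj (q j) (χ (B i)) ∈ Subgroup.closure (Set.range q))
    (hχs : ∀ i, Commute (χ (B i)) s) (hχt : ∀ i, Commute (χ (B i)) t)
    (hχu : ∀ i, Commute (χ (B i)) u)
    (hps : ∀ j, Commute (p j) s) (hqs : ∀ j, cnj (q j) s * p j * q j = 1)
    (hpt : ∀ j, Commute (p j) t) (hqt : ∀ j, Commute (q j) t)
    (hpu : ∀ j, Commute (p j) u) (hqu : ∀ j, Commute (q j) u)
    (hstu : ∀ r ∈ stuRelators (k + 3) s t u, r = 1)
    (hsp0 : s ^ (2 ^ (k + 3) / 2) * p 0 = 1) (htq0 : t ^ (2 ^ (k + 3 - 2) / 2) * q 0 = 1)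
    (hgen : Subgroup.closure
      (Set.range p ∪ Set.range q ∪ Set.range (fun i => χ (B i)) ∪ {s, t, u}) = ⊤)
    (hfp : ∀ j, f (p j) = trl (k + 1) n (.ofAdd (Pi.single j 1)))
    (hfq : ∀ j, f (q j) = tvn (k + 1) n (.ofAdd (Pi.single j 1)))
    (hfB : ∀ i, f (χ (B i)) = mtx (k + 1) n (B i)) (hfs : f s = shift (k + 1) n)
    (hft : f t = unt (k + 1) n (five (k + 1))⁻¹) (hfu : f u = unt (k + 1) n (-1)) :
    Nonempty (P ≃* Hol (CE (k + 1) n)) ∧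
      HasHolForm n (k + 3) (Subgroup.closure (Set.range p)) (Subgroup.closure (Set.range q))
        (Subgroup.closure (Set.range fun i => χ (B i))) (Subgroup.closure {s, t, u}) := by
  let α := elemLift p hp hpp
  let β := elemLift q hq hqq
  have hα : ∀ j, α (.ofAdd (Pi.single j 1)) = p j := elemLift_single p hp hpp
  have hβ : ∀ j, β (.ofAdd (Pi.single j 1)) = q j := elemLift_single q hq hqq
  have rα : α.range = Subgroup.closure (Set.range p) := by
    rw [elem_hom_range]
    simp only [hα]
  have rβ : β.range = Subgroup.closure (Set.range q) := by
    rw [elem_hom_range]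
    simp only [hβ]
  have rχ : χ.range = Subgroup.closure (Set.range fun i => χ (B i)) := by
    rw [MonoidHom.range_eq_map, ← hB, MonoidHom.map_closure, ← Set.range_comp]
    rfl
  have hαβ : ∀ x y, Commute (α x) (β y) := by
    intro x y
    have hx : α x ∈ Subgroup.closure (Set.range p) := rα ▸ ⟨x, rfl⟩
    have hy : β y ∈ Subgroup.closure (Set.range q) := rβ ▸ ⟨y, rfl⟩
    refine commute_of_mem_closure ?_ hx
    rintro _ ⟨i, rfl⟩
    refine (commute_of_mem_closure ?_ hy).symm
    rintro _ ⟨j, rfl⟩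
    exact (hpq i j).symm
  have hN : α.range ⊔ β.range = Subgroup.closure (Set.range p ∪ Set.range q) := by
    rw [rα, rβ, Subgroup.closure_union]
  have hfin : Finite (Subgroup.closure (Set.range p ∪ Set.range q)) := by
    rw [← hN, ← MonoidHom.noncommCoprod_range α β hαβ]
    exact Finite.of_surjective _ (MonoidHom.rangeRestrict_surjective _)
  have mp : ∀ {x}, x ∈ Subgroup.closure (Set.range p) →
      x ∈ Subgroup.closure (Set.range p ∪ Set.range q) :=
    fun h => Subgroup.closure_mono Set.subset_union_left h
  have mq : ∀ {x}, x ∈ Subgroup.closure (Set.range q) →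
      x ∈ Subgroup.closure (Set.range p ∪ Set.range q) :=
    fun h => Subgroup.closure_mono Set.subset_union_right h
  have mpi : ∀ i, p i ∈ Subgroup.closure (Set.range p ∪ Set.range q) :=
    fun i => mp (Subgroup.subset_closure ⟨i, rfl⟩)
  have mqi : ∀ i, q i ∈ Subgroup.closure (Set.range p ∪ Set.range q) :=
    fun i => mq (Subgroup.subset_closure ⟨i, rfl⟩)
  have conj_comm : ∀ {x g : P}, Commute x g → g⁻¹ * x * g = x := fun {x g} h => by
    rw [mul_assoc, h.eq, inv_mul_cancel_left]
  have hnorm : (α.range ⊔ β.range).Normal := by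
    rw [hN]
    refine normal_closure_of_conj_mem hgen ?_
    -- There is one case for each kind of generator and each factor. Only the conjugates of `q j` by
    -- `s` mix the two factors.
    rintro g (((⟨i, rfl⟩ | ⟨i, rfl⟩) | ⟨i, rfl⟩) | (rfl | rfl | rfl)) l (⟨j, rfl⟩ | ⟨j, rfl⟩)
    · exact mul_mem (mul_mem (inv_mem (mpi i)) (mpi j)) (mpi i)
    · exact mul_mem (mul_mem (inv_mem (mpi i)) (mqi j)) (mpi i)
    · exact mul_mem (mul_mem (inv_mem (mqi i)) (mpi j)) (mqi i)
    · exact mul_mem (mul_mem (inv_mem (mqi i)) (mqi j)) (mqi i)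
    · exact mp (hχp i j)
    · exact mq (hχq i j)
    · rw [conj_comm (hps j)]
      exact mpi j
    · have := hqs j
      rw [mul_assoc, mul_eq_one_iff_eq_inv] at this
      change cnj (q j) _ ∈ _
      rw [this]
      exact inv_mem (mul_mem (mpi j) (mqi j))
    · rw [conj_comm (hpt j)]
      exact mpi j
    · rw [conj_comm (hqt j)]
      exact mqi j
    · rw [conj_comm (hpu j)]
      exact mpi j
    · rw [conj_comm (hqu j)]
      exact mqi j
  have hgen' : α.range ⊔ β.range ⊔ χ.range ⊔ Subgroup.closure {s, t, u} = ⊤ := by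
    rw [hN, rχ, ← Subgroup.closure_union, ← Subgroup.closure_union, hgen]
  have hX : ∀ x ∈ χ.range, Commute x s ∧ Commute x t ∧ Commute x u := by
    intro x hx
    rw [rχ] at hx
    refine ⟨commute_of_mem_closure ?_ hx, commute_of_mem_closure ?_ hx,
      commute_of_mem_closure ?_ hx⟩ <;> rintro _ ⟨i, rfl⟩
    · exact hχs i
    · exact hχt i
    · exact hχu i
  -- Thus `s ^ 2 ^ (k + 2)` and `t ^ 2 ^ k` are the inverses of `p 0` and `q 0`, hence lie in the
  -- normal subgroup.
  rw [pow_succ 2, Nat.mul_div_cancel _ two_pos, mul_eq_one_iff_eq_inv] at hsp0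
  rw [show k + 3 - 2 = k + 1 from rfl, pow_succ 2, Nat.mul_div_cancel _ two_pos,
    mul_eq_one_iff_eq_inv] at htq0
  simp only [stuRelators, Set.mem_insert_iff, Set.mem_singleton_iff, forall_eq_or_imp,
    forall_eq] at hstu
  obtain ⟨-, -, hu2, htu, hst, hsu⟩ := hstu
  have fα : f.comp α = trl (k + 1) n := elem_hom_ext fun j => by
    rw [MonoidHom.comp_apply, hα, hfp]
  have fβ : f.comp β = tvn (k + 1) n := elem_hom_ext fun j => by
    rw [MonoidHom.comp_apply, hβ, hfq]
  have fχ : f.comp χ = mtx (k + 1) n := MonoidHom.eq_of_eqOn_dense hB (by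
    rintro _ ⟨i, rfl⟩
    exact hfB i)
  have hbij : Function.Bijective f :=
    bijective_of_relations hgen' hαβ hnorm hX (by rw [hsp0, hN]; exact inv_mem (mpi 0))
      (by rw [htq0, hN]; exact inv_mem (mqi 0)) hu2 (cmt_eq_one_iff.1 htu)
      (mul_inv_eq_one.1 hst) (mul_eq_one_iff_eq_inv.1 hsu)
      (surjective_of_generators fα fβ fχ hfs hft hfu)
  refine ⟨⟨MulEquiv.ofBijective f hbij⟩, ?_⟩
  rw [← rα, ← rβ, ← rχ]
  exact hasHolForm_of_bijective hgen' fα fβ fχ hfs hft hfu hbij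

section HolCommutators

variable {k n : ℕ}

lemma trl_eq_one {x : Elem (n + 1)} (h : x = 1) : trl k n x = 1 := by rw [h, map_one]

lemma tvn_eq_one {x : Elem (n + 1)} (h : x = 1) : tvn k n x = 1 := by rw [h, map_one]

lemma cmt_trl_trl (x y : Elem (n + 1)) : cmt (trl k n x) (trl k n y) = 1 :=
  cmt_eq_one_iff.2 ((Commute.all x y).map (trl k n))

lemma cmt_tvn_tvn (x y : Elem (n + 1)) : cmt (tvn k n x) (tvn k n y) = 1 :=
  cmt_eq_one_iff.2 ((Commute.all x y).map (tvn k n))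

lemma cmt_trl_tvn (x y : Elem (n + 1)) : cmt (trl k n x) (tvn k n y) = 1 :=
  cmt_eq_one_iff.2 (commute_trl_tvn x y)

lemma cmt_trl_shift (x : Elem (n + 1)) : cmt (trl k n x) (shift k n) = 1 :=
  cmt_eq_one_iff.2 (commute_shift_trl x).symm

lemma cmt_trl_unt (x : Elem (n + 1)) (u : (ZMod (2 ^ (k + 2)))ˣ) :
    cmt (trl k n x) (unt k n u) = 1 :=
  cmt_eq_one_iff.2 (commute_trl_unt x u)

lemma cmt_tvn_unt (x : Elem (n + 1)) (u : (ZMod (2 ^ (k + 2)))ˣ) :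
    cmt (tvn k n x) (unt k n u) = 1 :=
  cmt_eq_one_iff.2 (commute_tvn_unt x u)

lemma cmt_shift_mtx (B : Aff n) : cmt (shift k n) (mtx k n B) = 1 :=
  cmt_eq_one_iff.2 (commute_shift_mtx B)

lemma cmt_unt_mtx (u : (ZMod (2 ^ (k + 2)))ˣ) (B : Aff n) : cmt (unt k n u) (mtx k n B) = 1 :=
  cmt_eq_one_iff.2 (commute_mtx_unt B u).symm

end HolCommutators

/-! ### The presentations for `n = 2` and `n = 3` -/

/-- The images of the generators of the presentation for `n = 2` in the holomorph. -/
def hol2Gen (k : ℕ) : Gen2 → Hol (CE (k + 1) 2)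
  | .a => trl (k + 1) 2 (.ofAdd (Pi.single 0 1))
  | .b => trl (k + 1) 2 (.ofAdd (Pi.single 1 1))
  | .c => trl (k + 1) 2 (.ofAdd (Pi.single 2 1))
  | .d => tvn (k + 1) 2 (.ofAdd (Pi.single 0 1))
  | .e => tvn (k + 1) 2 (.ofAdd (Pi.single 1 1))
  | .f => tvn (k + 1) 2 (.ofAdd (Pi.single 2 1))
  | .x => mtx (k + 1) 2 s4X
  | .y => mtx (k + 1) 2 s4Y
  | .s => shift (k + 1) 2
  | .t => unt (k + 1) 2 (five (k + 1))⁻¹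
  | .u => unt (k + 1) 2 (-1)

lemma hol2Gen_relators (k : ℕ) : ∀ r ∈ relators2 (k + 3), FreeGroup.lift (hol2Gen k) r = 1 := by
  intro r hr
  simp only [relators2] at hr
  rcases hr with (((((hr | hr) | hr) | hr) | hr) | hr) | hr
  · revert r
    simp only [Set.mem_insert_iff, Set.mem_singleton_iff, forall_eq_or_imp, forall_eq, map_pow,
      map_cmt, FreeGroup.lift_apply_of, hol2Gen, trl_sq, tvn_sq, cmt_trl_trl, cmt_tvn_tvn,
      cmt_trl_tvn, and_self]
  · revert r
    rw [forall_s4Relators_map]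
    simp only [FreeGroup.lift_apply_of, hol2Gen]
    -- As `mtx` is a homomorphism, the relators need only be checked on the matrices.
    rw [← forall_s4Relators_map]
    intro r hr
    rw [s4_relators r hr, map_one]
  · revert r
    simp only [Set.mem_insert_iff, Set.mem_singleton_iff, forall_eq_or_imp, forall_eq, map_mul,
      map_cnj, map_cmt, FreeGroup.lift_apply_of, hol2Gen]
    -- Conjugation by a matrix is right multiplication of rows, so each relator becomes a decidable
    -- identity between vectors over `𝔽₂`.
    simp only [cmt_eq_inv_mul_cnj, cnj_trl_mtx, cnj_tvn_mtx, ← map_inv, ← map_mul]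
    and_intros <;> first
      | with_reducible exact trl_eq_one (by decide)
      | with_reducible exact tvn_eq_one (by decide)
  · revert r
    rw [forall_stuRelators_map]
    simp only [FreeGroup.lift_apply_of, hol2Gen]
    exact hol_stuRelators
  · revert r
    simp only [Set.mem_insert_iff, Set.mem_singleton_iff, forall_eq_or_imp, forall_eq, map_mul,
      map_pow, FreeGroup.lift_apply_of, hol2Gen]
    exact ⟨shift_pow_mul, unt_pow_mul⟩
  · revert r
    simp only [Set.mem_insert_iff, Set.mem_singleton_iff, forall_eq_or_imp, forall_eq, map_mul,
      map_cmt, map_cnj, FreeGroup.lift_apply_of, hol2Gen, cnj_tvn_shift_mul, cmt_trl_shift, cmt_trl_unt,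
      cmt_tvn_unt, and_self]
  · revert r
    simp only [Set.mem_insert_iff, Set.mem_singleton_iff, forall_eq_or_imp, forall_eq, map_cmt,
      FreeGroup.lift_apply_of, hol2Gen, cmt_shift_mtx, cmt_unt_mtx, and_self]

/-- The images of the generators of the presentation for `n = 3` in the holomorph. -/
def hol3Image (k : ℕ) : Gen3 → Hol (CE (k + 1) 3)
  | .p j => trl (k + 1) 3 (.ofAdd (Pi.single j 1))
  | .q j => tvn (k + 1) 3 (.ofAdd (Pi.single j 1))
  | .h i => mtx (k + 1) 3 (hol3Gen i)
  | .s => shift (k + 1) 3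
  | .t => unt (k + 1) 3 (five (k + 1))⁻¹
  | .u => unt (k + 1) 3 (-1)

lemma prod_ofFn_single_pow (v : Fin 4 → ZMod 2) :
    (List.ofFn fun l => (.ofAdd (Pi.single l 1) : Elem 4) ^ (v l).val).prod = .ofAdd v := by
  revert v
  decide

lemma hol3Image_relators (k : ℕ) :
    ∀ r ∈ relators3 (k + 3), FreeGroup.lift (hol3Image k) r = 1 := by
  intro r hr
  simp only [relators3] at hr
  rcases hr with (((((((((⟨j, hr⟩ | ⟨i, j, hr⟩) | hr) | ⟨i, j, hr⟩) | ⟨i, j, hr⟩) | hr) | hr) |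
    ⟨j, hr⟩) | ⟨j, hr⟩) | ⟨i, hr⟩)
  · rcases hr with rfl | rfl <;> simp only [map_pow, FreeGroup.lift_apply_of, hol3Image]
    · exact trl_sq _
    · exact tvn_sq _
  · rcases hr with rfl | rfl | rfl <;>
      simp only [map_cmt, FreeGroup.lift_apply_of, hol3Image, cmt_trl_trl, cmt_trl_tvn, cmt_tvn_tvn]
  · revert r
    rw [forall_hol3Relators_map]
    simp only [FreeGroup.lift_apply_of, hol3Image]
    rw [← forall_hol3Relators_map]
    intro r hr
    rw [hol3Gen_relators r hr, map_one]
  · rw [hr, map_mul, map_cnj, map_inv, map_list_prod, List.map_ofFn, mul_inv_eq_one]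
    simp only [Function.comp_def, map_pow, FreeGroup.lift_apply_of, hol3Image, cnj_trl_mtx]
    simp only [← map_pow]
    rw [← prod_ofFn_single_pow, map_list_prod, List.map_ofFn, toAdd_ofAdd, single_one_vecMul]
    rfl
  · rw [hr, map_mul, map_cnj, map_inv, map_list_prod, List.map_ofFn, mul_inv_eq_one]
    simp only [Function.comp_def, map_pow, FreeGroup.lift_apply_of, hol3Image, cnj_tvn_mtx]
    simp only [← map_pow]
    rw [← prod_ofFn_single_pow, map_list_prod, List.map_ofFn, toAdd_ofAdd, single_one_vecMul]
    rfl
  · revert r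
    rw [forall_stuRelators_map]
    simp only [FreeGroup.lift_apply_of, hol3Image]
    exact hol_stuRelators
  · revert r
    simp only [Set.mem_insert_iff, Set.mem_singleton_iff, forall_eq_or_imp, forall_eq, map_mul,
      map_pow, FreeGroup.lift_apply_of, hol3Image]
    exact ⟨shift_pow_mul, unt_pow_mul⟩
  · rcases hr with rfl | rfl <;>
      simp only [map_mul, map_cmt, map_cnj, FreeGroup.lift_apply_of, hol3Image, cmt_trl_shift,
        cnj_tvn_shift_mul]
  · rcases hr with rfl | rfl | rfl | rfl <;>
      simp only [map_cmt, FreeGroup.lift_apply_of, hol3Image, cmt_trl_unt, cmt_tvn_unt]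
  · rcases hr with rfl | rfl | rfl <;>
      simp only [map_cmt, FreeGroup.lift_apply_of, hol3Image, cmt_shift_mtx, cmt_unt_mtx]

/-- Since the relators present `Aff 2`, elements that satisfy them receive a homomorphism from it;
this supplies the `χ` of the recognition lemma. -/
lemma exists_hom_Aff_two {P : Type} [Group P] {x y : P} (h : ∀ r ∈ s4Relators x y, r = 1) :
    ∃ χ : Aff 2 →* P, ∀ i, χ (![s4X, s4Y] i) = ![x, y] i := by
  have hr : ∀ r ∈ s4Relators (FreeGroup.of (0 : Fin 2)) (FreeGroup.of 1),
      FreeGroup.lift ![x, y] r = 1 := by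
    rw [forall_s4Relators_map]
    simpa using h
  refine ⟨(PresentedGroup.toGroup hr).comp presS4Equiv.symm.toMonoidHom, fun i => ?_⟩
  rw [← presS4Equiv_of]
  change PresentedGroup.toGroup hr (presS4Equiv.symm (presS4Equiv _)) = _
  rw [MulEquiv.symm_apply_apply]
  exact PresentedGroup.toGroup.of hr

lemma exists_hom_Aff_three {P : Type} [Group P] {g : Fin 4 → P}
    (h : ∀ r ∈ hol3Relators (g 0) (g 1) (g 2) (g 3), r = 1) :
    ∃ χ : Aff 3 →* P, ∀ i, χ (hol3Gen i) = g i := by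
  have hr : ∀ r ∈ hol3Relators (FreeGroup.of (0 : Fin 4)) (FreeGroup.of 1) (FreeGroup.of 2)
      (FreeGroup.of 3), FreeGroup.lift g r = 1 := by
    rw [forall_hol3Relators_map]
    simpa using h
  refine ⟨(PresentedGroup.toGroup hr).comp presHol3Equiv.symm.toMonoidHom, fun i => ?_⟩
  rw [← presHol3Equiv_of]
  change PresentedGroup.toGroup hr (presHol3Equiv.symm (presHol3Equiv _)) = _
  rw [MulEquiv.symm_apply_apply]
  exact PresentedGroup.toGroup.of hr

section Membership

variable {P : Type} [Group P] {K : Subgroup P} {g x y z : P}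

lemma cnj_mem_of_commute (hg : g ∈ K) (h : Commute g x) : cnj g x ∈ K := by
  rwa [cnj, mul_assoc, h.eq, inv_mul_cancel_left]

lemma mem_of_mul_mul_eq_one (hx : x ∈ K) (hy : y ∈ K) (h : g * x * y = 1) : g ∈ K := by
  have := h ▸ K.one_mem
  rwa [K.mul_mem_cancel_right hy, K.mul_mem_cancel_right hx] at this

lemma mem_of_mul_mul_mul_eq_one (hx : x ∈ K) (hy : y ∈ K) (hz : z ∈ K)
    (h : g * x * y * z = 1) : g ∈ K := by
  have := h ▸ K.one_mem
  rwa [K.mul_mem_cancel_right hz, K.mul_mem_cancel_right hy, K.mul_mem_cancel_right hx] at this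

end Membership

lemma forall_fin_three {p : Fin 3 → Prop} : (∀ i, p i) ↔ p 0 ∧ p 1 ∧ p 2 := by
  simp [Fin.forall_fin_succ]

lemma range_vec_two {α : Type*} (x y : α) : Set.range ![x, y] = {x, y} := by
  ext z
  simp [eq_comm, or_comm]

lemma range_vec_three {α : Type*} (x y z : α) : Set.range ![x, y, z] = {x, y, z} := by
  ext w
  simp only [Set.mem_range, Fin.exists_fin_succ, Set.mem_insert_iff, Set.mem_singleton_iff]
  simp [eq_comm]

/-- The presented group enters only through `φ`, so that the images of the generators can be
replaced by variables. -/
lemma nonempty_mulEquiv_and_hasHolForm_two {k : ℕ} {P : Type} [Group P]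
    (φ : FreeGroup Gen2 →* P) (hrel : ∀ r ∈ relators2 (k + 3), φ r = 1)
    (hgen : Subgroup.closure (Set.range fun g => φ (.of g)) = ⊤) (F : P →* Hol (CE (k + 1) 2))
    (hF : ∀ g, F (φ (.of g)) = hol2Gen k g) :
    Nonempty (P ≃* Hol (CE (k + 1) 2)) ∧
    HasHolForm 2 (k + 3) (Subgroup.closure {φ (.of .a), φ (.of .b), φ (.of .c)})
      (Subgroup.closure {φ (.of .d), φ (.of .e), φ (.of .f)})
      (Subgroup.closure {φ (.of .x), φ (.of .y)})
      (Subgroup.closure {φ (.of .s), φ (.of .t), φ (.of .u)}) := by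
  simp only [relators2, Set.mem_union, or_imp, forall_and] at hrel
  obtain ⟨⟨⟨⟨⟨⟨r1, r2⟩, r3⟩, r4⟩, r5⟩, r6⟩, r7⟩ := hrel
  rw [forall_s4Relators_map] at r2
  rw [forall_stuRelators_map] at r4
  simp only [Set.mem_insert_iff, Set.mem_singleton_iff, forall_eq_or_imp, forall_eq, map_mul,
    map_pow, map_cmt, map_cnj, cmt_eq_one_iff] at r1 r3 r5 r6 r7
  have hgen' : Subgroup.closure ({φ (.of .a), φ (.of .b), φ (.of .c)} ∪
      {φ (.of .d), φ (.of .e), φ (.of .f)} ∪ {φ (.of .x), φ (.of .y)} ∪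
      {φ (.of .s), φ (.of .t), φ (.of .u)}) = ⊤ := by
    rw [eq_top_iff, ← hgen]
    apply Subgroup.closure_mono
    rintro _ ⟨g, rfl⟩
    cases g <;> simp
  have hFa := hF .a
  have hFb := hF .b
  have hFc := hF .c
  have hFd := hF .d
  have hFe := hF .e
  have hFf := hF .f
  have hFx := hF .x
  have hFy := hF .y
  have hFs := hF .s
  have hFt := hF .t
  have hFu := hF .u
  generalize φ (.of .a) = a at *
  generalize φ (.of .b) = b at *
  generalize φ (.of .c) = c at *
  generalize φ (.of .d) = d at *
  generalize φ (.of .e) = e at *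
  generalize φ (.of .f) = f at *
  generalize φ (.of .x) = x at *
  generalize φ (.of .y) = y at *
  generalize φ (.of .s) = s at *
  generalize φ (.of .t) = t at *
  generalize φ (.of .u) = u at *
  obtain ⟨a2, b2, c2, d2, e2, f2, ab, ac, ad, ae, af, bc, bd, be, bf, cd, ce, cf, de, df, ef⟩ := r1
  obtain ⟨ax, bx, cx, ay, bY, cy, dx, ex, fx, dy, ey, fy⟩ := r3
  obtain ⟨as, bs, cs, ds, es, fs, at', bt, ct, dt, et, ft, au, bu, cu, du, eu, fu⟩ := r6
  obtain ⟨sx, sy, tx, ty, ux, uy⟩ := r7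
  obtain ⟨χ, hχ⟩ := exists_hom_Aff_two r2
  have hX : (Set.range fun i => χ (![s4X, s4Y] i)) = {x, y} := by
    simp only [hχ]
    exact range_vec_two x y
  have mem3 : ∀ {v : Fin 3 → P} (i), v i ∈ Subgroup.closure (Set.range v) :=
    fun i => Subgroup.subset_closure ⟨i, rfl⟩
  have ma : a ∈ Subgroup.closure (Set.range ![a, b, c]) := mem3 0
  have mb : b ∈ Subgroup.closure (Set.range ![a, b, c]) := mem3 1
  have mc : c ∈ Subgroup.closure (Set.range ![a, b, c]) := mem3 2
  have md : d ∈ Subgroup.closure (Set.range ![d, e, f]) := mem3 0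
  have me : e ∈ Subgroup.closure (Set.range ![d, e, f]) := mem3 1
  have mf : f ∈ Subgroup.closure (Set.range ![d, e, f]) := mem3 2
  rw [← range_vec_three a b c, ← range_vec_three d e f, ← hX] at hgen' ⊢
  refine nonempty_mulEquiv_and_hasHolForm (B := ![s4X, s4Y]) F
    (forall_fin_three.2 ⟨a2, b2, c2⟩) (forall_fin_three.2 ⟨d2, e2, f2⟩)
    (forall_fin_three.2 ⟨?_, ?_, ?_⟩) (forall_fin_three.2 ⟨?_, ?_, ?_⟩)
    (forall_fin_three.2 ⟨?_, ?_, ?_⟩) (by rw [range_vec_two]; exact closure_s4)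
    (Fin.forall_fin_two.2 ?_) (Fin.forall_fin_two.2 ?_)
    (Fin.forall_fin_two.2 ?_) (Fin.forall_fin_two.2 ?_) (Fin.forall_fin_two.2 ?_)
    (forall_fin_three.2 ⟨as, bs, cs⟩) (forall_fin_three.2 ⟨ds, es, fs⟩)
    (forall_fin_three.2 ⟨at', bt, ct⟩) (forall_fin_three.2 ⟨dt, et, ft⟩)
    (forall_fin_three.2 ⟨au, bu, cu⟩) (forall_fin_three.2 ⟨du, eu, fu⟩)
    r4 r5.1 r5.2 hgen' (forall_fin_three.2 ⟨hFa, hFb, hFc⟩) (forall_fin_three.2 ⟨hFd, hFe, hFf⟩)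
    (Fin.forall_fin_two.2 ?_) hFs hFt hFu
  · exact forall_fin_three.2 ⟨.refl a, ab, ac⟩
  · exact forall_fin_three.2 ⟨ab.symm, .refl b, bc⟩
  · exact forall_fin_three.2 ⟨ac.symm, bc.symm, .refl c⟩
  · exact forall_fin_three.2 ⟨ad, ae, af⟩
  · exact forall_fin_three.2 ⟨bd, be, bf⟩
  · exact forall_fin_three.2 ⟨cd, ce, cf⟩
  · exact forall_fin_three.2 ⟨.refl d, de, df⟩
  · exact forall_fin_three.2 ⟨de.symm, .refl e, ef⟩
  · exact forall_fin_three.2 ⟨df.symm, ef.symm, .refl f⟩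
  · rw [hχ, hχ]
    exact ⟨forall_fin_three.2 ⟨cnj_mem_of_commute ma ax, mem_of_mul_mul_eq_one ma mb bx,
      mem_of_mul_mul_mul_eq_one ma mb mc cx⟩, forall_fin_three.2 ⟨cnj_mem_of_commute ma ay,
      mem_of_mul_mul_mul_eq_one ma mb mc bY, mem_of_mul_mul_eq_one ma mc cy⟩⟩
  · rw [hχ, hχ]
    exact ⟨forall_fin_three.2 ⟨cnj_mem_of_commute md dx, mem_of_mul_mul_eq_one md me ex,
      mem_of_mul_mul_mul_eq_one md me mf fx⟩, forall_fin_three.2 ⟨cnj_mem_of_commute md dy,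
      mem_of_mul_mul_mul_eq_one md me mf ey, mem_of_mul_mul_eq_one md mf fy⟩⟩
  · rw [hχ, hχ]
    exact ⟨sx.symm, sy.symm⟩
  · rw [hχ, hχ]
    exact ⟨tx.symm, ty.symm⟩
  · rw [hχ, hχ]
    exact ⟨ux.symm, uy.symm⟩
  · rw [hχ, hχ]
    exact ⟨hFx, hFy⟩

lemma nonempty_mulEquiv_and_hasHolForm_three {k : ℕ} {P : Type} [Group P]
    (φ : FreeGroup Gen3 →* P) (hrel : ∀ r ∈ relators3 (k + 3), φ r = 1)
    (hgen : Subgroup.closure (Set.range fun g => φ (.of g)) = ⊤) (F : P →* Hol (CE (k + 1) 3))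
    (hF : ∀ g, F (φ (.of g)) = hol3Image k g) :
    Nonempty (P ≃* Hol (CE (k + 1) 3)) ∧
    HasHolForm 3 (k + 3) (Subgroup.closure (Set.range fun j => φ (.of (.p j))))
      (Subgroup.closure (Set.range fun j => φ (.of (.q j))))
      (Subgroup.closure (Set.range fun i => φ (.of (.h i))))
      (Subgroup.closure {φ (.of .s), φ (.of .t), φ (.of .u)}) := by
  simp only [relators3, Set.mem_union, or_imp, forall_and] at hrel
  obtain ⟨⟨⟨⟨⟨⟨⟨⟨⟨r1, r2⟩, r3⟩, r4⟩, r5⟩, r6⟩, r7⟩, r8⟩, r9⟩, r10⟩ := hrel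
  rw [forall_hol3Relators_map] at r3
  rw [forall_stuRelators_map] at r6
  obtain ⟨χ, hχ⟩ := exists_hom_Aff_three (g := fun i => φ (.of (.h i))) r3
  simp only [Set.mem_insert_iff, Set.mem_singleton_iff, forall_eq_or_imp, forall_eq, map_mul,
    map_pow] at r7
  have hX : (fun i => φ (.of (.h i))) = fun i => χ (hol3Gen i) := funext fun i => (hχ i).symm
  have conj_mem : ∀ {v : Fin 4 → FreeGroup Gen3} {j : Fin 4} {g : FreeGroup Gen3}
      {w : Fin 4 → ℕ}, φ (cnj (v j) g * (List.ofFn fun l => v l ^ w l).prod⁻¹) = 1 →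
      cnj (φ (v j)) (φ g) ∈ Subgroup.closure (Set.range fun j => φ (v j)) := by
    intro v j g w h
    rw [map_mul, map_inv, mul_inv_eq_one, map_cnj, map_list_prod, List.map_ofFn] at h
    rw [h]
    refine Subgroup.list_prod_mem _ fun z hz => ?_
    obtain ⟨l, rfl⟩ := (List.mem_ofFn' _ _).1 hz
    rw [Function.comp_apply, map_pow]
    exact pow_mem (Subgroup.subset_closure (Set.mem_range_self (f := fun j => φ (v j)) l)) _
  have com : ∀ {g h : FreeGroup Gen3}, φ (cmt g h) = 1 → Commute (φ g) (φ h) := fun h =>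
    cmt_eq_one_iff.1 (by rwa [map_cmt] at h)
  rw [hX]
  refine nonempty_mulEquiv_and_hasHolForm (B := hol3Gen) F
    (fun j => ?_) (fun j => ?_) (fun i j => com (r2 _ ⟨i, j, .inl rfl⟩))
    (fun i j => com (r2 _ ⟨i, j, .inr (.inl rfl)⟩)) (fun i j => com (r2 _ ⟨i, j, .inr (.inr rfl)⟩))
    closure_hol3Gen (fun i j => ?_) (fun i j => ?_) (fun i => ?_) (fun i => ?_) (fun i => ?_)
    (fun j => com (r8 _ ⟨j, .inl rfl⟩)) (fun j => ?_)
    (fun j => com (r9 _ ⟨j, .inl rfl⟩)) (fun j => com (r9 _ ⟨j, .inr (.inl rfl)⟩))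
    (fun j => com (r9 _ ⟨j, .inr (.inr (.inl rfl))⟩))
    (fun j => com (r9 _ ⟨j, .inr (.inr (.inr rfl))⟩))
    r6 r7.1 r7.2 ?_ (fun j => hF (.p j)) (fun j => hF (.q j)) (fun i => ?_) (hF .s) (hF .t) (hF .u)
  · rw [← map_pow]
    exact r1 _ ⟨j, .inl rfl⟩
  · rw [← map_pow]
    exact r1 _ ⟨j, .inr rfl⟩
  · rw [hχ]
    exact conj_mem (r4 _ ⟨i, j, rfl⟩)
  · rw [hχ]
    exact conj_mem (r5 _ ⟨i, j, rfl⟩)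
  · rw [hχ]
    exact (com (r10 _ ⟨i, .inl rfl⟩)).symm
  · rw [hχ]
    exact (com (r10 _ ⟨i, .inr (.inl rfl)⟩)).symm
  · rw [hχ]
    exact (com (r10 _ ⟨i, .inr (.inr rfl)⟩)).symm
  · rw [← map_cnj, ← map_mul, ← map_mul]
    exact r8 _ ⟨j, .inr rfl⟩
  · rw [← hX, eq_top_iff, ← hgen]
    apply Subgroup.closure_mono
    rintro _ ⟨g, rfl⟩
    cases g <;> simp
  · rw [hχ]
    exact hF (.h i)

lemma pres2_isHol (k : ℕ) : Nonempty (Pres2 (k + 3) ≃* Hol (CE (k + 1) 2)) ∧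
    HasHolForm 2 (k + 3) (P := Pres2 (k + 3))
      (Subgroup.closure {.of .a, .of .b, .of .c}) (Subgroup.closure {.of .d, .of .e, .of .f})
      (Subgroup.closure {.of .x, .of .y}) (Subgroup.closure {.of .s, .of .t, .of .u}) :=
  nonempty_mulEquiv_and_hasHolForm_two (PresentedGroup.mk (relators2 (k + 3)))
    (fun _ hr => PresentedGroup.one_of_mem hr) (PresentedGroup.closure_range_of _)
    (PresentedGroup.toGroup (hol2Gen_relators k))
    fun _ => PresentedGroup.toGroup.of (hol2Gen_relators k)

lemma pres3_isHol (k : ℕ) : Nonempty (Pres3 (k + 3) ≃* Hol (CE (k + 1) 3)) ∧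
    HasHolForm 3 (k + 3) (P := Pres3 (k + 3))
      (Subgroup.closure (Set.range fun j => .of (.p j)))
      (Subgroup.closure (Set.range fun j => .of (.q j)))
      (Subgroup.closure (Set.range fun i => .of (.h i)))
      (Subgroup.closure {.of .s, .of .t, .of .u}) :=
  nonempty_mulEquiv_and_hasHolForm_three (PresentedGroup.mk (relators3 (k + 3)))
    (fun _ hr => PresentedGroup.one_of_mem hr) (PresentedGroup.closure_range_of _)
    (PresentedGroup.toGroup (hol3Image_relators k))
    fun _ => PresentedGroup.toGroup.of (hol3Image_relators k)

/-! ### The matrix representation of `Hol(1^3)` and the numerical orders -/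

/-- The faithful representation of the presented group by the matrices `t_1, …, t_4`. -/
noncomputable def presHol3Rep : PresHol3 →* GL (Fin 4) (ZMod 2) :=
  (Aff 3).subtype.comp presHol3Equiv.toMonoidHom

lemma presHol3Rep_injective : Function.Injective presHol3Rep :=
  (Aff 3).subtype_injective.comp presHol3Equiv.injective

lemma presHol3Rep_of (i : Fin 4) :
    (presHol3Rep (.of i) : Matrix (Fin 4) (Fin 4) (ZMod 2)) = holMat i := by
  rw [← hol3Gen_val, ← presHol3Equiv_of]
  rfl

lemma card_hol_elem_three : Nat.card (Hol (Elem 3)) = 1344 := by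
  rw [card_hol_elem]
  decide

lemma card_hol_elem_four : Nat.card (Hol (Elem 4)) = 322560 := by
  rw [card_hol_elem]
  decide

end

theorem mainTheorem5 :
    -- the structure of the holomorph of `C_x × 1^n`, `x = 2^m`
    (∀ m n : ℕ, 2 ≤ m →
      ∃ S : GroupExtension (Elem (n + 1) × Elem (n + 1)) (Hol (Cyc (2 ^ m) × Elem n))
          (Hol (Elem n) × Hol (Cyc (2 ^ (m - 1)))),
        3 ≤ m → IsEmpty S.Splitting) ∧
    -- the case `n = 2`
    (Nonempty (Hol (Elem 2) ≃* Equiv.Perm (Fin 4)) ∧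
      Nonempty (PresentedGroup (s4Relators (FreeGroup.of (0 : Fin 2)) (FreeGroup.of 1)) ≃*
        Hol (Elem 2)) ∧
      ∀ m : ℕ, 3 ≤ m →
        Nonempty (Pres2 m ≃* Hol (Cyc (2 ^ m) × Elem 2)) ∧
        HasHolForm 2 m (P := Pres2 m)
          (Subgroup.closure {.of .a, .of .b, .of .c})
          (Subgroup.closure {.of .d, .of .e, .of .f})
          (Subgroup.closure {.of .x, .of .y})
          (Subgroup.closure {.of .s, .of .t, .of .u})) ∧
    -- the case `n = 3`
    ((∃ φ : PresHol3 →* GL (Fin 4) (ZMod 2),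
        Function.Injective φ ∧
        (∀ i : Fin 4, (φ (.of i) : Matrix (Fin 4) (Fin 4) (ZMod 2)) = holMat i) ∧
        Nonempty (φ.range ≃* Hol (Elem 3))) ∧
      Nat.card (Hol (Elem 3)) = 1344 ∧
      ∀ m : ℕ, 3 ≤ m →
        Nonempty (Pres3 m ≃* Hol (Cyc (2 ^ m) × Elem 3)) ∧
        HasHolForm 3 m (P := Pres3 m)
          (Subgroup.closure (Set.range fun j => .of (.p j)))
          (Subgroup.closure (Set.range fun j => .of (.q j)))
          (Subgroup.closure (Set.range fun i => .of (.h i)))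
          (Subgroup.closure {.of .s, .of .t, .of .u})) ∧
    -- the order of the next holomorph, `n = 4`
    Nat.card (Hol (Elem 4)) = 322560 := by
  refine ⟨fun m n hm => ?_, ⟨⟨((affEquiv 2).symm.trans presS4Equiv.symm).trans presS4EquivPerm⟩,
    ⟨presS4Equiv.trans (affEquiv 2)⟩, fun m hm => ?_⟩,
    ⟨⟨presHol3Rep, presHol3Rep_injective, presHol3Rep_of,
      ⟨((MonoidHom.ofInjective presHol3Rep_injective).symm.trans presHol3Equiv).trans
        (affEquiv 3)⟩⟩, card_hol_elem_three, fun m hm => ?_⟩, card_hol_elem_four⟩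
  -- Here `m = k + 2`, so `m ≥ 3` means `k ≥ 1`; in the two presentations `m = k + 3`.
  · obtain ⟨k, rfl⟩ := Nat.exists_eq_add_of_le' hm
    exact ⟨holExtension k n, fun h => isEmpty_splitting_holExtension k n (by omega)⟩
  · obtain ⟨k, rfl⟩ := Nat.exists_eq_add_of_le' hm
    exact pres2_isHol k
  · obtain ⟨k, rfl⟩ := Nat.exists_eq_add_of_le' hm
    exact pres3_isHol k
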